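/- Let $n\ge 3$ and $0\le k\le n$ be integers. Let $\Pi_{k,n}$ be the set of partitions $\mu=(\mu_1\ge\dots\ge\mu_k\ge 0)$ with $\mu_1\le n-k$; write $|\mu|=\sum_i\mu_i$, $\ell(\mu)$ for the number of nonzero parts, $m_i(\mu)$ for the multiplicity of $i$, and $\mu'\in\Pi_{n-k,n}$ for the conjugate partition. The binary string $b^\mu=b^\mu_n\cdots b^\mu_1$ has its $k$ one-letters at the positions $\mu_{k+1-i}+i$ $(1\le i\le k)$, and $b^{\mu'}$ (with $n-k$ one-letters) is defined in the same way. All positions are read modulo $n$. *Quantum Kostka numbers.* Let $qH^*(\mathrm{Gr}_k(\mathbb C^n))=\mathbb Z[q][e_1,\dots,e_k]/\langle h_{n-k+1},\dots,h_{n-1},h_n+(-1)^kq\rangle$ with $h_r=\det(e_{1-i+j})_{1\le i,j\le r}$, where $e_0=1$ and $e_m=0$ for $m<0$ or $m>k$ (there are $k$ relations; none if $k=0$), and put $\sigma_\mu=\det(h_{\mu_i-i+j})_{1\le i,j\le k}$, where $h_r=0$ for $r<0$. For $\lambda,\mu\in\Pi_{k,n}$ there is a unique expansion $$\sigma_\mu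 * h_{\lambda_1}*\cdots*h_{\lambda_k}=\sum_{\nu\in\Pi_{k,n}}c_\nu(q)\,\sigma_\nu,\qquad c_\nu(q)\in\mathbb Z[q],$$ and $q^d$ occurs in $c_\nu$ only if $nd=|\lambda|+|\mu|-|\nu|$. For this $d$ let $K_{\nu/d/\mu,\lambda}$ be the coefficient of $q^d$ in $c_\nu$; put $K_{\nu/d/\mu,\lambda}=0$ if $(|\lambda|+|\mu|-|\nu|)/n$ is not a nonnegative integer. *Dimers.* Consider the honeycomb lattice on a cylinder with $k$ rows and circumference $n$: row $i$ has lower vertices $D_{i,j}$ and upper vertices $U_{i,j}$ $(j\in\mathbb Z/n)$, with horizontal edges $D_{i,j}U_{i,j-1}$ and slanted edges $D_{i,j}U_{i,j}$; vertical edges join $U_{i,j}$ to $D_{i+1,j}$, and there are $n$ outer vertical edges at the bottom, ending in the $D_{1,j}$, and $n$ at the top, ending in the $U_{k,j}$ (if $k=0$ the lattice consists of $n$ vertical edges, each being both a bottom and a top edge). A dimer configuration is a set of edges such that each vertex $D_{i,j}$, $U_{i,j}$ lies on exactly one of them. Let $\Gamma(\mu,\nu)$ be the set of dimer configurations in which the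 occupied bottom and top edges are the one-letters of $b^\mu$ and of $b^\nu$, respectively, and let $\Gamma_\alpha(\mu,\nu)$ be the subset of those with exactly $\alpha_i$ horizontal dimers in row $i$ for $i=1,\dots,k$. *Crystals.* Let $B_r$ be the Kirillov–Reshetikhin crystal of binary strings $b$ of length $n$ with $r$ one-letters; $f_i$ $(i\in\mathbb Z/n)$ moves a one-letter from position $i$ to position $i+1$ if $b_i=1$, $b_{i+1}=0$, and gives $\emptyset$ otherwise; $e_i$ is the inverse operation. Let $\varphi_i$, $\varepsilon_i$ be the maximal numbers of times that $f_i$, $e_i$ can be applied. In tensor products, $e_i(b_1\otimes b_2)=e_i(b_1)\otimes b_2$ if $\varepsilon_i(b_1)>\varphi_i(b_2)$ and $b_1\otimes e_i(b_2)$ otherwise; $f_i(b_1\otimes b_2)=f_i(b_1)\otimes b_2$ if $\varepsilon_i(b_1)\ge\varphi_i(b_2)$ and $b_1\otimes f_i(b_2)$ otherwise. Let $B_\lambda=B_{\lambda_1}\otimes\cdots\otimes B_{\lambda_k}$, let $\Omega:B_\lambda\to B_\lambda$ shift all one-letters of all factors from $j$ to $j+1$ modulo $n$, and let $R_\lambda:B_{n-k}\otimes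 B_\lambda\to B_\lambda\otimes B_{n-k}$ be the combinatorial $R$-matrix, i.e. the crystal isomorphism (bijection commuting with all $e_i,f_i$). Let $B_\lambda(\mu,\nu)$ be the set of $b\in B_\lambda$ such that 1. $d=(|\lambda|+|\mu|-|\nu|)/n$ is an integer and, for $1\le i\le n$, $\varphi_i(b)=b^\mu_{n-i}\Theta_i$ and $\varepsilon_i(b)=b^\nu_{n-i}\Theta_{i+1}$, where $\Theta_i=1$ if $d+\sum_{j=n+1-i}^n(b^\nu_j-b^\mu_j)>0$, $\Theta_i=0$ otherwise, and $\Theta_{n+1}=\Theta_1$; and 2. $R_\lambda(b^{\mu'}\otimes\Omega(b))=b\otimes b^{\nu'}$. **Theorem (Sum rule for quantum Kostka numbers).** (i) For all $\lambda,\mu,\nu\in\Pi_{k,n}$, $$K_{\nu/d/\mu,\lambda}=|\Gamma_\lambda(\mu,\nu)|=|B_\lambda(\mu,\nu)|.$$ (ii) For all $\mu,\nu\in\Pi_{k,n}$, with $\alpha$ running over all $(\alpha_1,\dots,\alpha_k)$ with $0\le\alpha_i\le n-k$, $$|\Gamma(\mu,\nu)|=\sum_\alpha|\Gamma_\alpha(\mu,\nu)|=\sum_{\lambda\in\Pi_{k,n}}K_{\nu/d/\mu,\lambda}\,\frac{\ell(\lambda)!}{\prod_{i\ge1}m_i(\lambda)!}\binom{k}{\ell(\lambda)}.$$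 -/

import Mathlib

open Polynomial

noncomputable section

namespace QKostka

/-! ### Partitions in a box and binary strings -/

/-- Partitions whose Young diagram fits into a box of height `k` and width `n - k`, written with
exactly `k` (possibly zero) parts `parts 0 ≥ parts 1 ≥ ⋯ ≥ parts (k - 1)`. -/
@[ext]
structure BoxPartition (n k : ℕ) where
  parts : Fin k → ℕ
  anti : Antitone parts
  le : ∀ i, parts i ≤ n - k

theorem BoxPartition.finite (n k : ℕ) : Finite (BoxPartition n k) := by
  refine Finite.of_injective
    (fun (p : BoxPartition n k) (i : Fin k) => (⟨p.parts i, Nat.lt_succ_of_le (p.le i)⟩ :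
      Fin (n - k + 1))) ?_
  intro p r h
  ext i
  simpa using congrArg Fin.val (congrFun h i)

instance (n k : ℕ) : Fintype (BoxPartition n k) :=
  @Fintype.ofFinite _ (BoxPartition.finite n k)

/-- The sum of the parts. -/
def BoxPartition.size {n k : ℕ} (p : BoxPartition n k) : ℕ := ∑ i, p.parts i

/-- The number of nonzero parts. -/
def BoxPartition.length {n k : ℕ} (p : BoxPartition n k) : ℕ :=
  (Finset.univ.filter fun i => p.parts i ≠ 0).card

/-- The multiplicity of `m` among the parts. -/
def BoxPartition.mult {n k : ℕ} (p : BoxPartition n k) (m : ℕ) : ℕ :=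
  (Finset.univ.filter fun i => p.parts i = m).card

/-- The parts of the conjugate partition: its `j`-th part is the number of parts exceeding `j`
(rows and columns counted from `0`). -/
def BoxPartition.conj {n k : ℕ} (p : BoxPartition n k) : Fin (n - k) → ℕ :=
  fun j => (Finset.univ.filter fun i => (j : ℕ) < p.parts i).card

/-- The binary string of length `n` attached to a sequence of `m` parts, given as the set of
positions of its one-letters. Positions are `1, …, n` read modulo `n`. The part with (zero-based)
index `i` gives a one-letter at position `p i + m - i`. -/
def bstring (n : ℕ) {m : ℕ} (p : Fin m → ℕ) : Finset (ZMod n) :=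
  Finset.univ.image fun i : Fin m => ((p i + (m - (i : ℕ)) : ℕ) : ZMod n)

/-! ### Dimer configurations on the honeycomb lattice on a cylinder

The lattice has `k` rows and circumference `n`. Row `i` is a closed zigzag through the `2n`
vertices `lower i j`, `upper i j`. -/

inductive Vertex (n k : ℕ) where
  | lower (i : Fin k) (j : ZMod n)
  | upper (i : Fin k) (j : ZMod n)

/-- `vertical l j`, for `l = 0, …, k`, are the vertical edges; those with `l = 0` stick out at the
bottom and those with `l = k` at the top of the cylinder. `horizontal i j` and `slanted i j` are
the edges of the `i`-th zigzag. -/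
inductive Edge (n k : ℕ) where
  | vertical (l : Fin (k + 1)) (j : ZMod n)
  | horizontal (i : Fin k) (j : ZMod n)
  | slanted (i : Fin k) (j : ZMod n)

/-- The vertices of the lattice on an edge. -/
def Edge.ends {n k : ℕ} : Edge n k → Set (Vertex n k)
  | .vertical l j => {v | ∃ i : Fin k,
      (i.castSucc = l ∧ v = .lower i j) ∨ (i.succ = l ∧ v = .upper i j)}
  | .horizontal i j => {.lower i j, .upper i (j - 1)}
  | .slanted i j => {.lower i j, .upper i j}

/-- A dimer configuration: every vertex lies on exactly one of the chosen edges. -/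
def IsDimerConfig {n k : ℕ} (M : Set (Edge n k)) : Prop :=
  ∀ v : Vertex n k, ∃! e : Edge n k, e ∈ M ∧ v ∈ e.ends

/-- Dimer configurations with bottom edges occupied according to `μ` and top edges according
to `ν`. -/
def dimers {n k : ℕ} (μ ν : BoxPartition n k) : Set (Set (Edge n k)) :=
  {M | IsDimerConfig M ∧
    (∀ j, Edge.vertical 0 j ∈ M ↔ j ∈ bstring n μ.parts) ∧
    (∀ j, Edge.vertical (Fin.last k) j ∈ M ↔ j ∈ bstring n ν.parts)}

/-- Those having, in addition, exactly `α i` horizontal dimers in row `i`. -/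
def dimersWith {n k : ℕ} (α : Fin k → ℕ) (μ ν : BoxPartition n k) : Set (Set (Edge n k)) :=
  {M | M ∈ dimers μ ν ∧ ∀ i, {j : ZMod n | Edge.horizontal i j ∈ M}.ncard = α i}

/-! ### Crystals -/

/-- The data of a crystal graph with colours in `ZMod n`: vertices and Kashiwara operators, with
`none` in the role of `∅`. -/
structure Crystal (n : ℕ) where
  V : Type
  e : ZMod n → V → Option V
  f : ZMod n → V → Option V

/-- The largest `p` such that `g` can be applied `p` times to `b`. -/
def depth {V : Type} (g : V → Option V) (b : V) : ℕ :=
  sSup {p : ℕ | (fun o : Option V => o.bind g)^[p] (some b) ≠ none}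

def Crystal.eps {n : ℕ} (A : Crystal n) (i : ZMod n) (b : A.V) : ℕ := depth (A.e i) b

def Crystal.phi {n : ℕ} (A : Crystal n) (i : ZMod n) (b : A.V) : ℕ := depth (A.f i) b

/-- The tensor product of crystals. -/
def Crystal.tensor {n : ℕ} (A B : Crystal n) : Crystal n where
  V := A.V × B.V
  e i b := if B.phi i b.2 < A.eps i b.1 then (A.e i b.1).map (fun x => (x, b.2))
    else (B.e i b.2).map (fun y => (b.1, y))
  f i b := if B.phi i b.2 ≤ A.eps i b.1 then (A.f i b.1).map (fun x => (x, b.2))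
    else (B.f i b.2).map (fun y => (b.1, y))

/-- The empty tensor product. -/
def Crystal.unit (n : ℕ) : Crystal n where
  V := Unit
  e _ _ := none
  f _ _ := none

/-- Bijections of the vertex sets that commute with all Kashiwara operators. -/
def Crystal.IsIso {n : ℕ} {A B : Crystal n} (R : A.V ≃ B.V) : Prop :=
  ∀ i b, B.e i (R b) = (A.e i b).map R ∧ B.f i (R b) = (A.f i b).map R

theorem card_move {n r : ℕ} {s : Finset (ZMod n)} {a b : ZMod n} (hs : s.card = r)
    (ha : a ∈ s) (hb : b ∉ s) : (insert b (s.erase a)).card = r := by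
  rw [Finset.card_insert_of_notMem (fun h => hb (Finset.mem_of_mem_erase h)),
    Finset.card_erase_of_mem ha, hs]
  have : 0 < s.card := Finset.card_pos.2 ⟨a, ha⟩
  omega

/-- The Kirillov-Reshetikhin crystal `B_r` of type `A_{n-1}^{(1)}` attached to a single column of
height `r`: binary strings of length `n` with `r` one-letters (given by their set of positions);
`f i` moves a one-letter from position `i` to `i + 1`, and `e i` moves it back. -/
def column (n r : ℕ) : Crystal n where
  V := {s : Finset (ZMod n) // s.card = r}
  e i s := if h : i + 1 ∈ s.1 ∧ i ∉ s.1 then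
    some ⟨insert i (s.1.erase (i + 1)), card_move s.2 h.1 h.2⟩ else none
  f i s := if h : i ∈ s.1 ∧ i + 1 ∉ s.1 then
    some ⟨insert (i + 1) (s.1.erase i), card_move s.2 h.1 h.2⟩ else none

/-- `B_α = B_{α_1} ⊗ ⋯ ⊗ B_{α_k}`. -/
def columns (n : ℕ) : (k : ℕ) → (Fin k → ℕ) → Crystal n
  | 0, _ => Crystal.unit n
  | k + 1, α => (column n (α 0)).tensor (columns n k fun i => α i.succ)

/-- The cyclic shift of a binary string by one position, `i ↦ i + 1`. -/
def shift {n r : ℕ} (s : (column n r).V) : (column n r).V :=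
  ⟨s.1.image (fun i => i + 1), by
    rw [Finset.card_image_of_injective _ (add_left_injective 1)]; exact s.2⟩

/-- The Dynkin diagram automorphism on `B_α`: all factors are shifted. -/
def Omega (n : ℕ) : (k : ℕ) → (α : Fin k → ℕ) → (columns n k α).V → (columns n k α).V
  | 0, _, b => b
  | k + 1, α, b => (shift b.1, Omega n k (fun i => α i.succ) b.2)

/-- The partial sums `n_i(μ) = ∑_{j = n + 1 - i}^{n} b^μ_j`. -/
def partialSum {n k : ℕ} (μ : BoxPartition n k) (i : ℕ) : ℕ :=
  ((Finset.Icc (n + 1 - i) n).filter fun j : ℕ => (j : ZMod n) ∈ bstring n μ.parts).card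

/-- `θ_i(μ, ν; d) = d + n_i(ν) - n_i(μ)`; as `n_{n+1} - n_1` does not depend on the partition,
`θ_{n+1} = θ_1`. -/
def theta {n k : ℕ} (μ ν : BoxPartition n k) (d : ℤ) (i : ℕ) : ℤ :=
  d + partialSum ν i - partialSum μ i

/-- The signature condition `φ_i(b) = b^μ_{n-i} Θ_i`, `ε_i(b) = b^ν_{n-i} Θ_{i+1}`, where `Θ_i` is
`1` if `θ_i(μ, ν; d) > 0` and `0` otherwise, and `n d = |α| + |μ| - |ν|`. -/
def SignatureCond {n k : ℕ} (α : Fin k → ℕ) (μ ν : BoxPartition n k)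
    (b : (columns n k α).V) : Prop :=
  ∃ d : ℤ, n * d = (∑ i, (α i : ℤ)) + μ.size - ν.size ∧
    ∀ i ∈ Finset.Icc 1 n,
      (columns n k α).phi (i : ZMod n) b =
        (if ((n - i : ℕ) : ZMod n) ∈ bstring n μ.parts ∧ 0 < theta μ ν d i then 1 else 0) ∧
      (columns n k α).eps (i : ZMod n) b =
        (if ((n - i : ℕ) : ZMod n) ∈ bstring n ν.parts ∧ 0 < theta μ ν d (i + 1) then 1 else 0)

/-- The condition `R(b^{μ'} ⊗ Ω(b)) = b ⊗ b^{ν'}`, for the combinatorial `R`-matrix, that is the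
crystal isomorphism `B_{n-k} ⊗ B_α → B_α ⊗ B_{n-k}`. -/
def RMatrixCond {n k : ℕ} (α : Fin k → ℕ) (μ ν : BoxPartition n k)
    (b : (columns n k α).V) : Prop :=
  ∃ R : ((column n (n - k)).tensor (columns n k α)).V ≃
      ((columns n k α).tensor (column n (n - k))).V,
    Crystal.IsIso R ∧
    ∃ u v : (column n (n - k)).V, u.1 = bstring n μ.conj ∧ v.1 = bstring n ν.conj ∧
      R (u, Omega n k α b) = (b, v)

/-- The set `B_α(μ, ν)` of crystal vertices. -/
def crystalSet {n k : ℕ} (α : Fin k → ℕ) (μ ν : BoxPartition n k) : Set (columns n k α).V :=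
  {b | SignatureCond α μ ν b ∧ RMatrixCond α μ ν b}

/-! ### Small quantum cohomology of the Grassmannian

The coefficient ring is `ℤ[X]`, the variable `X` being the deformation parameter `q`. -/

/-- `e_m` for an arbitrary integer `m`: `e_0 = 1`, the generators are `e_1, …, e_k`, and all others
vanish. -/
def eGen (k : ℕ) (m : ℤ) : MvPolynomial (Fin k) ℤ[X] :=
  if m = 0 then 1
  else if h : 1 ≤ m ∧ m ≤ k then MvPolynomial.X ⟨(m - 1).toNat, by omega⟩
  else 0

/-- `h_r = det (e_{1 - i + j})_{1 ≤ i, j ≤ r}`. -/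
def hGen (k r : ℕ) : MvPolynomial (Fin k) ℤ[X] :=
  Matrix.det (Matrix.of fun i j : Fin r => eGen k (1 - (i : ℤ) + (j : ℤ)))

/-- The `k` relations `h_{n-k+1}, …, h_{n-1}, h_n + (-1)^k q`. -/
def relation (n k : ℕ) (i : Fin k) : MvPolynomial (Fin k) ℤ[X] :=
  if (i : ℕ) + 1 = k then hGen k n + MvPolynomial.C ((-1) ^ k * X)
  else hGen k (n - k + 1 + i)

/-- The small quantum cohomology ring of the Grassmannian of `k`-planes in `ℂ^n`. -/
abbrev QH (n k : ℕ) : Type :=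
  MvPolynomial (Fin k) ℤ[X] ⧸ Ideal.span (Set.range (relation n k))

/-- The class `h_r` for an arbitrary integer `r`; it vanishes for `r < 0`. -/
def hClass (n k : ℕ) (r : ℤ) : QH n k :=
  if r < 0 then 0 else Ideal.Quotient.mk _ (hGen k r.toNat)

/-- The Schubert class `σ_μ = det (h_{μ_i - i + j})_{1 ≤ i, j ≤ k}`. -/
def schubert {n k : ℕ} (μ : BoxPartition n k) : QH n k :=
  Matrix.det (Matrix.of fun i j : Fin k => hClass n k ((μ.parts i : ℤ) - (i : ℤ) + (j : ℤ)))

/-- `c` is an expansion of `σ_μ * h_{lam_1} * ⋯ * h_{lam_k}` in Schubert classes with coefficients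
in `ℤ[q]`. -/
def IsExpansion {n k : ℕ} (lam μ : BoxPartition n k) (c : BoxPartition n k → ℤ[X]) : Prop :=
  schubert μ * ∏ i, hClass n k (lam.parts i) = ∑ ν, c ν • schubert ν

/-- The coefficients of the expansion. -/
def expansion {n k : ℕ} (lam μ : BoxPartition n k) : BoxPartition n k → ℤ[X] :=
  Classical.epsilon (IsExpansion lam μ)

/-- The quantum Kostka number `K_{ν/d/μ,lam}`: the coefficient of `q^d σ_ν` for
`d = (|lam| + |μ| - |ν|) / n`, and `0` if this is not a nonnegative integer. -/
def quantumKostka {n k : ℕ} (lam μ ν : BoxPartition n k) : ℤ :=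
  open Classical in
  if ∃ d : ℕ, n * d + ν.size = lam.size + μ.size then
    (expansion lam μ ν).coeff ((lam.size + μ.size - ν.size) / n)
  else 0

end QKostka

end

/-!
All three numbers count the same objects: walks of particles on a circle.

Encode `μ ∈ Π_{k,n}` by the set `zeroSet μ ⊆ ℤ/n` of the one-letters of `b^{μ'}`, which is the
reflected set of the zero-letters of `b^μ`. In one step a set `S` of these particles hops from `x`
to `x + 1`; a particle may hop onto an occupied position only if that one is vacated in the same
step (`HopValid`, `hop`). A *walk* from `μ` to `ν` with numbers of hops `α_1, …, α_k` (`IsWalk`,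
`walks`) is a sequence `b = (S_1, …, S_k)` of such steps, hence an element of `B_α`.

* *Quantum Kostka numbers.* The row vectors `W_a = (h_{a-k+1}, …, h_a)` satisfy a linear recurrence
  of order `k`, and in quantum cohomology `W_{a+n} = (-1)^{k+1} q W_a` (`hClass_add_period`). The
  class `σ_μ` is the determinant of the rows `W_a` at the 0-based positions `a` of the one-letters of
  `b^μ`. One step of the recurrence is multiplication by a constant matrix `M`, and for a set of
  positions on the circle the generating function, in `z`, of all ways to push each letter forward
  without reaching the next one is the determinant of the `W_a`, times a factor common to all sets of
  positions: multiplied by `det (1 - z M)` it telescopes (`det_blockRows_mul`). Comparing with the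
  empty partition gives the quantum Pieri rule (`rowDet_mul_pieri`,
  `schubert_mul_hClass_eq_sum_hops`): `σ_μ * h_r` is the sum of the `q^w σ_ν` over the steps with `r`
  hops from `μ` to `ν`. The Schubert classes are linearly independent, since evaluation at
  `x_1, …, x_k` with `x_j^n = t^n` turns them, after multiplication by the Vandermonde determinant,
  into alternants with distinct leading monomials (`schubert_independent`). Iterating the Pieri rule
  gives `quantumKostka_eq` and `existsUnique_isExpansion`.
* *Dimers.* In a dimer configuration the unoccupied vertical edges between two consecutive rows form
  a set of particles, and the horizontal dimers of a row are the hops (`card_dimersWith`). As the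
  product of the `h_r` is commutative, the number of walks does not depend on the order of the `α_i`;
  grouping the `α` by their decreasing rearrangement gives the multinomial factors in
  `sum_card_walks`.
* *Crystals.* The combinatorial R-matrix `B_M ⊗ B_r → B_r ⊗ B_M` with `r ≤ M` is given by a bracketing
  rule (`IsCarry`, `rMap`), from which one reads off that `R(Z ⊗ (S + 1)) = S ⊗ Z'` holds if and only
  if `Z'` arises from `Z` by the hops `S` (`exists_isIso_column`). Composing, `R_α(Z ⊗ Ω(b)) = b ⊗ Z'`
  says that `b` is a walk from `Z` to `Z'`. The R-matrix is unique because `B_{n-k} ⊗ B_α` is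
  connected and has a vertex determined by its weight (`columns_connected`, `IsIso.eq_of_columns`),
  so that the R-matrix condition describes the walks (`rMatrixCond_iff`). Along a walk the hops onto
  a position and out of it alternate, and `θ_i` counts the hops out of the position `i`; hence the
  signature condition is automatic (`signatureCond_of_mem_walks`).
-/

noncomputable section

namespace QKostka

/-! ### Linear recurrences and determinants -/

/-- A sequence satisfying the linear recurrence of order `k` with coefficients `u`. -/
def IsRec {R : Type*} [CommRing R] {k : ℕ} (u : Fin k → R) (y : ℕ → R) : Prop :=
  ∀ a, y (a + k) = ∑ l : Fin k, u l * y (a + l)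

/-- The determinant whose rows are members of a sequence of vectors. -/
def rowDet {R : Type*} [CommRing R] {k : ℕ} (W : ℕ → Fin k → R) (b : Fin k → ℕ) : R :=
  Matrix.det (Matrix.of fun i j => W (b i) j)

/-- The exponents `k - 1, …, 1, 0` belonging to the empty partition. -/
def stair (k : ℕ) (i : Fin k) : ℕ := k - 1 - i

theorem stair_rev {k : ℕ} (i : Fin k) : stair k i.rev = i := by
  have := i.2
  simp only [stair, Fin.val_rev]; omega

/-- A vector sequence subject to a linear recurrence is the image of a fixed one whose initial
values form a basis under a constant matrix. -/
theorem exists_matrix_of_isRec {R : Type*} [CommRing R] {k : ℕ} (u : Fin k → R)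
    (W Y : ℕ → Fin k → R) (hW : ∀ j, IsRec u fun a => W a j) (hY : ∀ j, IsRec u fun a => Y a j)
    (h1 : rowDet W (stair k) = 1) :
    ∃ G : Matrix (Fin k) (Fin k) R, ∀ a, Y a = Matrix.vecMul (W a) G := by
  set P : Matrix (Fin k) (Fin k) R := Matrix.of fun i j => W (stair k i) j with hP
  set Q : Matrix (Fin k) (Fin k) R := Matrix.of fun i j => Y (stair k i) j with hQ
  have hu : IsUnit P.det := by
    have : P.det = 1 := h1
    rw [this]; exact isUnit_one
  refine ⟨P⁻¹ * Q, fun a => ?_⟩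
  induction a using Nat.strong_induction_on with
  | _ a ih =>
    by_cases ha : a < k
    · have hrow : ∀ Z : ℕ → Fin k → R, Z a = (Matrix.of fun i j => Z (stair k i) j)
          (Fin.rev ⟨a, ha⟩) := by
        intro Z; ext j; simp [stair_rev]
      have h2 : P * (P⁻¹ * Q) = Q := Matrix.mul_nonsing_inv_cancel_left _ _ hu
      rw [hrow Y, hrow W, ← Matrix.mul_apply_eq_vecMul]
      exact (congrFun h2 _).symm
    · obtain ⟨d, rfl⟩ := Nat.exists_eq_add_of_le (not_lt.1 ha)
      have hWd : W (k + d) = ∑ l : Fin k, u l • W (d + l) := by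
        ext j; rw [add_comm, Finset.sum_apply]; exact hW j d
      have hYd : Y (k + d) = ∑ l : Fin k, u l • Y (d + l) := by
        ext j; rw [add_comm, Finset.sum_apply]; exact hY j d
      rw [hWd, hYd, Matrix.sum_vecMul]
      refine Finset.sum_congr rfl fun l _ => ?_
      rw [ih (d + l) (by have := l.2; omega), Matrix.smul_vecMul]

theorem rowDet_vecMul {R : Type*} [CommRing R] {k : ℕ} (W Y : ℕ → Fin k → R)
    (G : Matrix (Fin k) (Fin k) R) (h : ∀ a, Y a = Matrix.vecMul (W a) G) (b : Fin k → ℕ) :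
    rowDet Y b = rowDet W b * G.det := by
  rw [rowDet, rowDet, ← Matrix.det_mul]
  congr 1
  ext i j
  simp [h, Matrix.vecMul, dotProduct, Matrix.mul_apply]

/-- All determinants formed from a vector sequence subject to a linear recurrence are the
corresponding determinants for the fixed sequence, up to the common factor given by the initial
values. -/
theorem rowDet_eq_mul_of_isRec {R : Type*} [CommRing R] {k : ℕ} (u : Fin k → R)
    (W Y : ℕ → Fin k → R) (hW : ∀ j, IsRec u fun a => W a j) (hY : ∀ j, IsRec u fun a => Y a j)
    (h1 : rowDet W (stair k) = 1) (b : Fin k → ℕ) :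
    rowDet Y b = rowDet W b * rowDet Y (stair k) := by
  obtain ⟨G, hG⟩ := exists_matrix_of_isRec u W Y hW hY h1
  rw [rowDet_vecMul W Y G hG, rowDet_vecMul W Y G hG (stair k), h1, one_mul]

/-- The complete symmetric polynomials attached to `e`, as coefficients of a power series. -/
noncomputable def hSeries {R : Type*} [CommRing R] (e : ℤ → R) : PowerSeries R :=
  PowerSeries.invOfUnit (PowerSeries.mk fun s => (-1) ^ s * e s) 1

theorem sum_eh {R : Type*} [CommRing R] (e : ℤ → R) (h0 : e 0 = 1) (m : ℕ) :
    ∑ s ∈ Finset.range (m + 1), (-1) ^ s * e s * PowerSeries.coeff (m - s) (hSeries e) =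
      if m = 0 then 1 else 0 := by
  have h := PowerSeries.mul_invOfUnit (PowerSeries.mk fun s => (-1) ^ s * e (s : ℤ)) (1 : Rˣ)
    (by simp [h0])
  have h2 := congrArg (PowerSeries.coeff m) h
  rw [PowerSeries.coeff_mul, Finset.Nat.sum_antidiagonal_eq_sum_range_succ_mk,
    PowerSeries.coeff_one] at h2
  simpa [hSeries] using h2

theorem coeff_hSeries_zero {R : Type*} [CommRing R] (e : ℤ → R) (h0 : e 0 = 1) :
    PowerSeries.coeff 0 (hSeries e) = 1 := by
  have := sum_eh e h0 0
  simpa [h0] using this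

/-- The determinant `det (e_{1 - i + j})` is a coefficient of the inverse of `∑ (-1)^s e_s z^s`:
replacing the last column by a suitable combination of all columns leaves only one entry in it. -/
theorem det_toeplitz {R : Type*} [CommRing R] (e : ℤ → R) (h0 : e 0 = 1)
    (hneg : ∀ m, m < 0 → e m = 0) (r : ℕ) :
    Matrix.det (Matrix.of fun i j : Fin r => e (1 - (i : ℤ) + (j : ℤ))) =
      PowerSeries.coeff r (hSeries e) := by
  cases r with
  | zero => rw [coeff_hSeries_zero e h0]; simp
  | succ r =>
    set T : Matrix (Fin (r + 1)) (Fin (r + 1)) R :=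
      Matrix.of fun i j => e (1 - (i : ℤ) + (j : ℤ)) with hT
    set g : ℕ → R := fun m => PowerSeries.coeff m (hSeries e) with hg
    set v : Fin (r + 1) → R := fun j => (-1) ^ (j : ℕ) * g (r - j) with hv
    have key : ∀ i : Fin (r + 1), ∑ j, v j • T i j = if i = 0 then g (r + 1) else 0 := by
      intro i
      have hs := sum_eh e h0 (r + 1 - i)
      induction i using Fin.cases with
      | zero =>
        rw [if_pos rfl]
        rw [if_neg (by simp), Finset.sum_range_succ'] at hs
        simp only [Fin.val_zero, Nat.sub_zero, pow_zero, Nat.cast_zero, h0, one_mul] at hs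
        rw [Finset.sum_range] at hs
        rw [eq_comm, ← sub_eq_zero, ← hs, sub_eq_add_neg, add_comm, ← Finset.sum_neg_distrib]
        congr 1
        refine Finset.sum_congr rfl fun j _ => ?_
        have hj := j.2
        have : e (1 - 0 + (j : ℤ)) = e ((j + 1 : ℕ) : ℤ) := by congr 1; push_cast; ring
        simp only [hv, hT, Matrix.of_apply, Fin.val_zero, Nat.cast_zero, this, smul_eq_mul]
        rw [show r + 1 - (j + 1 : ℕ) = r - j by omega]
        rw [pow_succ]; ring
      | succ i =>
        rw [if_neg (Fin.succ_ne_zero i)]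
        have hi := i.2
        rw [if_neg (by simp only [Fin.val_succ]; omega), Fin.val_succ,
          show r + 1 - (i + 1 : ℕ) = r - i by omega] at hs
        have hsum : ∑ j, v j • T i.succ j = ∑ j ∈ Finset.range (i + (r - i + 1)),
            ((-1) ^ j * g (r - j)) * e ((j : ℤ) - i) := by
          rw [show (i : ℕ) + (r - i + 1) = r + 1 by omega, Finset.sum_range]
          refine Finset.sum_congr rfl fun j _ => ?_
          simp only [hv, hT, Matrix.of_apply, Fin.val_succ, smul_eq_mul]
          congr 2; push_cast; ring
        rw [hsum, Finset.sum_range_add]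
        have hz : ∑ j ∈ Finset.range (i : ℕ), ((-1) ^ j * g (r - j)) * e ((j : ℤ) - i) = 0 := by
          refine Finset.sum_eq_zero fun j hj => ?_
          rw [hneg _ (by have := Finset.mem_range.1 hj; omega), mul_zero]
        rw [hz, zero_add, ← mul_zero ((-1) ^ (i : ℕ)), ← hs, Finset.mul_sum]
        refine Finset.sum_congr rfl fun s _ => ?_
        have : ((i + s : ℕ) : ℤ) - i = s := by push_cast; ring
        rw [this, pow_add, show r - (i + s) = r - i - s by omega]
        ring
    have h1 := Matrix.det_updateCol_sum T (Fin.last r) v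
    have h2 : (T.updateCol (Fin.last r) (fun i => ∑ j, v j • T i j)).det =
        (-1) ^ r * g (r + 1) := by
      rw [Matrix.det_succ_column _ (Fin.last r), Finset.sum_eq_single 0]
      · have htri : ((T.updateCol (Fin.last r) (fun i => ∑ j, v j • T i j)).submatrix
            (Fin.succAbove 0) (Fin.succAbove (Fin.last r))).det = 1 := by
          have hent : ∀ i j, ((T.updateCol (Fin.last r) (fun i => ∑ j, v j • T i j)).submatrix
              (Fin.succAbove 0) (Fin.succAbove (Fin.last r))) i j = e ((j : ℤ) - i) := by
            intro i j
            simp only [Matrix.submatrix_apply, Fin.succAbove_last, Fin.succAbove_zero]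
            rw [Matrix.updateCol_ne (Fin.castSucc_lt_last j).ne]
            simp only [hT, Matrix.of_apply, Fin.val_succ, Fin.val_castSucc]
            congr 1; push_cast; ring
          rw [Matrix.det_of_isUpperTriangular]
          · refine Finset.prod_eq_one fun i _ => ?_
            rw [hent]; simp [h0]
          · intro i j hij
            rw [hent]
            have : (j : ℕ) < i := hij
            exact hneg _ (by omega)
        rw [htri, Matrix.updateCol_self, key]
        simp
      · intro i _ hi
        rw [Matrix.updateCol_self, key, if_neg hi]; simp
      · simp
    rw [h2] at h1
    have h3 : v (Fin.last r) = (-1) ^ r := by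
      simp [hv, hg, coeff_hSeries_zero e h0]
    rw [h3, smul_eq_mul] at h1
    have h4 : ((-1 : R) ^ r) * (-1) ^ r = 1 := by rw [← mul_pow]; simp
    calc T.det = (-1) ^ r * ((-1) ^ r * T.det) := by rw [← mul_assoc, h4, one_mul]
      _ = g (r + 1) := by rw [← h1, ← mul_assoc, h4, one_mul]

/-! ### The Pieri rule for quasi-periodic sequences of vectors -/

/-- The weighted cyclic shift matrix: row `i + 1` has `w (i + 1)` in column `i`, and row `0` has
`w 0` in the last column. -/
def cyclicMatrix {S : Type*} [CommRing S] {k : ℕ} (w : Fin (k + 1) → S) :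
    Matrix (Fin (k + 1)) (Fin (k + 1)) S :=
  Matrix.of fun i j => if (finRotate (k + 1)) j = i then w i else 0

theorem finRotate_castSucc {k : ℕ} (i : Fin k) : finRotate (k + 1) i.castSucc = i.succ := by
  rw [finRotate_apply, Fin.coeSucc_eq_succ]

theorem cyclicMatrix_succ {S : Type*} [CommRing S] {k : ℕ} (w : Fin (k + 1) → S) (i : Fin k)
    (j : Fin (k + 1)) : cyclicMatrix w i.succ j = if j = i.castSucc then w i.succ else 0 := by
  have : (finRotate (k + 1)) j = i.succ ↔ j = i.castSucc := by
    rw [← finRotate_castSucc, Equiv.apply_eq_iff_eq]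
  simp only [cyclicMatrix, Matrix.of_apply, this]

theorem cyclicMatrix_zero {S : Type*} [CommRing S] {k : ℕ} (w : Fin (k + 1) → S)
    (j : Fin (k + 1)) : cyclicMatrix w 0 j = if j = Fin.last k then w 0 else 0 := by
  have : (finRotate (k + 1)) j = 0 ↔ j = Fin.last k := by
    rw [← finRotate_last, Equiv.apply_eq_iff_eq]
  simp only [cyclicMatrix, Matrix.of_apply, this]

theorem det_one_sub_cyclicMatrix {S : Type*} [CommRing S] {k : ℕ} (w : Fin (k + 1) → S) :
    (1 - cyclicMatrix w).det = 1 - ∏ i, w i := by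
  set A := 1 - cyclicMatrix w with hA
  set x : Fin (k + 1) → S := Pi.single 0 1 with hx
  set y : Fin (k + 1) → S := Pi.single (Fin.last k) 1 with hy
  have h0 : A = A.updateRow 0 (x + (-w 0) • y) := by
    ext i j
    by_cases hi : i = 0
    · subst hi
      rw [Matrix.updateRow_self]
      simp only [hA, Matrix.sub_apply, cyclicMatrix_zero, hx, hy, Pi.add_apply, Pi.smul_apply,
        Pi.single_apply, Matrix.one_apply, smul_eq_mul, eq_comm (a := (0 : Fin (k + 1)))]
      split_ifs <;> ring
    · rw [Matrix.updateRow_ne hi]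
  have hsucc : ∀ (i : Fin k) (j : Fin (k + 1)), A i.succ j =
      (if j = i.succ then 1 else 0) - if j = i.castSucc then w i.succ else 0 := by
    intro i j
    simp only [hA, Matrix.sub_apply, cyclicMatrix_succ, Matrix.one_apply, eq_comm]
  have h1 : (A.updateRow 0 x).det = 1 := by
    rw [Matrix.det_of_isLowerTriangular]
    · refine Finset.prod_eq_one fun i _ => ?_
      induction i using Fin.cases with
      | zero => simp [hx]
      | succ i =>
        rw [Matrix.updateRow_ne (Fin.succ_ne_zero i), hsucc, if_pos rfl,
          if_neg (Fin.castSucc_lt_succ).ne', sub_zero]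
    · intro i j hij
      have hij' : i < j := hij
      induction i using Fin.cases with
      | zero => simp [hx, hij'.ne']
      | succ i =>
        rw [Matrix.updateRow_ne (Fin.succ_ne_zero i), hsucc, if_neg hij'.ne',
          if_neg ((Fin.castSucc_lt_succ).trans hij').ne', sub_zero]
  have h2 : (A.updateRow 0 y).det = ∏ i : Fin k, w i.succ := by
    rw [Matrix.det_succ_row_zero, Finset.sum_eq_single (Fin.last k)]
    · rw [Matrix.det_of_isUpperTriangular]
      · simp only [Matrix.updateRow_self, Matrix.submatrix_apply, Fin.succAbove_last]
        have hd : ∀ i : Fin k, (A.updateRow 0 y) i.succ i.castSucc = - w i.succ := by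
          intro i
          rw [Matrix.updateRow_ne (Fin.succ_ne_zero i), hsucc, if_pos rfl,
            if_neg (Fin.castSucc_lt_succ).ne, zero_sub]
        have hl : y (Fin.last k) = 1 := by simp [hy]
        rw [hl, Finset.prod_congr rfl fun i _ => hd i, Finset.prod_neg, Finset.card_univ,
          Fintype.card_fin, Fin.val_last, mul_one, ← mul_assoc, ← mul_pow]
        simp
      · intro i j hij
        have hij' : j < i := hij
        simp only [Matrix.submatrix_apply, Fin.succAbove_last]
        rw [Matrix.updateRow_ne (Fin.succ_ne_zero i), hsucc, if_neg, if_neg, sub_zero]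
        · exact fun h => hij'.ne (Fin.castSucc_injective _ h)
        · exact ((Fin.castSucc_lt_castSucc_iff.2 hij').trans Fin.castSucc_lt_succ).ne
    · intro j _ hj
      simp [hy, hj]
    · simp
  rw [h0, Matrix.det_updateRow_add, Matrix.det_updateRow_smul, h1, h2, Fin.prod_univ_succ]
  ring

/-- For a decreasing sequence `a` of positions on a circle of length `n`, the distance from
`a i` to the next larger position (cyclically). -/
def gap (n : ℕ) {k : ℕ} (a : Fin (k + 1) → ℕ) (i : Fin (k + 1)) : ℕ :=
  if i = 0 then a (Fin.last k) + n - a 0 else a ((finRotate (k + 1)).symm i) - a i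

theorem gap_zero (n : ℕ) {k : ℕ} (a : Fin (k + 1) → ℕ) :
    gap n a 0 = a (Fin.last k) + n - a 0 := if_pos rfl

theorem gap_succ (n : ℕ) {k : ℕ} (a : Fin (k + 1) → ℕ) (i : Fin k) :
    gap n a i.succ = a i.castSucc - a i.succ := by
  rw [gap, if_neg (Fin.succ_ne_zero i)]
  congr 2
  rw [Equiv.symm_apply_eq, finRotate_castSucc]

/-- Strictly decreasing sequences of positions spread over less than one turn of the circle. -/
structure IsPos (n : ℕ) {k : ℕ} (a : Fin (k + 1) → ℕ) : Prop where
  anti : StrictAnti a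
  lt : a 0 < a (Fin.last k) + n

theorem sum_gap {n k : ℕ} {a : Fin (k + 1) → ℕ} (ha : IsPos n a) : ∑ i, gap n a i = n := by
  have hz : ∀ i : Fin k, ((gap n a i.succ : ℕ) : ℤ) = a i.castSucc - a i.succ := fun i => by
    rw [gap_succ, Nat.cast_sub (ha.anti (Fin.castSucc_lt_succ (i := i))).le]
  have h0 : ((gap n a 0 : ℕ) : ℤ) = a (Fin.last k) + n - a 0 := by
    rw [gap_zero, Nat.cast_sub ha.lt.le]; push_cast; rfl
  have : ((∑ i, gap n a i : ℕ) : ℤ) = n := by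
    rw [Nat.cast_sum, Fin.sum_univ_succ, h0]
    simp only [hz, Finset.sum_sub_distrib]
    have e1 := Fin.sum_univ_succ fun i => (a i : ℤ)
    have e2 := Fin.sum_univ_castSucc fun i => (a i : ℤ)
    linarith
  exact_mod_cast this

theorem gap_pos {n k : ℕ} {a : Fin (k + 1) → ℕ} (ha : IsPos n a) (i : Fin (k + 1)) :
    0 < gap n a i := by
  induction i using Fin.cases with
  | zero => rw [gap_zero]; have := ha.lt; omega
  | succ i => rw [gap_succ]; have := ha.anti (Fin.castSucc_lt_succ (i := i)); omega

/-- The rows `∑_{0 ≤ t < gap i} z ^ t W (a i + t)`. -/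
noncomputable def blockRows {R : Type*} [CommRing R] (n : ℕ) {k : ℕ} (W : ℕ → Fin (k + 1) → R)
    (a : Fin (k + 1) → ℕ) : Matrix (Fin (k + 1)) (Fin (k + 1)) R[X] :=
  Matrix.of fun i j => ∑ t ∈ Finset.range (gap n a i), X ^ t * C (W (a i + t) j)

theorem det_blockRows {R : Type*} [CommRing R] (n : ℕ) {k : ℕ} (W : ℕ → Fin (k + 1) → R)
    (a : Fin (k + 1) → ℕ) :
    (blockRows n W a).det = ∑ t ∈ Fintype.piFinset fun i => Finset.range (gap n a i),
      X ^ (∑ i, t i) * C (rowDet W fun i => a i + t i) := by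
  have h : (blockRows n W a).det = Matrix.detRowAlternating.toMultilinearMap fun i =>
      ∑ t ∈ Finset.range (gap n a i), (X : R[X]) ^ t • fun j => C (W (a i + t) j) := by
    change Matrix.det _ = Matrix.det _
    congr 1
    ext i j : 2
    simp [blockRows, Finset.sum_apply]
  rw [h, MultilinearMap.map_sum_finset]
  refine Finset.sum_congr rfl fun t _ => ?_
  rw [MultilinearMap.map_smul_univ, Finset.prod_pow_eq_pow_sum, smul_eq_mul]
  congr 1
  rw [rowDet, ← RingHom.coe_coe (C : R →+* R[X]), RingHom.map_det]
  rfl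

theorem det_blockRows_mul {R : Type*} [CommRing R] {n k : ℕ} (W : ℕ → Fin (k + 1) → R) (c : R)
    (hper : ∀ a, W (a + n) = c • W a) (M : Matrix (Fin (k + 1)) (Fin (k + 1)) R)
    (hM : ∀ a, W (a + 1) = Matrix.vecMul (W a) M) {a : Fin (k + 1) → ℕ} (ha : IsPos n a) :
    (blockRows n W a).det * (1 - (X : R[X]) • M.map C).det =
      (1 - C c * X ^ n) * C (rowDet W a) := by
  set w : Fin (k + 1) → R[X] := fun i => (if i = 0 then C c else 1) * X ^ gap n a i with hw
  have hprod : ∏ i, w i = C c * X ^ n := by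
    rw [hw, Finset.prod_mul_distrib, Finset.prod_pow_eq_pow_sum, sum_gap ha]
    simp
  have hC : C (rowDet W a) = Matrix.det (Matrix.of fun i j => C (W (a i) j)) := by
    rw [rowDet, ← RingHom.coe_coe (C : R →+* R[X]), RingHom.map_det]
    rfl
  rw [← hprod, ← det_one_sub_cyclicMatrix, hC, ← Matrix.det_mul, ← Matrix.det_mul]
  congr 1
  have hMC : ∀ b j, ∑ l, C (W b l) * C (M l j) = C (W (b + 1) j) := by
    intro b j
    rw [hM, Matrix.vecMul, dotProduct, map_sum]
    simp
  have htel : ∀ i j, (blockRows n W a * (1 - (X : R[X]) • M.map C)) i j =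
      C (W (a i) j) - X ^ gap n a i * C (W (a i + gap n a i) j) := by
    intro i j
    have h1 : ∀ m : ℕ, (∑ t ∈ Finset.range m, X ^ t * C (W (a i + t) j)) -
        X * ∑ t ∈ Finset.range m, X ^ t * C (W (a i + t + 1) j) =
        C (W (a i) j) - X ^ m * C (W (a i + m) j) := by
      intro m
      induction m with
      | zero => simp
      | succ m ih =>
        rw [Finset.sum_range_succ, Finset.sum_range_succ, mul_add, add_sub_add_comm, ih,
          ← add_assoc (a i) m 1, pow_succ]
        ring
    rw [← h1, Matrix.mul_sub, Matrix.mul_one, Matrix.sub_apply, Matrix.mul_smul,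
      Matrix.smul_apply, smul_eq_mul]
    congr 2
    simp only [Matrix.mul_apply, blockRows, Matrix.of_apply, Finset.sum_mul, Matrix.map_apply]
    rw [Finset.sum_comm]
    refine Finset.sum_congr rfl fun t _ => ?_
    simp only [mul_assoc, ← Finset.mul_sum, hMC]
  ext1 i j
  rw [htel, Matrix.sub_mul, Matrix.one_mul, Matrix.sub_apply, Matrix.of_apply]
  congr 1
  rw [Matrix.mul_apply]
  induction i using Fin.cases with
  | zero =>
    simp only [cyclicMatrix_zero, ite_mul, zero_mul, Finset.sum_ite_eq', Finset.mem_univ, if_true]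
    have : a 0 + gap n a 0 = a (Fin.last k) + n := by rw [gap_zero]; have := ha.lt; omega
    rw [this, hper]
    simp only [hw, if_pos, Pi.smul_apply, smul_eq_mul, C_mul, Matrix.of_apply]
    ring
  | succ i =>
    simp only [cyclicMatrix_succ, ite_mul, zero_mul, Finset.sum_ite_eq', Finset.mem_univ, if_true]
    have : a i.succ + gap n a i.succ = a i.castSucc := by
      rw [gap_succ]; have := ha.anti (Fin.castSucc_lt_succ (i := i)); omega
    rw [this]
    simp [hw]

/-- `1 - c z ^ n` can be cancelled. -/
theorem eq_of_one_sub_mul_eq {R : Type*} [CommRing R] {n : ℕ} (hn : n ≠ 0) (c : R) {p r : R[X]}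
    (h : (1 - C c * X ^ n) * p = (1 - C c * X ^ n) * r) : p = r := by
  have hu : IsUnit ((1 - C c * X ^ n : R[X]) : PowerSeries R) := by
    rw [PowerSeries.isUnit_iff_constantCoeff]
    simp [hn]
  have h2 := congrArg (Polynomial.toPowerSeries (R := R)) h
  rw [Polynomial.coe_mul, Polynomial.coe_mul] at h2
  exact Polynomial.coe_injective R (hu.mul_left_cancel h2)

theorem isPos_stair {n k : ℕ} (hk : k + 1 ≤ n) : IsPos n (stair (k + 1)) where
  anti := fun i j hij => by
    have := j.2
    have : (i : ℕ) < j := hij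
    simp only [stair]; omega
  lt := by simp only [stair, Fin.val_last, Fin.val_zero]; omega

/-- The Pieri rule, in the form of an identity of generating functions. -/
theorem det_blockRows_eq {R : Type*} [CommRing R] {n k : ℕ} (hk : k + 1 ≤ n)
    (W : ℕ → Fin (k + 1) → R) (c : R) (u : Fin (k + 1) → R) (hW : ∀ j, IsRec u fun a => W a j)
    (h1 : rowDet W (stair (k + 1)) = 1) (hper : ∀ a, W (a + n) = c • W a)
    {a : Fin (k + 1) → ℕ} (ha : IsPos n a) :
    (blockRows n W a).det = C (rowDet W a) * (blockRows n W (stair (k + 1))).det := by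
  obtain ⟨M, hM⟩ := exists_matrix_of_isRec u W (fun a => W (a + 1)) hW
    (fun j a => by
      have := hW j (a + 1)
      simp only at this ⊢
      rw [show a + (k + 1) + 1 = a + 1 + (k + 1) by ring, this]
      refine Finset.sum_congr rfl fun l _ => ?_
      rw [show a + 1 + (l : ℕ) = a + l + 1 by ring]) h1
  have e1 := det_blockRows_mul W c hper M hM ha
  have e2 := det_blockRows_mul W c hper M hM (isPos_stair hk)
  rw [h1, C_1, mul_one] at e2
  refine eq_of_one_sub_mul_eq (n := n) (by omega) c ?_
  calc (1 - C c * X ^ n) * (blockRows n W a).det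
      = ((blockRows n W a).det * (1 - (X : R[X]) • M.map C).det) *
        (blockRows n W (stair (k + 1))).det := by rw [← e2]; ring
    _ = _ := by rw [e1]; ring

theorem gap_stair_succ {n k : ℕ} (i : Fin k) : gap n (stair (k + 1)) i.succ = 1 := by
  rw [gap_succ]
  have := i.2
  simp only [stair, Fin.val_castSucc, Fin.val_succ]
  omega

/-- The Pieri rule: the product with `rowDet W (k + r, k - 1, …, 0)` is the sum over all ways of
moving the positions `a i` by a total of `r`, none of them reaching the next position. -/
theorem rowDet_mul_pieri {R : Type*} [CommRing R] {n k : ℕ} (hk : k + 1 ≤ n)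
    (W : ℕ → Fin (k + 1) → R) (c : R) (u : Fin (k + 1) → R) (hW : ∀ j, IsRec u fun a => W a j)
    (h1 : rowDet W (stair (k + 1)) = 1) (hper : ∀ a, W (a + n) = c • W a)
    {a : Fin (k + 1) → ℕ} (ha : IsPos n a) {r : ℕ} (hr : r ≤ n - (k + 1)) :
    rowDet W a * rowDet W (fun i => stair (k + 1) i + if i = 0 then r else 0) =
      ∑ t ∈ Fintype.piFinset (fun i => Finset.range (gap n a i)) with ∑ i, t i = r,
        rowDet W fun i => a i + t i := by
  have h := congrArg (coeff · r) (det_blockRows_eq hk W c u hW h1 hper ha)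
  simp only [coeff_C_mul] at h
  rw [det_blockRows, det_blockRows] at h
  simp only [finsetSum_coeff, coeff_mul_C, coeff_X_pow, ite_mul, one_mul, zero_mul] at h
  rw [Finset.sum_filter]
  simp only [eq_comm (b := r)]
  rw [h]
  congr 1
  rw [Finset.sum_eq_single fun i => if i = 0 then r else 0]
  · rw [if_pos (by simp)]
  · intro t ht htr
    rw [if_neg]
    intro hsum
    refine htr (funext fun i => ?_)
    have hs : ∀ i : Fin k, t i.succ = 0 := fun i => by
      have := Fintype.mem_piFinset.1 ht i.succ
      rw [gap_stair_succ] at this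
      simpa using this
    induction i using Fin.cases with
    | zero => rw [Fin.sum_univ_succ] at hsum; simp [hs] at hsum; simp [hsum]
    | succ i => simp [hs i, Fin.succ_ne_zero]
  · intro hmem
    refine absurd (Fintype.mem_piFinset.2 fun i => ?_) hmem
    induction i using Fin.cases with
    | zero =>
      rw [gap_zero]
      simp only [if_true, Finset.mem_range, stair, Fin.val_last, Fin.val_zero]
      omega
    | succ i => rw [gap_stair_succ]; simp [Fin.succ_ne_zero]

/-! ### Schubert classes as determinants of a quasi-periodic sequence -/

theorem rowDet_map {R S : Type*} [CommRing R] [CommRing S] (f : R →+* S) {k : ℕ}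
    (W : ℕ → Fin k → R) (b : Fin k → ℕ) :
    rowDet (fun a j => f (W a j)) b = f (rowDet W b) := by
  rw [rowDet, rowDet, RingHom.map_det]; rfl

theorem IsRec.map {R S : Type*} [CommRing R] [CommRing S] (f : R →+* S) {k : ℕ} {u : Fin k → R}
    {y : ℕ → R} (h : IsRec u y) : IsRec (fun l => f (u l)) fun a => f (y a) := by
  intro a
  simp only [h a, map_sum, map_mul]

/-- Changing one entry multiplies the determinant by a constant if the row is multiplied by it. -/
theorem rowDet_smul_row {R : Type*} [CommRing R] {k : ℕ} (W : ℕ → Fin k → R) (c : R)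
    {b b' : Fin k → ℕ} (i : Fin k) (hi : W (b i) = c • W (b' i))
    (hl : ∀ l, l ≠ i → b l = b' l) : rowDet W b = c * rowDet W b' := by
  have : (Matrix.of fun i j => W (b i) j) =
      (Matrix.of fun i j => W (b' i) j).updateRow i (c • W (b' i)) := by
    ext l j
    by_cases h : l = i
    · subst h; rw [Matrix.updateRow_self, ← hi]; rfl
    · rw [Matrix.updateRow_ne h, Matrix.of_apply, Matrix.of_apply, hl l h]
  rw [rowDet, rowDet, this, Matrix.det_updateRow_smul]
  congr 2
  ext l j
  by_cases h : l = i
  · subst h; rw [Matrix.updateRow_self]; rfl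
  · rw [Matrix.updateRow_ne h]

theorem rowDet_eq_zero_of_eq {R : Type*} [CommRing R] {k : ℕ} (W : ℕ → Fin k → R)
    {b : Fin k → ℕ} {i j : Fin k} (hij : i ≠ j) (h : b i = b j) : rowDet W b = 0 :=
  Matrix.det_zero_of_row_eq hij (by ext l; simp [h])

/-- Complete symmetric polynomials, with index in `ℤ`. -/
def hInt (k : ℕ) (m : ℤ) : MvPolynomial (Fin k) ℤ[X] := if m < 0 then 0 else hGen k m.toNat

/-- The vector `(h_{a - k + 1}, …, h_a)`. -/
def hRow (k : ℕ) (a : ℕ) (j : Fin k) : MvPolynomial (Fin k) ℤ[X] :=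
  hInt k ((a : ℤ) - (k - 1) + j)

/-- The coefficients of the recurrence satisfied by the complete symmetric polynomials. -/
def recCoeff (k : ℕ) (l : Fin k) : MvPolynomial (Fin k) ℤ[X] :=
  (-1) ^ (k - 1 - (l : ℕ)) * eGen k ((k - l : ℕ) : ℤ)

theorem eGen_zero (k : ℕ) : eGen k 0 = 1 := by simp [eGen]

theorem eGen_neg (k : ℕ) (m : ℤ) (hm : m < 0) : eGen k m = 0 := by
  rw [eGen, if_neg hm.ne, dif_neg (by omega)]

theorem eGen_of_lt (k : ℕ) (m : ℤ) (hm : (k : ℤ) < m) : eGen k m = 0 := by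
  rw [eGen, if_neg (by omega), dif_neg (by omega)]

theorem hGen_eq (k r : ℕ) : hGen k r = PowerSeries.coeff r (hSeries (eGen k)) :=
  det_toeplitz _ (eGen_zero k) (eGen_neg k) r

theorem hInt_zero (k : ℕ) : hInt k 0 = 1 := by
  rw [hInt, if_neg (by simp), Int.toNat_zero, hGen_eq, coeff_hSeries_zero _ (eGen_zero k)]

theorem hInt_neg (k : ℕ) {m : ℤ} (hm : m < 0) : hInt k m = 0 := if_pos hm

theorem hInt_nat (k r : ℕ) : hInt k r = hGen k r := by
  rw [hInt, if_neg (by omega), Int.toNat_natCast]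

/-- The recurrence `h_m = ∑_{1 ≤ s ≤ k} (-1)^(s-1) e_s h_{m-s}` for `m ≥ 1`. -/
theorem hInt_rec (k : ℕ) {m : ℤ} (hm : 1 ≤ m) :
    hInt k m = ∑ l : Fin k, recCoeff k l * hInt k (m - k + l) := by
  obtain ⟨p, rfl⟩ : ∃ p : ℕ, m = p := ⟨m.toNat, by omega⟩
  have hp : p ≠ 0 := by omega
  set f : ℕ → MvPolynomial (Fin k) ℤ[X] := fun s => (-1) ^ s * eGen k s * hInt k (p - s) with hf
  have h1 : ∑ s ∈ Finset.range (p + 1), f s = 0 := by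
    have := sum_eh (eGen k) (eGen_zero k) p
    rw [if_neg hp] at this
    rw [← this]
    refine Finset.sum_congr rfl fun s hs => ?_
    have hs' := Finset.mem_range.1 hs
    simp only [hf]
    rw [show (p : ℤ) - s = ((p - s : ℕ) : ℤ) by omega, hInt_nat, hGen_eq]
  have h2 : ∑ s ∈ Finset.range (k + 1), f s = 0 := by
    have ha : ∑ s ∈ Finset.range (p + 1), f s = ∑ s ∈ Finset.range (p + k + 1), f s := by
      refine Finset.sum_subset (Finset.range_subset_range.2 (by omega)) fun s _ hs => ?_
      simp only [Finset.mem_range, not_lt] at hs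
      simp only [hf]
      rw [hInt_neg _ (by omega), mul_zero]
    have hb : ∑ s ∈ Finset.range (k + 1), f s = ∑ s ∈ Finset.range (p + k + 1), f s := by
      refine Finset.sum_subset (Finset.range_subset_range.2 (by omega)) fun s _ hs => ?_
      simp only [Finset.mem_range, not_lt] at hs
      simp only [hf]
      rw [eGen_of_lt _ _ (by omega), mul_zero, zero_mul]
    rw [hb, ← ha, h1]
  rw [Finset.sum_range_succ'] at h2
  have h0 : f 0 = hInt k p := by simp [hf, eGen_zero]
  rw [h0, add_comm, add_eq_zero_iff_eq_neg] at h2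
  rw [h2, ← Finset.sum_range_reflect, Finset.sum_range, ← Finset.sum_neg_distrib]
  refine Finset.sum_congr rfl fun l _ => ?_
  have hl := l.2
  simp only [hf, recCoeff]
  rw [show k - 1 - (l : ℕ) + 1 = k - l by omega]
  rw [show (p : ℤ) - ((k - l : ℕ) : ℤ) = p - k + l by omega]
  rw [show k - (l : ℕ) = k - 1 - l + 1 by omega, pow_succ]
  ring

theorem isRec_hRow (k : ℕ) (j : Fin k) : IsRec (recCoeff k) fun a => hRow k a j := by
  intro a
  simp only [hRow]
  rw [hInt_rec k (by push_cast; omega)]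
  refine Finset.sum_congr rfl fun l _ => ?_
  congr 2; push_cast; ring

/-- The one-row Schubert class is a complete symmetric polynomial: the matrix is triangular. -/
theorem rowDet_hRow_stair_add (k r : ℕ) :
    rowDet (hRow k) (fun i => stair k i + if (i : ℕ) = 0 then r else 0) =
      if k = 0 then 1 else hGen k r := by
  cases k with
  | zero => simp [rowDet]
  | succ k =>
    have hent : ∀ i j : Fin (k + 1), hRow (k + 1) (stair (k + 1) i + if (i : ℕ) = 0 then r else 0) j
        = hInt (k + 1) ((j : ℤ) - i + if (i : ℕ) = 0 then r else 0) := by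
      intro i j
      have := i.2
      simp only [hRow, stair]
      congr 1
      split_ifs <;> push_cast <;> omega
    rw [rowDet, Matrix.det_of_isUpperTriangular, Fin.prod_univ_succ]
    · rw [if_neg (Nat.succ_ne_zero k)]
      simp only [Matrix.of_apply, hent]
      simp [hInt_zero, hInt_nat]
    · intro i j hij
      have hij' : (j : ℕ) < i := hij
      rw [Matrix.of_apply, hent, if_neg (by omega)]
      exact hInt_neg _ (by simp; omega)

theorem rowDet_hRow_stair (k : ℕ) : rowDet (hRow k) (stair k) = 1 := by
  have h := rowDet_hRow_stair_add k 0
  simp only [ite_self, add_zero] at h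
  have h0 : hGen k 0 = 1 := by rw [← hInt_nat, Nat.cast_zero, hInt_zero]
  rw [h0, ite_self] at h
  exact h

theorem hClass_eq (n k : ℕ) (m : ℤ) : hClass n k m = Ideal.Quotient.mk _ (hInt k m) := by
  rw [hClass, hInt]; split_ifs <;> simp

/-- The vector `(h_{a - k + 1}, …, h_a)` of classes in quantum cohomology. -/
def qRow (n k : ℕ) (a : ℕ) (j : Fin k) : QH n k := Ideal.Quotient.mk _ (hRow k a j)

/-- The 0-based positions `μ_i + k - 1 - i` of the one-letters belonging to a partition. -/
def BoxPartition.pos {n k : ℕ} (μ : BoxPartition n k) (i : Fin k) : ℕ := μ.parts i + stair k i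

theorem schubert_eq_rowDet {n k : ℕ} (μ : BoxPartition n k) :
    schubert μ = rowDet (qRow n k) μ.pos := by
  rw [schubert, rowDet]
  congr 1
  ext i j
  have := i.2
  simp only [Matrix.of_apply, qRow, hRow, hClass_eq, BoxPartition.pos, stair]
  congr 2
  push_cast; omega

theorem rowDet_qRow (n k : ℕ) (b : Fin k → ℕ) :
    rowDet (qRow n k) b = Ideal.Quotient.mk _ (rowDet (hRow k) b) :=
  rowDet_map (Ideal.Quotient.mk _) (hRow k) b

theorem relation_eq_zero (n k : ℕ) (i : Fin k) :
    (Ideal.Quotient.mk (Ideal.span (Set.range (relation n k)))) (relation n k i) = 0 :=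
  Ideal.Quotient.eq_zero_iff_mem.2 (Ideal.subset_span ⟨i, rfl⟩)

/-- The constant by which the classes `h_m` get multiplied when `m` is raised by `n`. -/
def qConst (n k : ℕ) : QH n k := algebraMap ℤ[X] _ ((-1) ^ (k + 1) * X)

theorem hClass_add_period_of_nonpos {n k : ℕ} (hk : k ≤ n) {m : ℤ} (hm : -(k : ℤ) < m)
    (h0 : m ≤ 0) : hClass n k (m + n) = qConst n k * hClass n k m := by
  have hlt : (m + k - 1).toNat < k := by omega
  have hrel := relation_eq_zero n k ⟨(m + k - 1).toNat, hlt⟩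
  rw [relation] at hrel
  rcases h0.lt_or_eq with h1 | rfl
  · rw [if_neg (by simp only; omega)] at hrel
    rw [hClass_eq, hClass_eq, hInt_neg k h1, map_zero, mul_zero, ← hrel, hInt, if_neg (by omega)]
    congr 2
    simp only; omega
  · rw [if_pos (by simp only; omega), map_add] at hrel
    rw [hClass_eq, hClass_eq, hInt_zero, zero_add, hInt_nat, map_one, mul_one,
      eq_neg_of_add_eq_zero_left hrel, qConst, ← map_neg, IsScalarTower.algebraMap_apply ℤ[X]
      (MvPolynomial (Fin k) ℤ[X]) (QH n k)]
    rw [MvPolynomial.algebraMap_eq, Ideal.Quotient.algebraMap_eq, ← map_neg]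
    congr 2
    ring

/-- Quasi-periodicity of the classes `h_m`: it holds for `-k < m ≤ 0` by the defining relations
and propagates by the recurrence. -/
theorem hClass_add_period {n k : ℕ} (hk : k ≤ n) {m : ℤ} (hm : -(k : ℤ) < m) :
    hClass n k (m + n) = qConst n k * hClass n k m := by
  by_cases h0 : m ≤ 0
  · exact hClass_add_period_of_nonpos hk hm h0
  obtain ⟨p, rfl⟩ : ∃ p : ℕ, m = p := ⟨m.toNat, by omega⟩
  induction p using Nat.strong_induction_on with
  | _ p ih =>
    rw [hClass_eq, hClass_eq, hInt_rec k (m := p) (by omega), hInt_rec k (m := p + n) (by omega)]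
    simp only [map_sum, map_mul, ← hClass_eq, Finset.mul_sum]
    refine Finset.sum_congr rfl fun l _ => ?_
    have hl := l.2
    have : hClass n k (((p : ℤ) - k + l) + n) = qConst n k * hClass n k ((p : ℤ) - k + l) := by
      by_cases hp : (p : ℤ) - k + l ≤ 0
      · exact hClass_add_period_of_nonpos hk (by omega) hp
      · have := ih ((p : ℤ) - k + l).toNat (by omega) (by omega) (by omega)
        rwa [Int.toNat_of_nonneg (by omega)] at this
    rw [show (p : ℤ) + n - k + l = (p - k + l) + n by ring, this]; ring

theorem qRow_add_period {n k : ℕ} (hk : k ≤ n) (a : ℕ) :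
    qRow n k (a + n) = qConst n k • qRow n k a := by
  ext j
  have := j.2
  simp only [qRow, hRow, ← hClass_eq, Pi.smul_apply, smul_eq_mul]
  rw [← hClass_add_period hk (by omega)]
  congr 1; push_cast; ring

theorem isRec_qRow (n k : ℕ) (j : Fin k) :
    IsRec (fun l => (Ideal.Quotient.mk (Ideal.span (Set.range (relation n k)))) (recCoeff k l))
      fun a => qRow n k a j :=
  (isRec_hRow k j).map _

theorem rowDet_qRow_stair (n k : ℕ) : rowDet (qRow n k) (stair k) = 1 := by
  rw [rowDet_qRow, rowDet_hRow_stair, map_one]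

theorem isPos_pos {n k : ℕ} (hk : k + 1 ≤ n) (μ : BoxPartition n (k + 1)) : IsPos n μ.pos where
  anti := fun i j hij => by
    have h1 := μ.anti hij.le
    have h2 := (isPos_stair hk).anti hij
    simp only [BoxPartition.pos]; omega
  lt := by
    have := μ.le 0
    simp only [BoxPartition.pos, stair, Fin.val_last, Fin.val_zero]; omega

/-- The quantum Pieri rule in terms of sequences of positions. -/
theorem schubert_mul_hClass {n k : ℕ} (hk : k + 1 ≤ n) (μ : BoxPartition n (k + 1)) {r : ℕ}
    (hr : r ≤ n - (k + 1)) :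
    schubert μ * hClass n (k + 1) r =
      ∑ t ∈ Fintype.piFinset (fun i => Finset.range (gap n μ.pos i)) with ∑ i, t i = r,
        rowDet (qRow n (k + 1)) fun i => μ.pos i + t i := by
  rw [← rowDet_mul_pieri hk (qRow n (k + 1)) (qConst n (k + 1)) _ (isRec_qRow n (k + 1))
    (rowDet_qRow_stair n (k + 1)) (qRow_add_period hk) (isPos_pos hk μ) hr, schubert_eq_rowDet,
    rowDet_qRow n (k + 1) fun i => stair (k + 1) i + _, hClass_eq, hInt_nat]
  congr 2
  have := rowDet_hRow_stair_add (k + 1) r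
  rw [if_neg (Nat.succ_ne_zero k)] at this
  rw [← this]
  simp only [Fin.val_eq_zero_iff]

/-! ### Linear independence of the Schubert classes -/

/-- The ring `ℤ[t][x_1, …, x_k] / (x_j ^ n - t ^ n)`, with basis over `ℤ[t]` the monomials
`(x_1 / t) ^ (a_1) ⋯ (x_k / t) ^ (a_k)`, `a_j ∈ ℤ / n`. -/
abbrev TorusRing (n k : ℕ) : Type := AddMonoidAlgebra ℤ[X] (Fin k → ZMod n)

/-- The variable `x_j`. -/
def torusVar (n k : ℕ) (j : Fin k) : TorusRing n k := AddMonoidAlgebra.single (Pi.single j 1) X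

/-- The multiset of all variables. -/
def torusVars (n k : ℕ) : Multiset (TorusRing n k) := Finset.univ.val.map (torusVar n k)

/-- The substitution `q ↦ (-1)^(k+1) t^n`. -/
def qSubst (n k : ℕ) : ℤ[X] →+* ℤ[X] := Polynomial.compRingHom ((-1) ^ (k + 1) * X ^ n)

/-- The evaluation of symmetric functions at `x_1, …, x_k`. -/
def torusEval (n k : ℕ) : MvPolynomial (Fin k) ℤ[X] →+* TorusRing n k :=
  MvPolynomial.eval₂Hom (AddMonoidAlgebra.singleZeroRingHom.comp (qSubst n k))
    fun i => (torusVars n k).esymm (i + 1)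

/-- The powers of the variables. -/
def torusRow (n k : ℕ) (a : ℕ) (j : Fin k) : TorusRing n k := torusVar n k j ^ a

theorem torusEval_eGen (n k : ℕ) (m : ℕ) (hm : m ≤ k) :
    torusEval n k (eGen k m) = (torusVars n k).esymm m := by
  rw [eGen]
  by_cases h : m = 0
  · subst h; simp [Multiset.esymm]
  · rw [if_neg (by omega), dif_pos (by omega)]
    simp only [torusEval, MvPolynomial.coe_eval₂Hom, MvPolynomial.eval₂_X]
    congr 1
    omega

theorem torusVar_pow (n k : ℕ) (j : Fin k) (a : ℕ) :
    torusVar n k j ^ a = AddMonoidAlgebra.single (Pi.single j (a : ZMod n)) (X ^ a) := by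
  rw [torusVar, AddMonoidAlgebra.single_pow, ← Pi.single_smul]
  simp

/-- Each variable is a root of the polynomial with roots `x_1, …, x_k`. -/
theorem isRec_torusRow (n k : ℕ) (j : Fin k) :
    IsRec (fun l => torusEval n k (recCoeff k l)) fun a => torusRow n k a j := by
  have hcard : Multiset.card (torusVars n k) = k := by simp [torusVars]
  have h := Multiset.prod_X_sub_X_eq_sum_esymm (torusVars n k)
  have h0 : ((torusVars n k).map fun t => (X : (TorusRing n k)[X]) - C t).prod.eval
      (torusVar n k j) = 0 := by
    rw [Polynomial.eval_multiset_prod, Multiset.map_map]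
    refine Multiset.prod_eq_zero (Multiset.mem_map.2 ⟨torusVar n k j, ?_, by simp⟩)
    exact Multiset.mem_map.2 ⟨j, Finset.mem_univ j, rfl⟩
  rw [h, hcard] at h0
  simp only [eval_finsetSum, eval_mul, eval_pow, eval_neg, eval_one, eval_C, eval_X] at h0
  rw [Finset.sum_range_succ'] at h0
  simp only [pow_zero, Nat.sub_zero, one_mul] at h0
  have he0 : (torusVars n k).esymm 0 = 1 := by simp [Multiset.esymm]
  rw [he0, one_mul, add_comm, add_eq_zero_iff_eq_neg, ← Finset.sum_range_reflect,
    Finset.sum_range, ← Finset.sum_neg_distrib] at h0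
  intro a
  simp only [torusRow]
  rw [pow_add, h0, Finset.mul_sum]
  refine Finset.sum_congr rfl fun l _ => ?_
  have hl := l.2
  rw [recCoeff, map_mul, torusEval_eGen _ _ _ (by omega), map_pow, map_neg, map_one,
    show k - 1 - (l : ℕ) + 1 = k - l by omega, show k - (k - (l : ℕ)) = l by omega,
    show k - (l : ℕ) = k - 1 - l + 1 by omega, pow_succ, pow_add]
  ring

theorem rowDet_torusRow (n k : ℕ) (b : Fin k → ℕ) :
    rowDet (torusRow n k) b =
      torusEval n k (rowDet (hRow k) b) * rowDet (torusRow n k) (stair k) := by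
  rw [← rowDet_map]
  refine rowDet_eq_mul_of_isRec _ _ _ (fun j => (isRec_hRow k j).map _) (isRec_torusRow n k) ?_ b
  rw [rowDet_map, rowDet_hRow_stair, map_one]

theorem torusRow_add_period (n k : ℕ) (a : ℕ) :
    torusRow n k (a + n) = (AddMonoidAlgebra.single 0 (X ^ n) : TorusRing n k) • torusRow n k a := by
  ext1 j
  simp only [torusRow, Pi.smul_apply, smul_eq_mul]
  rw [torusVar_pow, torusVar_pow, AddMonoidAlgebra.single_mul_single, zero_add, ← pow_add]
  simp [add_comm]

theorem rowDet_torusRow_stair_add {n k r : ℕ} (hk : k ≠ 0) :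
    rowDet (torusRow n k) (fun i => stair k i + if (i : ℕ) = 0 then r else 0) =
      torusEval n k (hGen k r) * rowDet (torusRow n k) (stair k) := by
  rw [rowDet_torusRow, rowDet_hRow_stair_add, if_neg hk]

/-- The relations of quantum cohomology hold after multiplication by the Vandermonde determinant,
since then `h_r` becomes a determinant with two proportional rows. -/
theorem torusEval_relation {n k : ℕ} (hk : k ≤ n) (i : Fin k) :
    torusEval n k (relation n k i) * rowDet (torusRow n k) (stair k) = 0 := by
  have hi := i.2
  have hk0 : k ≠ 0 := by omega
  have key : ∀ r m, r + (k - 1) = m + n →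
      torusEval n k (hGen k r) * rowDet (torusRow n k) (stair k) =
      AddMonoidAlgebra.single 0 (X ^ n) *
        rowDet (torusRow n k) (fun i => if (i : ℕ) = 0 then m else stair k i) := by
    intro r m hm
    rw [← rowDet_torusRow_stair_add hk0]
    refine rowDet_smul_row _ _ ⟨0, by omega⟩ ?_ ?_
    · simp only [stair, if_true]
      rw [← torusRow_add_period, Nat.sub_zero, ← hm, add_comm]
    · intro l hl
      have : (l : ℕ) ≠ 0 := fun h => hl (Fin.ext h)
      simp [this]
  rw [relation]
  split_ifs with h
  · rw [map_add, add_mul, key n (k - 1) (by omega)]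
    have : (fun i : Fin k => if (i : ℕ) = 0 then k - 1 else stair k i) = stair k := by
      ext l; simp only [stair]; split_ifs with h <;> omega
    rw [this, ← add_mul]
    convert zero_mul _
    rw [torusEval, MvPolynomial.coe_eval₂Hom, MvPolynomial.eval₂_C, RingHom.comp_apply]
    simp only [qSubst, coe_compRingHom_apply, mul_comp, pow_comp, neg_comp, one_comp, X_comp]
    change AddMonoidAlgebra.single _ _ + AddMonoidAlgebra.single _ _ = _
    rw [← AddMonoidAlgebra.single_add, AddMonoidAlgebra.single_eq_zero, pow_succ, ← mul_assoc,
      ← mul_assoc, ← mul_pow]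
    simp
  · rw [key _ i (by omega), rowDet_eq_zero_of_eq _ (i := ⟨0, by omega⟩)
      (j := ⟨k - 1 - i, by omega⟩) (by rw [Ne, Fin.mk.injEq]; omega), mul_zero]
    simp only [stair, if_true]
    rw [if_neg (by omega)]; omega

theorem torusEval_of_mem {n k : ℕ} (hk : k ≤ n) {p : MvPolynomial (Fin k) ℤ[X]}
    (hp : p ∈ Ideal.span (Set.range (relation n k))) :
    torusEval n k p * rowDet (torusRow n k) (stair k) = 0 := by
  induction hp using Submodule.span_induction with
  | mem x hx => obtain ⟨i, rfl⟩ := hx; exact torusEval_relation hk i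
  | zero => simp
  | add x y _ _ hx hy => rw [map_add, add_mul, hx, hy, add_zero]
  | smul a x _ hx => rw [smul_eq_mul, map_mul, mul_assoc, hx, mul_zero]

theorem prod_single {n k : ℕ} (b : Fin k → ℕ) :
    ∏ i, torusRow n k (b i) i =
      AddMonoidAlgebra.single (fun i => (b i : ZMod n)) (X ^ ∑ i, b i) := by
  have : ∀ s : Finset (Fin k), ∏ i ∈ s, torusRow n k (b i) i =
      AddMonoidAlgebra.single (∑ i ∈ s, Pi.single i (b i : ZMod n)) (X ^ ∑ i ∈ s, b i) := by
    intro s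
    induction s using Finset.induction_on with
    | empty => simp [AddMonoidAlgebra.one_def]
    | insert i s hi ih =>
      rw [Finset.prod_insert hi, Finset.sum_insert hi, Finset.sum_insert hi, ih, torusRow,
        torusVar_pow, AddMonoidAlgebra.single_mul_single, pow_add]
  rw [this]
  congr 1
  exact Finset.univ_sum_single _

theorem BoxPartition.pos_strictAnti {n k : ℕ} (μ : BoxPartition n k) : StrictAnti μ.pos := by
  intro i j hij
  have h1 := μ.anti hij.le
  have h2 : (i : ℕ) < j := hij
  have := j.2
  simp only [BoxPartition.pos, stair]; omega

theorem BoxPartition.pos_lt {n k : ℕ} (hk : k ≤ n) (μ : BoxPartition n k) (i : Fin k) :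
    μ.pos i < n := by
  have h1 := μ.le i
  have := i.2
  simp only [BoxPartition.pos, stair]; omega

theorem BoxPartition.pos_injective {n k : ℕ} :
    Function.Injective (BoxPartition.pos : BoxPartition n k → Fin k → ℕ) := by
  intro μ ν h
  ext i
  have := congrFun h i
  simp only [BoxPartition.pos] at this; omega

theorem eq_of_pos_comp {n k : ℕ} (μ ν : BoxPartition n k) (τ : Equiv.Perm (Fin k))
    (h : ∀ i, ν.pos (τ i) = μ.pos i) : τ = 1 ∧ ν = μ := by
  have hτ : StrictMono τ := by
    intro i j hij
    by_contra hle
    have h1 := ν.pos_strictAnti.antitone (not_lt.1 hle)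
    have h2 := μ.pos_strictAnti hij
    rw [h, h] at h1
    omega
  have h1 : τ = 1 := by
    ext i : 1
    exact congrFun ((hτ.range_inj (g := id) strictMono_id).1 (by simp)) i
  refine ⟨h1, BoxPartition.pos_injective (funext fun i => ?_)⟩
  simpa [h1] using h i

open scoped Classical in
/-- The coefficient of the leading monomial of `μ` in the alternant of `ν`. -/
theorem coeff_rowDet_torusRow {n k : ℕ} (hk : k ≤ n) (μ ν : BoxPartition n k) :
    (rowDet (torusRow n k) ν.pos).coeff (fun i => (μ.pos i : ZMod n)) =
      if ν = μ then X ^ ∑ i, μ.pos i else 0 := by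
  rw [rowDet, Matrix.det_apply, AddMonoidAlgebra.coeff_sum, Finsupp.finsetSum_apply]
  have hterm : ∀ τ : Equiv.Perm (Fin k), ((Equiv.Perm.sign τ • ∏ i,
      (Matrix.of fun i j => torusRow n k (ν.pos i) j) (τ i) i : TorusRing n k)).coeff
        (fun i => (μ.pos i : ZMod n)) = if τ = 1 ∧ ν = μ then X ^ ∑ i, μ.pos i else 0 := by
    intro τ
    have hp := prod_single (n := n) fun i => ν.pos (τ i)
    simp only [Matrix.of_apply, hp]
    rw [AddMonoidAlgebra.coeff_smul_apply, AddMonoidAlgebra.coeff_single, Finsupp.single_apply]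
    by_cases h : τ = 1 ∧ ν = μ
    · obtain ⟨rfl, rfl⟩ := h
      simp
    · rw [if_neg h, if_neg, smul_zero]
      intro hf
      refine h (eq_of_pos_comp μ ν τ fun i => ?_)
      have h2 := congrFun hf i
      simp only [ZMod.natCast_eq_natCast_iff] at h2
      exact Nat.ModEq.eq_of_lt_of_lt h2 (ν.pos_lt hk _) (μ.pos_lt hk _)
  rw [Finset.sum_congr rfl fun τ _ => hterm τ, Finset.sum_eq_single 1]
  · simp
  · intro τ _ hτ; simp [hτ]
  · simp

theorem schubert_eq_mk {n k : ℕ} (ν : BoxPartition n k) :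
    schubert ν = Ideal.Quotient.mk _ (rowDet (hRow k) ν.pos) := by
  rw [schubert_eq_rowDet, rowDet_qRow]

/-- The Schubert classes are linearly independent over `ℤ[q]`. -/
theorem schubert_independent {n k : ℕ} (hn : n ≠ 0) (hk : k ≤ n) (c : BoxPartition n k → ℤ[X])
    (h : ∑ ν, c ν • schubert ν = 0) (μ : BoxPartition n k) : c μ = 0 := by
  classical
  have h1 : Ideal.Quotient.mk (Ideal.span (Set.range (relation n k)))
      (∑ ν, MvPolynomial.C (c ν) * rowDet (hRow k) ν.pos) = 0 := by
    rw [← h, map_sum]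
    refine Finset.sum_congr rfl fun ν _ => ?_
    rw [schubert_eq_mk, ← MvPolynomial.smul_eq_C_mul]
    rfl
  have h2 := torusEval_of_mem hk (Ideal.Quotient.eq_zero_iff_mem.1 h1)
  rw [map_sum, Finset.sum_mul] at h2
  simp only [map_mul, mul_assoc, ← rowDet_torusRow] at h2
  have h3 := congrArg (fun x : TorusRing n k => x.coeff fun i => (μ.pos i : ZMod n)) h2
  simp only [AddMonoidAlgebra.coeff_sum, Finsupp.finsetSum_apply] at h3
  have hC : ∀ p : ℤ[X], torusEval n k (MvPolynomial.C p) =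
      AddMonoidAlgebra.single 0 (qSubst n k p) := by
    intro p
    rw [torusEval, MvPolynomial.coe_eval₂Hom, MvPolynomial.eval₂_C]; rfl
  simp only [hC, AddMonoidAlgebra.coeff_single_zero_mul, coeff_rowDet_torusRow hk] at h3
  simp only [mul_ite, mul_zero, Finset.sum_ite_eq', Finset.mem_univ, if_true] at h3
  have h4 : qSubst n k (c μ) = 0 := by
    rcases mul_eq_zero.1 h3 with h | h
    · exact h
    · exact absurd h (pow_ne_zero _ X_ne_zero)
  rw [qSubst, coe_compRingHom_apply] at h4
  rcases comp_eq_zero_iff.1 h4 with h | ⟨_, h⟩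
  · exact h
  · exfalso
    have h5 := congrArg natDegree h
    rw [natDegree_C] at h5
    have h6 : ((-1) ^ (k + 1) * X ^ n : ℤ[X]).natDegree = n := by
      rcases neg_one_pow_eq_or ℤ[X] (k + 1) with h | h <;> rw [h] <;> simp
    omega

/-! ### Hopping zero-letters -/

/-- The positions `n + 1 - p` for the zero-letters `p` of the string of `μ`. These are the
one-letters of the string of the conjugate partition. -/
def zeroSet {n k : ℕ} (μ : BoxPartition n k) : Finset (ZMod n) := bstring n μ.conj

/-- The particles in `S` may all hop by one step: `S` consists of particles, and no particle hops
onto one that stays. -/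
def HopValid {n : ℕ} (Z S : Finset (ZMod n)) : Prop :=
  S ⊆ Z ∧ ∀ x ∈ S, x + 1 ∈ Z → x + 1 ∈ S

/-- The result of letting the particles in `S` hop. -/
def hop {n : ℕ} (Z S : Finset (ZMod n)) : Finset (ZMod n) := (Z \ S) ∪ S.image (· + 1)

theorem BoxPartition.lt_conj_iff {n k : ℕ} (μ : BoxPartition n k) (i : Fin k) (j : Fin (n - k)) :
    (i : ℕ) < μ.conj j ↔ (j : ℕ) < μ.parts i := by
  constructor
  · intro h
    by_contra hle
    have hsub : (Finset.univ.filter fun l => (j : ℕ) < μ.parts l) ⊆ Finset.Iio i := by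
      intro l hl
      rw [Finset.mem_filter] at hl
      rw [Finset.mem_Iio]
      by_contra hil
      have := μ.anti (not_lt.1 hil)
      omega
    have := Finset.card_le_card hsub
    rw [Fin.card_Iio] at this
    simp only [BoxPartition.conj] at h
    omega
  · intro h
    have hsub : Finset.Iic i ⊆ (Finset.univ.filter fun l => (j : ℕ) < μ.parts l) := by
      intro l hl
      rw [Finset.mem_Iic] at hl
      rw [Finset.mem_filter]
      have := μ.anti hl
      exact ⟨Finset.mem_univ _, by omega⟩
    have := Finset.card_le_card hsub
    rw [Fin.card_Iic] at this
    simp only [BoxPartition.conj]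
    omega

theorem BoxPartition.conj_le {n k : ℕ} (μ : BoxPartition n k) (j : Fin (n - k)) :
    μ.conj j ≤ k := by
  have := Finset.card_le_univ (Finset.univ.filter fun i => (j : ℕ) < μ.parts i)
  simpa [BoxPartition.conj] using this

theorem BoxPartition.conj_anti {n k : ℕ} (μ : BoxPartition n k) : Antitone μ.conj := by
  intro i j hij
  refine Finset.card_le_card fun l hl => ?_
  rw [Finset.mem_filter] at hl ⊢
  have : (i : ℕ) ≤ j := hij
  exact ⟨hl.1, by omega⟩

/-- A number with the same residue as another one from an interval of length `n`. -/
theorem natCast_eq_iff_of_lt {n a b c : ℕ} (ha : c ≤ a) (ha' : a < c + n) (hb : c ≤ b)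
    (hb' : b < c + n) : (a : ZMod n) = b ↔ a = b := by
  refine ⟨fun h => ?_, fun h => by rw [h]⟩
  obtain ⟨a, rfl⟩ := Nat.exists_eq_add_of_le ha
  obtain ⟨b, rfl⟩ := Nat.exists_eq_add_of_le hb
  rw [Nat.cast_add, Nat.cast_add, add_right_inj, ZMod.natCast_eq_natCast_iff] at h
  rw [Nat.ModEq.eq_of_lt_of_lt h (by omega) (by omega)]

theorem card_bstring {n m : ℕ} (hm : m ≤ n) {p : Fin m → ℕ} (hp : Antitone p)
    (hle : ∀ i, p i ≤ n - m) : (bstring n p).card = m := by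
  rw [bstring, Finset.card_image_of_injective, Finset.card_univ, Fintype.card_fin]
  intro i j hij
  have hi := hle i
  have hj := hle j
  have h2 := i.2
  have h3 := j.2
  have h := (natCast_eq_iff_of_lt (c := 1) (by omega) (by omega) (by omega) (by omega)).1 hij
  rcases lt_trichotomy i j with h1 | h1 | h1
  · have h4 := hp h1.le
    have : (i : ℕ) < j := h1
    omega
  · exact h1
  · have h4 := hp h1.le
    have : (j : ℕ) < i := h1
    omega

theorem card_zeroSet {n k : ℕ} (hk : k ≤ n) (μ : BoxPartition n k) :
    (zeroSet μ).card = n - k :=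
  card_bstring (by omega) μ.conj_anti fun j => by have := μ.conj_le j; omega

/-- The position of a one-letter is `pos i + 1`. -/
theorem mem_bstring_iff {n k : ℕ} (μ : BoxPartition n k) (x : ZMod n) :
    x ∈ bstring n μ.parts ↔ ∃ i, x = (μ.pos i : ZMod n) + 1 := by
  simp only [bstring, Finset.mem_image, Finset.mem_univ, true_and]
  refine exists_congr fun i => ?_
  have := i.2
  rw [eq_comm, show μ.parts i + (k - (i : ℕ)) = μ.pos i + 1 by
    simp only [BoxPartition.pos, stair]; omega]
  push_cast; rfl

/-- The one-letters for the conjugate partition are the reflected zero-letters. -/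
theorem mem_zeroSet_iff {n k : ℕ} (hn : n ≠ 0) (hk : k ≤ n) (μ : BoxPartition n k) (x : ZMod n) :
    x ∈ zeroSet μ ↔ ∀ i, x ≠ -(μ.pos i : ZMod n) := by
  have : NeZero n := ⟨hn⟩
  set O : Finset (ZMod n) := Finset.univ.image fun i => -(μ.pos i : ZMod n) with hO
  have hOcard : O.card = k := by
    rw [hO, Finset.card_image_of_injective, Finset.card_univ, Fintype.card_fin]
    intro i j hij
    have h := neg_injective hij
    rw [natCast_eq_iff_of_lt (c := 0) (Nat.zero_le _) (by simpa using μ.pos_lt hk i)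
      (Nat.zero_le _) (by simpa using μ.pos_lt hk j)] at h
    exact μ.pos_strictAnti.injective h
  have hdis : zeroSet μ ⊆ Oᶜ := by
    intro x hx
    simp only [hO, Finset.mem_compl, Finset.mem_image, Finset.mem_univ, true_and, not_exists]
    intro i hi
    simp only [zeroSet, bstring, Finset.mem_image, Finset.mem_univ, true_and] at hx
    obtain ⟨j, rfl⟩ := hx
    rw [eq_comm, eq_neg_iff_add_eq_zero, ← Nat.cast_add, ZMod.natCast_eq_zero_iff] at hi
    have h1 := μ.lt_conj_iff i j
    have h2 := μ.conj_le j
    have h3 := μ.le i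
    have h4 := i.2
    have h5 := j.2
    simp only [BoxPartition.pos, stair] at hi
    obtain ⟨d, hd⟩ := hi
    have hd1 : d = 0 ∨ d = 1 ∨ 2 ≤ d := by omega
    by_cases hc : (j : ℕ) < μ.parts i
    · have := h1.2 hc
      rcases hd1 with rfl | rfl | h6
      · omega
      · omega
      · have := Nat.mul_le_mul_left n h6
        omega
    · have : ¬ (i : ℕ) < μ.conj j := fun h => hc (h1.1 h)
      rcases hd1 with rfl | rfl | h6
      · omega
      · omega
      · have := Nat.mul_le_mul_left n h6
        omega
  have heq : zeroSet μ = Oᶜ := Finset.eq_of_subset_of_card_le hdis (by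
    rw [Finset.card_compl, hOcard, card_zeroSet hk, ZMod.card])
  rw [heq]
  simp only [hO, Finset.mem_compl, Finset.mem_image, Finset.mem_univ, true_and, not_exists]
  exact forall_congr' fun i => not_congr eq_comm

theorem mem_zeroSet_iff_bstring {n k : ℕ} (hn : n ≠ 0) (hk : k ≤ n) (μ : BoxPartition n k)
    (x : ZMod n) : x ∈ zeroSet μ ↔ 1 - x ∉ bstring n μ.parts := by
  rw [mem_zeroSet_iff hn hk, mem_bstring_iff, not_exists]
  refine forall_congr' fun i => not_congr ?_
  constructor
  · rintro rfl; ring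
  · intro h
    linear_combination -h

theorem bstring_injective {n k : ℕ} (hk : k ≤ n) {μ ν : BoxPartition n k}
    (h : bstring n μ.parts = bstring n ν.parts) : μ = ν := by
  refine BoxPartition.pos_injective
    ((μ.pos_strictAnti.range_inj ν.pos_strictAnti).1 (Set.ext fun y => ?_))
  have key : ∀ {μ ν : BoxPartition n k}, bstring n μ.parts = bstring n ν.parts →
      ∀ i, ∃ j, ν.pos j = μ.pos i := by
    intro μ ν h i
    have h1 : (μ.pos i : ZMod n) + 1 ∈ bstring n ν.parts := by
      rw [← h, mem_bstring_iff]; exact ⟨i, rfl⟩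
    obtain ⟨j, hj⟩ := (mem_bstring_iff ν _).1 h1
    refine ⟨j, ?_⟩
    rw [add_left_inj, natCast_eq_iff_of_lt (c := 0) (Nat.zero_le _)
      (by simpa using μ.pos_lt hk i) (Nat.zero_le _) (by simpa using ν.pos_lt hk j)] at hj
    exact hj.symm
  constructor
  · rintro ⟨i, rfl⟩; exact key h i
  · rintro ⟨i, rfl⟩; exact key h.symm i

theorem zeroSet_injective {n k : ℕ} (hn : n ≠ 0) (hk : k ≤ n) {μ ν : BoxPartition n k}
    (h : zeroSet μ = zeroSet ν) : μ = ν := by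
  refine bstring_injective hk (Finset.ext fun x => ?_)
  have h1 := mem_zeroSet_iff_bstring hn hk μ (1 - x)
  have h2 := mem_zeroSet_iff_bstring hn hk ν (1 - x)
  rw [sub_sub_cancel] at h1 h2
  rw [h, h2] at h1
  exact (not_iff_not.1 h1).symm

/-! ### Arcs -/

/-- The `s`-th position on the arc starting at the `i`-th one-letter, after reflection. -/
def arc (n : ℕ) {k : ℕ} (a : Fin (k + 1) → ℕ) (i : Fin (k + 1)) (s : ℕ) : ZMod n :=
  -((a i + s : ℕ) : ZMod n)

theorem arc_succ_add_one (n : ℕ) {k : ℕ} (a : Fin (k + 1) → ℕ) (i : Fin (k + 1)) (s : ℕ) :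
    arc n a i (s + 1) + 1 = arc n a i s := by
  simp only [arc]; push_cast; ring

/-- The arcs cover the circle. -/
theorem exists_arc {n k : ℕ} (hn : n ≠ 0) (a : Fin (k + 1) → ℕ) (x : ZMod n) :
    ∃ i s, s < gap n a i ∧ x = arc n a i s := by
  have : NeZero n := ⟨hn⟩
  -- the representative of `-x` in the interval that begins at the smallest position
  obtain ⟨y, hy1, hy2, hy3⟩ : ∃ y : ℕ, a (Fin.last k) ≤ y ∧ y < a (Fin.last k) + n ∧
      x = -(y : ZMod n) := by
    refine ⟨a (Fin.last k) + (-x - (a (Fin.last k) : ZMod n)).val, by omega, ?_, ?_⟩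
    · have := ZMod.val_lt (-x - (a (Fin.last k) : ZMod n)); omega
    · rw [Nat.cast_add, ZMod.natCast_rightInverse]; ring
  have hne : (Finset.univ.filter fun i => a i ≤ y).Nonempty := ⟨Fin.last k, by simpa using hy1⟩
  obtain ⟨i, hi, hmin⟩ := Finset.exists_minimal hne
  rw [Finset.mem_filter] at hi
  refine ⟨i, y - a i, ?_, ?_⟩
  · induction i using Fin.cases with
    | zero => rw [gap_zero]; omega
    | succ i =>
      rw [gap_succ]
      have : ¬ a i.castSucc ≤ y := by
        intro h
        have h1 := hmin (Finset.mem_filter.2 ⟨Finset.mem_univ _, h⟩)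
          (Fin.castSucc_lt_succ (i := i)).le
        exact absurd h1 (not_le.2 (Fin.castSucc_lt_succ (i := i)))
      omega
  · rw [arc, hy3, Nat.add_sub_cancel' hi.2]

theorem arc_injective {n k : ℕ} (hn : n ≠ 0) {a : Fin (k + 1) → ℕ} (ha : IsPos n a)
    {i i' : Fin (k + 1)} {s s' : ℕ} (hs : s < gap n a i) (hs' : s' < gap n a i')
    (h : arc n a i s = arc n a i' s') : i = i' ∧ s = s' := by
  have : NeZero n := ⟨hn⟩
  have hbij : Function.Bijective fun p : (Σ i, Fin (gap n a i)) => arc n a p.1 p.2 := by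
    rw [Fintype.bijective_iff_surjective_and_card]
    refine ⟨fun x => ?_, ?_⟩
    · obtain ⟨i, s, hs, rfl⟩ := exists_arc hn a x
      exact ⟨⟨i, s, hs⟩, rfl⟩
    · rw [Fintype.card_sigma, ZMod.card]
      simp [sum_gap ha]
  have := hbij.1 (a₁ := ⟨i, s, hs⟩) (a₂ := ⟨i', s', hs'⟩) h
  simp only [Sigma.mk.injEq] at this
  obtain ⟨rfl, h2⟩ := this
  exact ⟨rfl, by simpa using h2⟩

theorem arc_mem_zeroSet {n k : ℕ} (hk : k + 1 ≤ n) (μ : BoxPartition n (k + 1))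
    {i : Fin (k + 1)} {s : ℕ} (hs : s < gap n μ.pos i) :
    arc n μ.pos i s ∈ zeroSet μ ↔ s ≠ 0 := by
  have hn : n ≠ 0 := by omega
  rw [mem_zeroSet_iff hn hk]
  have h0 : ∀ l, -(μ.pos l : ZMod n) = arc n μ.pos l 0 := by intro l; simp [arc]
  constructor
  · rintro h rfl
    exact h i (h0 i).symm
  · intro h l hl
    rw [h0] at hl
    exact h (arc_injective hn (isPos_pos hk μ) hs (gap_pos (isPos_pos hk μ) l) hl).2

/-- The set of particles that hop when the one-letters move by `t`. -/
def hopSet (n : ℕ) {k : ℕ} (a t : Fin (k + 1) → ℕ) : Finset (ZMod n) :=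
  (Finset.univ.sigma fun i => Finset.Icc 1 (t i)).image fun p => arc n a p.1 p.2

theorem arc_mem_hopSet {n k : ℕ} (hn : n ≠ 0) {a t : Fin (k + 1) → ℕ} (ha : IsPos n a)
    (ht : ∀ i, t i < gap n a i) {i : Fin (k + 1)} {s : ℕ} (hs : s < gap n a i) :
    arc n a i s ∈ hopSet n a t ↔ 1 ≤ s ∧ s ≤ t i := by
  simp only [hopSet, Finset.mem_image, Finset.mem_sigma, Finset.mem_univ, true_and,
    Finset.mem_Icc, Sigma.exists]
  constructor
  · rintro ⟨i', s', h1, h2⟩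
    obtain ⟨rfl, rfl⟩ := arc_injective hn ha (lt_of_le_of_lt h1.2 (ht _)) hs h2
    exact h1
  · exact fun h => ⟨i, s, h, rfl⟩

theorem card_hopSet {n k : ℕ} (hn : n ≠ 0) {a t : Fin (k + 1) → ℕ} (ha : IsPos n a)
    (ht : ∀ i, t i < gap n a i) : (hopSet n a t).card = ∑ i, t i := by
  rw [hopSet, Finset.card_image_of_injOn, Finset.card_sigma]
  · simp
  · rintro ⟨i, s⟩ h1 ⟨i', s'⟩ h2 h
    simp only [Finset.coe_sigma, Set.mem_sigma_iff, Finset.mem_coe, Finset.mem_univ, true_and,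
      Finset.mem_Icc] at h1 h2
    obtain ⟨rfl, rfl⟩ := arc_injective hn ha (lt_of_le_of_lt h1.2 (ht _))
      (lt_of_le_of_lt h2.2 (ht _)) h
    rfl

theorem hopValid_hopSet {n k : ℕ} (hk : k + 1 ≤ n) (μ : BoxPartition n (k + 1))
    {t : Fin (k + 1) → ℕ} (ht : ∀ i, t i < gap n μ.pos i) :
    HopValid (zeroSet μ) (hopSet n μ.pos t) := by
  have hn : n ≠ 0 := by omega
  have ha := isPos_pos hk μ
  constructor
  · intro x hx
    obtain ⟨i, s, hs, rfl⟩ := exists_arc hn μ.pos x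
    rw [arc_mem_hopSet hn ha ht hs] at hx
    rw [arc_mem_zeroSet hk μ hs]; omega
  · intro x hx hx1
    obtain ⟨i, s, hs, rfl⟩ := exists_arc hn μ.pos x
    rw [arc_mem_hopSet hn ha ht hs] at hx
    obtain ⟨s, rfl⟩ := Nat.exists_eq_add_of_le' hx.1
    rw [arc_succ_add_one] at hx1 ⊢
    rw [arc_mem_zeroSet hk μ (by omega)] at hx1
    rw [arc_mem_hopSet hn ha ht (by omega)]
    omega

theorem hopSet_injective {n k : ℕ} (hn : n ≠ 0) {a t t' : Fin (k + 1) → ℕ} (ha : IsPos n a)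
    (ht : ∀ i, t i < gap n a i) (ht' : ∀ i, t' i < gap n a i)
    (h : hopSet n a t = hopSet n a t') : t = t' := by
  have key : ∀ {t t' : Fin (k + 1) → ℕ}, (∀ i, t i < gap n a i) → (∀ i, t' i < gap n a i) →
      hopSet n a t = hopSet n a t' → ∀ i, t i ≤ t' i := by
    intro t t' ht ht' h i
    by_contra hlt
    have h1 := (arc_mem_hopSet hn ha ht (ht i)).2 ⟨by omega, le_rfl⟩
    rw [h, arc_mem_hopSet hn ha ht' (ht i)] at h1
    exact hlt h1.2
  exact funext fun i => le_antisymm (key ht ht' h i) (key ht' ht h.symm i)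

/-- Every admissible set of hopping particles comes from moving the one-letters: it meets each arc
in an initial segment. -/
theorem exists_hopSet_eq {n k : ℕ} (hk : k + 1 ≤ n) (μ : BoxPartition n (k + 1))
    {S : Finset (ZMod n)} (hS : HopValid (zeroSet μ) S) :
    ∃ t : Fin (k + 1) → ℕ, (∀ i, t i < gap n μ.pos i) ∧ hopSet n μ.pos t = S := by
  classical
  have hn : n ≠ 0 := by omega
  have ha := isPos_pos hk μ
  set t : Fin (k + 1) → ℕ := fun i =>
    Nat.findGreatest (fun s => arc n μ.pos i s ∈ S) (gap n μ.pos i - 1) with htdef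
  have ht : ∀ i, t i < gap n μ.pos i := fun i => by
    have h1 := gap_pos ha i
    have h2 := Nat.findGreatest_le (P := fun s => arc n μ.pos i s ∈ S) (gap n μ.pos i - 1)
    simp only [htdef]; omega
  have h0 : ∀ i, arc n μ.pos i 0 ∉ S := fun i h =>
    (arc_mem_zeroSet hk μ (gap_pos ha i)).1 (hS.1 h) rfl
  have hdown : ∀ i s d, s + d < gap n μ.pos i → 1 ≤ s → arc n μ.pos i (s + d) ∈ S →
      arc n μ.pos i s ∈ S := by
    intro i s d
    induction d with
    | zero => exact fun _ _ h => h
    | succ d ih =>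
      intro hlt hs h
      refine ih (by omega) hs ?_
      have h1 := hS.2 _ h
      rw [← add_assoc, arc_succ_add_one] at h1
      exact h1 ((arc_mem_zeroSet hk μ (by omega)).2 (by omega))
  refine ⟨t, ht, Finset.ext fun x => ?_⟩
  obtain ⟨i, s, hs, rfl⟩ := exists_arc hn μ.pos x
  rw [arc_mem_hopSet hn ha ht hs]
  constructor
  · rintro ⟨h1, h2⟩
    obtain ⟨d, hd⟩ := Nat.exists_eq_add_of_le h2
    refine hdown i s d (hd ▸ ht i) h1 ?_
    rw [← hd]
    exact Nat.findGreatest_of_ne_zero (P := fun s => arc n μ.pos i s ∈ S) rfl (by omega)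
  · intro h
    refine ⟨Nat.one_le_iff_ne_zero.2 fun hs0 => h0 i (hs0 ▸ h), ?_⟩
    exact Nat.le_findGreatest (by omega) h

theorem arc_mem_hop {n k : ℕ} (hk : k + 1 ≤ n) (μ : BoxPartition n (k + 1))
    {t : Fin (k + 1) → ℕ} (ht : ∀ i, t i < gap n μ.pos i) {i : Fin (k + 1)} {s : ℕ}
    (hs : s < gap n μ.pos i) :
    arc n μ.pos i s ∈ hop (zeroSet μ) (hopSet n μ.pos t) ↔ s ≠ t i := by
  have hn : n ≠ 0 := by omega
  have ha := isPos_pos hk μ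
  rw [hop, Finset.mem_union, Finset.mem_sdiff, arc_mem_zeroSet hk μ hs,
    arc_mem_hopSet hn ha ht hs]
  have himg : arc n μ.pos i s ∈ (hopSet n μ.pos t).image (· + 1) ↔ s < t i := by
    rw [Finset.mem_image]
    constructor
    · rintro ⟨x, hx, hx1⟩
      obtain ⟨i', s', hs', rfl⟩ := exists_arc hn μ.pos x
      rw [arc_mem_hopSet hn ha ht hs'] at hx
      obtain ⟨s', rfl⟩ := Nat.exists_eq_add_of_le' hx.1
      rw [arc_succ_add_one] at hx1
      obtain ⟨rfl, rfl⟩ := arc_injective hn ha (by omega) hs hx1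
      omega
    · intro h
      have := ht i
      exact ⟨arc n μ.pos i (s + 1), (arc_mem_hopSet hn ha ht (by omega)).2 ⟨by omega, h⟩,
        arc_succ_add_one n _ i s⟩
  rw [himg]
  omega

/-- The one-letters after the hop are `pos i + t i`. -/
theorem mem_hop_hopSet {n k : ℕ} (hk : k + 1 ≤ n) (μ : BoxPartition n (k + 1))
    {t : Fin (k + 1) → ℕ} (ht : ∀ i, t i < gap n μ.pos i) (x : ZMod n) :
    x ∈ hop (zeroSet μ) (hopSet n μ.pos t) ↔ ∀ i, x ≠ -((μ.pos i + t i : ℕ) : ZMod n) := by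
  have hn : n ≠ 0 := by omega
  have ha := isPos_pos hk μ
  obtain ⟨i, s, hs, rfl⟩ := exists_arc hn μ.pos x
  rw [arc_mem_hop hk μ ht hs]
  constructor
  · intro h l hl
    obtain ⟨rfl, rfl⟩ := arc_injective hn ha hs (ht l) hl
    exact h rfl
  · rintro h rfl
    exact h i rfl

/-! ### The quantum Pieri rule in terms of hopping particles -/

theorem add_sub_le_of_strictAnti {k : ℕ} {b : Fin k → ℕ} (hb : StrictAnti b) {i j : Fin k}
    (hij : i ≤ j) : b j + ((j : ℕ) - i) ≤ b i := by
  obtain ⟨i, hi⟩ := i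
  obtain ⟨j, hj⟩ := j
  have hij' : i ≤ j := hij
  obtain ⟨d, rfl⟩ := Nat.exists_eq_add_of_le hij'
  simp only [Nat.add_sub_cancel_left]
  clear hij hij'
  induction d with
  | zero => simp
  | succ d ih =>
    have h1 := ih (by omega)
    have h2 : b ⟨i + (d + 1), hj⟩ < b ⟨i + d, by omega⟩ := hb (by simp [Fin.lt_def])
    omega

/-- The partition with a prescribed decreasing sequence of positions. -/
def BoxPartition.ofPos {n k : ℕ} (b : Fin k → ℕ) (hb : StrictAnti b) (hlt : ∀ i, b i < n) :
    BoxPartition n k where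
  parts i := b i - stair k i
  anti i j hij := by
    have h1 := add_sub_le_of_strictAnti hb hij
    have h2 : (i : ℕ) ≤ j := hij
    simp only [stair]; omega
  le i := by
    have hi := i.2
    have h1 := add_sub_le_of_strictAnti hb (i := ⟨0, by omega⟩) (j := i) (Fin.mk_le_of_le_val (by omega))
    have h2 := hlt ⟨0, by omega⟩
    simp only at h1
    simp only [stair]; omega

theorem BoxPartition.pos_ofPos {n k : ℕ} {b : Fin k → ℕ} (hb : StrictAnti b)
    (hlt : ∀ i, b i < n) : (BoxPartition.ofPos b hb hlt).pos = b := by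
  ext i
  have hi := i.2
  have h1 := add_sub_le_of_strictAnti hb (i := i) (j := ⟨k - 1, by omega⟩)
    (Fin.le_def.2 (by simp only; omega))
  simp only [BoxPartition.pos, BoxPartition.ofPos, stair]
  simp only at h1
  omega

theorem BoxPartition.size_add_sum_stair {n k : ℕ} (μ : BoxPartition n k) :
    μ.size + ∑ i, stair k i = ∑ i, μ.pos i := by
  simp only [BoxPartition.size, BoxPartition.pos, Finset.sum_add_distrib]

theorem smul_eq_algebraMap_mul {n k : ℕ} (p : ℤ[X]) (x : QH n k) :
    p • x = algebraMap ℤ[X] (QH n k) p * x := Algebra.smul_def p x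

theorem rowDet_snoc {R : Type*} [CommRing R] {k : ℕ} (W : ℕ → Fin (k + 1) → R) (v : Fin k → ℕ)
    (a : ℕ) : rowDet W (Fin.snoc v a : Fin (k + 1) → ℕ) =
      (-1) ^ k * rowDet W (Fin.cons a v : Fin (k + 1) → ℕ) := by
  have h := Matrix.det_permute (finRotate (k + 1))
    (Matrix.of fun i j => W ((Fin.cons a v : Fin (k + 1) → ℕ) i) j)
  rw [sign_finRotate] at h
  have h2 : (Fin.snoc v a : Fin (k + 1) → ℕ) =
      fun i => (Fin.cons a v : Fin (k + 1) → ℕ) (finRotate _ i) := Fin.snoc_eq_cons_rotate v a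
  rw [rowDet, rowDet, h2]
  refine Eq.trans h ?_
  simp

/-- The class obtained by moving the one-letters of a partition is a Schubert class, up to a power
of `q` that counts how often a letter passes from position `n` to position `1`. -/
theorem exists_rowDet_eq_schubert {n k : ℕ} (hk : k + 1 ≤ n) (μ : BoxPartition n (k + 1))
    {t : Fin (k + 1) → ℕ} (ht : ∀ i, t i < gap n μ.pos i) :
    ∃ (ν : BoxPartition n (k + 1)) (w : ℕ),
      zeroSet ν = hop (zeroSet μ) (hopSet n μ.pos t) ∧
      n * w + ν.size = μ.size + ∑ i, t i ∧
      rowDet (qRow n (k + 1)) (fun i => μ.pos i + t i) = (X ^ w : ℤ[X]) • schubert ν := by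
  have hn : n ≠ 0 := by omega
  have ha := isPos_pos hk μ
  set b : Fin (k + 1) → ℕ := fun i => μ.pos i + t i with hb
  have hsucc : ∀ i : Fin k, b i.succ < μ.pos i.castSucc := fun i => by
    have := ht i.succ
    rw [gap_succ] at this
    simp only [hb]; omega
  have hzero : b 0 < μ.pos (Fin.last k) + n := by
    have := ht 0
    rw [gap_zero] at this
    simp only [hb]; omega
  have hbanti : StrictAnti b := Fin.strictAnti_iff_succ_lt.2 fun i =>
    lt_of_lt_of_le (hsucc i) (Nat.le_add_right _ _)
  have hbs : ∀ i : Fin k, b i.succ < n := fun i => (hsucc i).trans (μ.pos_lt hk _)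
  have hsum : ∑ i, b i = ∑ i, μ.pos i + ∑ i, t i := Finset.sum_add_distrib
  have hμ := μ.size_add_sum_stair
  by_cases h0 : b 0 < n
  · have hlt : ∀ i, b i < n := fun i => by
      induction i using Fin.cases with
      | zero => exact h0
      | succ i => exact hbs i
    set ν := BoxPartition.ofPos b hbanti hlt with hν
    have hpos : ν.pos = b := BoxPartition.pos_ofPos hbanti hlt
    refine ⟨ν, 0, ?_, ?_, ?_⟩
    · ext x
      rw [mem_hop_hopSet hk μ ht, mem_zeroSet_iff hn hk, hpos]
    · have h1 := ν.size_add_sum_stair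
      rw [hpos] at h1
      omega
    · rw [schubert_eq_rowDet, hpos, pow_zero, one_smul]
  · set b' : Fin (k + 1) → ℕ := Fin.snoc (fun i : Fin k => b i.succ) (b 0 - n) with hb'
    have hb'c : ∀ i : Fin k, b' i.castSucc = b i.succ := fun i => by simp [hb']
    have hb'l : b' (Fin.last k) = b 0 - n := by simp [hb']
    have hge : ∀ i, μ.pos (Fin.last k) ≤ b i := fun i =>
      (ha.anti.antitone (Fin.le_last i)).trans (Nat.le_add_right _ _)
    have hanti : StrictAnti b' := by
      intro i j hij
      induction i using Fin.lastCases with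
      | last => exact absurd hij (not_lt.2 (Fin.le_last j))
      | cast i =>
        induction j using Fin.lastCases with
        | last =>
          rw [hb'c, hb'l]
          have := hge i.succ
          omega
        | cast j =>
          rw [hb'c, hb'c]
          exact hbanti (Fin.succ_lt_succ_iff.2 (Fin.castSucc_lt_castSucc_iff.1 hij))
    have hlt : ∀ i, b' i < n := fun i => by
      induction i using Fin.lastCases with
      | last =>
        rw [hb'l]
        have := μ.pos_lt hk (Fin.last k)
        omega
      | cast i => rw [hb'c]; exact hbs i
    set ν := BoxPartition.ofPos b' hanti hlt with hν
    have hpos : ν.pos = b' := BoxPartition.pos_ofPos hanti hlt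
    have hcast : ((b 0 - n : ℕ) : ZMod n) = (b 0 : ZMod n) := by
      rw [Nat.cast_sub (not_lt.1 h0)]; simp
    refine ⟨ν, 1, ?_, ?_, ?_⟩
    · ext x
      rw [mem_hop_hopSet hk μ ht, mem_zeroSet_iff hn hk, hpos,
        Fin.forall_fin_succ (P := fun i => x ≠ -((b i : ℕ) : ZMod n)),
        Fin.forall_fin_succ' (P := fun i => x ≠ -((b' i : ℕ) : ZMod n))]
      simp only [hb'c, hb'l, hcast]
      exact and_comm
    · have h1 := ν.size_add_sum_stair
      have h2 := Fin.sum_univ_castSucc b'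
      simp only [hb'c, hb'l] at h2
      rw [hpos] at h1
      rw [Fin.sum_univ_succ] at hsum
      omega
    · rw [schubert_eq_rowDet, hpos, hb', rowDet_snoc, pow_one]
      have h1 : rowDet (qRow n (k + 1)) b = qConst n (k + 1) *
          rowDet (qRow n (k + 1)) (Fin.cons (b 0 - n) (fun i : Fin k => b i.succ) :
            Fin (k + 1) → ℕ) := by
        refine rowDet_smul_row _ _ 0 ?_ ?_
        · rw [Fin.cons_zero, ← qRow_add_period hk, Nat.sub_add_cancel (not_lt.1 h0)]
        · intro l hl
          obtain ⟨l, rfl⟩ := Fin.exists_succ_eq.2 hl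
          rw [Fin.cons_succ]
      rw [h1, qConst, smul_eq_algebraMap_mul, ← mul_assoc]
      congr 1
      rw [map_mul, map_pow, map_neg, map_one, pow_add, pow_add]
      ring

theorem exists_zeroSet_eq_hop {n k : ℕ} (hk : k + 1 ≤ n) (μ : BoxPartition n (k + 1))
    {S : Finset (ZMod n)} (hS : HopValid (zeroSet μ) S) :
    ∃ (ν : BoxPartition n (k + 1)) (w : ℕ), zeroSet ν = hop (zeroSet μ) S ∧
      n * w + ν.size = μ.size + S.card := by
  obtain ⟨t, ht, rfl⟩ := exists_hopSet_eq hk μ hS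
  obtain ⟨ν, w, h1, h2, -⟩ := exists_rowDet_eq_schubert hk μ ht
  exact ⟨ν, w, h1, by rw [card_hopSet (by omega) (isPos_pos hk μ) ht, h2]⟩

/-- The ways to get from `μ` to `ν` by letting `r` particles hop. -/
def hops (n : ℕ) {k : ℕ} (r : ℕ) (μ ν : BoxPartition n k) : Set (column n r).V :=
  {s | HopValid (zeroSet μ) s.1 ∧ hop (zeroSet μ) s.1 = zeroSet ν}

instance (n r : ℕ) [NeZero n] : Finite (column n r).V :=
  inferInstanceAs (Finite {s : Finset (ZMod n) // s.card = r})

open scoped Classical in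
theorem card_hops {n k : ℕ} (hk : k + 1 ≤ n) (r : ℕ) (μ ν : BoxPartition n (k + 1)) :
    Nat.card (hops n r μ ν) =
      (((Fintype.piFinset fun i => Finset.range (gap n μ.pos i)).filter
        fun t => ∑ i, t i = r).filter
          fun t => hop (zeroSet μ) (hopSet n μ.pos t) = zeroSet ν).card := by
  have hn : n ≠ 0 := by omega
  have ha := isPos_pos hk μ
  set T := ((Fintype.piFinset fun i => Finset.range (gap n μ.pos i)).filter
        fun t => ∑ i, t i = r).filter
          fun t => hop (zeroSet μ) (hopSet n μ.pos t) = zeroSet ν with hT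
  have hmem : ∀ t, t ∈ T ↔ ((∀ i, t i < gap n μ.pos i) ∧ ∑ i, t i = r) ∧
      hop (zeroSet μ) (hopSet n μ.pos t) = zeroSet ν := by
    intro t
    simp only [hT, Finset.mem_filter, Fintype.mem_piFinset, Finset.mem_range]
  rw [← Fintype.card_coe, ← Nat.card_eq_fintype_card]
  refine (Nat.card_congr (Equiv.ofBijective (fun t : T => (⟨⟨hopSet n μ.pos t.1, ?_⟩, ?_⟩ :
    hops n r μ ν)) ⟨?_, ?_⟩)).symm
  · have h := (hmem _).1 t.2
    rw [card_hopSet hn ha h.1.1, h.1.2]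
  · have h := (hmem _).1 t.2
    exact ⟨hopValid_hopSet hk μ h.1.1, h.2⟩
  · rintro ⟨t, ht⟩ ⟨t', ht'⟩ h
    exact Subtype.ext (hopSet_injective hn ha ((hmem _).1 ht).1.1 ((hmem _).1 ht').1.1
      (congrArg (fun p => p.1.1) h))
  · rintro ⟨⟨S, hr⟩, hS1, hS2⟩
    obtain ⟨t, ht, rfl⟩ := exists_hopSet_eq hk μ hS1
    rw [card_hopSet hn ha ht] at hr
    exact ⟨⟨t, (hmem t).2 ⟨⟨ht, hr⟩, hS2⟩⟩, rfl⟩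

/-- The quantum Pieri rule. -/
theorem schubert_mul_hClass_eq_sum_hops {n k : ℕ} (hk0 : k ≠ 0) (hk : k ≤ n)
    (μ : BoxPartition n k) {r : ℕ} (hr : r ≤ n - k) :
    schubert μ * hClass n k r = ∑ ν : BoxPartition n k,
      ((Nat.card (hops n r μ ν) : ℤ[X]) * X ^ ((μ.size + r - ν.size) / n)) • schubert ν := by
  classical
  obtain ⟨k, rfl⟩ := Nat.exists_eq_succ_of_ne_zero hk0
  have hn : n ≠ 0 := by omega
  rw [schubert_mul_hClass hk μ hr]
  have hterm : ∀ t ∈ (Fintype.piFinset fun i => Finset.range (gap n μ.pos i)).filter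
        fun t => ∑ i, t i = r,
      rowDet (qRow n (k + 1)) (fun i => μ.pos i + t i) = ∑ ν : BoxPartition n (k + 1),
        if hop (zeroSet μ) (hopSet n μ.pos t) = zeroSet ν then
          (X ^ ((μ.size + r - ν.size) / n) : ℤ[X]) • schubert ν else 0 := by
    intro t ht
    rw [Finset.mem_filter, Fintype.mem_piFinset] at ht
    obtain ⟨κ, w, h1, h2, h3⟩ := exists_rowDet_eq_schubert hk μ
      (fun i => Finset.mem_range.1 (ht.1 i))
    rw [Finset.sum_eq_single κ]
    · rw [if_pos h1.symm, h3]
      congr 2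
      rw [← ht.2, ← h2, Nat.add_sub_cancel, Nat.mul_div_cancel_left _ (by omega)]
    · intro ν _ hν
      refine if_neg fun h => hν (zeroSet_injective hn hk ?_)
      rw [← h, h1]
    · simp
  rw [Finset.sum_congr rfl hterm, Finset.sum_comm]
  refine Finset.sum_congr rfl fun ν _ => ?_
  rw [← Finset.sum_filter, Finset.sum_const, ← card_hops hk, mul_smul, Nat.cast_smul_eq_nsmul]

/-! ### Walks -/

/-- `b = (S_1, …, S_m)` describes `m` successive hops leading from `Z` to `Z'`. -/
def IsWalk (n : ℕ) : (m : ℕ) → (α : Fin m → ℕ) → Finset (ZMod n) → (columns n m α).V →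
    Finset (ZMod n) → Prop
  | 0, _, Z, _, Z' => Z = Z'
  | m + 1, α, Z, b, Z' =>
      HopValid Z b.1.1 ∧ IsWalk n m (fun i => α i.succ) (hop Z b.1.1) b.2 Z'

/-- The walks from `μ` to `ν` with `α i` hops in the `i`-th step. -/
def walks {n k m : ℕ} (α : Fin m → ℕ) (μ ν : BoxPartition n k) : Set (columns n m α).V :=
  {b | IsWalk n m α (zeroSet μ) b (zeroSet ν)}

instance columns_finite (n : ℕ) [NeZero n] : (m : ℕ) → (α : Fin m → ℕ) →
    Finite (columns n m α).V
  | 0, _ => inferInstanceAs (Finite Unit)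
  | m + 1, α =>
    have := columns_finite n m fun i => α i.succ
    inferInstanceAs (Finite ((column n (α 0)).V × (columns n m fun i => α i.succ).V))

theorem card_walks_zero {n k : ℕ} (hn : n ≠ 0) (hk : k ≤ n) (α : Fin 0 → ℕ)
    (μ ν : BoxPartition n k) [Decidable (μ = ν)] :
    Nat.card (walks α μ ν) = if μ = ν then 1 else 0 := by
  split_ifs with h
  · subst h
    have : walks α μ μ = Set.univ := Set.eq_univ_of_forall fun b => rfl
    rw [this, Nat.card_univ]
    exact Nat.card_unique (α := Unit)
  · have : walks α μ ν = ∅ := Set.eq_empty_of_forall_notMem fun b hb =>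
      h (zeroSet_injective hn hk hb)
    rw [this]; simp

theorem card_walks_succ {n k m : ℕ} (hk0 : k ≠ 0) (hk : k ≤ n) (α : Fin (m + 1) → ℕ)
    (μ ν : BoxPartition n k) :
    Nat.card (walks α μ ν) = ∑ κ : BoxPartition n k,
      Nat.card (hops n (α 0) μ κ) * Nat.card (walks (fun i => α i.succ) κ ν) := by
  have hn : n ≠ 0 := by omega
  have : NeZero n := ⟨hn⟩
  have e : (Σ κ : BoxPartition n k, hops n (α 0) μ κ × walks (fun i => α i.succ) κ ν) ≃
      walks α μ ν := by
    refine Equiv.ofBijective (fun p => ⟨((p.2.1 : (column n (α 0)).V),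
      (p.2.2 : (columns n m fun i => α i.succ).V)), ?_⟩) ⟨?_, ?_⟩
    · obtain ⟨κ, ⟨s, hs1, hs2⟩, ⟨b, hb⟩⟩ := p
      refine ⟨hs1, ?_⟩
      change IsWalk n m _ (hop (zeroSet μ) s.1) b _
      rw [hs2]; exact hb
    · rintro ⟨κ, ⟨s, hs1, hs2⟩, ⟨b, hb⟩⟩ ⟨κ', ⟨s', hs1', hs2'⟩, ⟨b', hb'⟩⟩ h
      have h1 : (s, b) = (s', b') := congrArg Subtype.val h
      obtain ⟨rfl, rfl⟩ := Prod.mk.inj h1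
      have : κ = κ' := zeroSet_injective hn hk (by rw [← hs2, hs2'])
      subst this
      rfl
    · rintro ⟨⟨s, b⟩, hs, hb⟩
      obtain ⟨k, rfl⟩ := Nat.exists_eq_succ_of_ne_zero hk0
      obtain ⟨κ, w, h1, -⟩ := exists_zeroSet_eq_hop hk μ hs
      refine ⟨⟨κ, ⟨s, hs, h1.symm⟩, ⟨b, ?_⟩⟩, rfl⟩
      change IsWalk n m _ (zeroSet κ) b _
      rw [h1]; exact hb
  rw [← Nat.card_congr e, Nat.card_sigma]
  simp only [Nat.card_prod]

theorem size_of_mem_walks {n k m : ℕ} (hk : k ≤ n) (hmk : m = 0 ∨ k ≠ 0) (hn : n ≠ 0)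
    (α : Fin m → ℕ) (μ ν : BoxPartition n k) (b : (columns n m α).V) (hb : b ∈ walks α μ ν) :
    ∃ w : ℕ, n * w + ν.size = μ.size + ∑ i, α i := by
  induction m generalizing μ with
  | zero =>
    obtain rfl : μ = ν := zeroSet_injective hn hk hb
    exact ⟨0, by simp⟩
  | succ m ih =>
    obtain ⟨k, rfl⟩ := Nat.exists_eq_succ_of_ne_zero (hmk.resolve_left (Nat.succ_ne_zero m))
    obtain ⟨hs, hb⟩ := hb
    obtain ⟨κ, w, h1, h2⟩ := exists_zeroSet_eq_hop hk μ hs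
    rw [← h1] at hb
    obtain ⟨w', h3⟩ := ih (Or.inr (Nat.succ_ne_zero k)) (fun i => α i.succ) κ b.2 hb
    refine ⟨w + w', ?_⟩
    rw [Fin.sum_univ_succ, mul_add]
    have h4 : b.1.1.card = α 0 := b.1.2
    omega

/-- The product of a Schubert class with classes `h_r` is a sum over walks. -/
theorem schubert_mul_prod_hClass {n k m : ℕ} (hn : n ≠ 0) (hk : k ≤ n) (hmk : m = 0 ∨ k ≠ 0)
    (α : Fin m → ℕ) (hα : ∀ i, α i ≤ n - k) (μ : BoxPartition n k) :
    schubert μ * ∏ i, hClass n k (α i) = ∑ ν : BoxPartition n k,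
      ((Nat.card (walks α μ ν) : ℤ[X]) * X ^ ((μ.size + ∑ i, α i - ν.size) / n)) •
        schubert ν := by
  classical
  have : NeZero n := ⟨hn⟩
  induction m generalizing μ with
  | zero =>
    rw [Finset.sum_eq_single μ]
    · simp [card_walks_zero hn hk]
    · intro ν _ hν
      rw [card_walks_zero hn hk, if_neg hν.symm]; simp
    · simp
  | succ m ih =>
    have hk0 : k ≠ 0 := hmk.resolve_left (Nat.succ_ne_zero m)
    rw [Fin.prod_univ_succ, ← mul_assoc, schubert_mul_hClass_eq_sum_hops hk0 hk μ (hα 0),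
      Finset.sum_mul]
    simp only [smul_mul_assoc, ih (Or.inr hk0) (fun i => α i.succ) (fun i => hα i.succ),
      Finset.smul_sum, smul_smul]
    rw [Finset.sum_comm]
    refine Finset.sum_congr rfl fun ν _ => ?_
    rw [← Finset.sum_smul, card_walks_succ hk0 hk, Nat.cast_sum, Finset.sum_mul]
    congr 1
    refine Finset.sum_congr rfl fun κ _ => ?_
    by_cases h1 : Nat.card (hops n (α 0) μ κ) = 0
    · rw [h1]; simp
    by_cases h2 : Nat.card (walks (fun i => α i.succ) κ ν) = 0
    · rw [h2]; simp
    -- if both sets are inhabited, the divisions defining the exponents are exact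
    obtain ⟨⟨s, hs1, hs2⟩⟩ := (Nat.card_ne_zero.1 h1).1
    obtain ⟨⟨b, hb⟩⟩ := (Nat.card_ne_zero.1 h2).1
    obtain ⟨w2, hw2⟩ := size_of_mem_walks hk (Or.inr hk0) hn _ κ ν b hb
    obtain ⟨w1, hw1⟩ : ∃ w1, n * w1 + κ.size = μ.size + α 0 := by
      obtain ⟨k, rfl⟩ := Nat.exists_eq_succ_of_ne_zero hk0
      obtain ⟨κ', w1, h3, h4⟩ := exists_zeroSet_eq_hop hk μ hs1
      obtain rfl : κ' = κ := zeroSet_injective hn hk (by rw [h3, hs2])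
      exact ⟨w1, by rw [h4, s.2]⟩
    have hw : μ.size + ∑ i, α i = n * (w1 + w2) + ν.size := by
      rw [Fin.sum_univ_succ, mul_add]; omega
    rw [hw, ← hw1, ← hw2]
    simp only [Nat.add_sub_cancel, Nat.mul_div_cancel_left _ (Nat.pos_of_ne_zero hn)]
    push_cast
    ring

/-! ### Quantum Kostka numbers count walks -/

/-- The number of walks as a multiple of the power of `q` prescribed by the degrees. -/
def walkCoeff {n k m : ℕ} (α : Fin m → ℕ) (μ ν : BoxPartition n k) : ℤ[X] :=
  (Nat.card (walks α μ ν) : ℤ[X]) * X ^ ((μ.size + ∑ i, α i - ν.size) / n)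

theorem coeff_walkCoeff {n k m : ℕ} (hn : n ≠ 0) (hk : k ≤ n) (hmk : m = 0 ∨ k ≠ 0)
    (α : Fin m → ℕ) (μ ν : BoxPartition n k) (d : ℕ) :
    (walkCoeff α μ ν).coeff d =
      if n * d + ν.size = μ.size + ∑ i, α i then (Nat.card (walks α μ ν) : ℤ) else 0 := by
  have : NeZero n := ⟨hn⟩
  rw [walkCoeff, ← C_eq_natCast, coeff_C_mul, coeff_X_pow]
  by_cases h : Nat.card (walks α μ ν) = 0
  · simp [h]
  obtain ⟨⟨b, hb⟩⟩ := (Nat.card_ne_zero.1 h).1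
  obtain ⟨w, hw⟩ := size_of_mem_walks hk hmk hn α μ ν b hb
  rw [← hw, Nat.add_sub_cancel, Nat.mul_div_cancel_left _ (Nat.pos_of_ne_zero hn)]
  have : n * d + ν.size = n * w + ν.size ↔ d = w := by
    rw [Nat.add_right_cancel_iff, Nat.mul_right_inj hn]
  simp only [this]
  split_ifs <;> simp

theorem eq_of_sum_smul_schubert_eq {n k : ℕ} (hn : n ≠ 0) (hk : k ≤ n)
    {c c' : BoxPartition n k → ℤ[X]} (h : ∑ ν, c ν • schubert ν = ∑ ν, c' ν • schubert ν) :
    c = c' := by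
  ext1 ν
  refine sub_eq_zero.1 (schubert_independent hn hk (fun ν => c ν - c' ν) ?_ ν)
  simp only [sub_smul, Finset.sum_sub_distrib, h, sub_self]

theorem isExpansion_walkCoeff {n k : ℕ} (hn : n ≠ 0) (hk : k ≤ n) (lam μ : BoxPartition n k) :
    IsExpansion lam μ (walkCoeff lam.parts μ) :=
  schubert_mul_prod_hClass hn hk (Nat.eq_zero_or_pos k |>.imp_right Nat.pos_iff_ne_zero.1)
    lam.parts lam.le μ

theorem existsUnique_isExpansion {n k : ℕ} (hn : n ≠ 0) (hk : k ≤ n) (lam μ : BoxPartition n k) :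
    ∃! c : BoxPartition n k → ℤ[X], IsExpansion lam μ c := by
  refine ⟨_, isExpansion_walkCoeff hn hk lam μ, fun c hc => ?_⟩
  refine eq_of_sum_smul_schubert_eq hn hk ?_
  rw [← hc, isExpansion_walkCoeff hn hk lam μ]

theorem expansion_eq {n k : ℕ} (hn : n ≠ 0) (hk : k ≤ n) (lam μ : BoxPartition n k) :
    expansion lam μ = walkCoeff lam.parts μ :=
  (existsUnique_isExpansion hn hk lam μ).unique
    (Classical.epsilon_spec (p := IsExpansion lam μ) ⟨_, isExpansion_walkCoeff hn hk lam μ⟩)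
    (isExpansion_walkCoeff hn hk lam μ)

theorem coeff_expansion {n k : ℕ} (hn : n ≠ 0) (hk : k ≤ n) (lam μ ν : BoxPartition n k) (d : ℕ) :
    (expansion lam μ ν).coeff d = if n * d + ν.size = lam.size + μ.size then
      (Nat.card (walks lam.parts μ ν) : ℤ) else 0 := by
  rw [expansion_eq hn hk, coeff_walkCoeff hn hk
    (Nat.eq_zero_or_pos k |>.imp_right Nat.pos_iff_ne_zero.1), add_comm lam.size]
  rfl

theorem quantumKostka_eq {n k : ℕ} (hn : n ≠ 0) (hk : k ≤ n) (lam μ ν : BoxPartition n k) :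
    quantumKostka lam μ ν = Nat.card (walks lam.parts μ ν) := by
  have : NeZero n := ⟨hn⟩
  rw [quantumKostka]
  split_ifs with h
  · obtain ⟨d, hd⟩ := h
    rw [← hd, Nat.add_sub_cancel, Nat.mul_div_cancel_left _ (Nat.pos_of_ne_zero hn),
      coeff_expansion hn hk, if_pos hd]
  · rw [eq_comm, Nat.cast_eq_zero]
    by_contra h0
    obtain ⟨⟨b, hb⟩⟩ := (Nat.card_ne_zero.1 h0).1
    obtain ⟨w, hw⟩ := size_of_mem_walks hk
      (Nat.eq_zero_or_pos k |>.imp_right Nat.pos_iff_ne_zero.1) hn _ μ ν b hb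
    exact h ⟨w, by rw [hw, add_comm]; rfl⟩

/-- The number of walks does not depend on the order of the steps, since multiplication in quantum
cohomology is commutative. -/
theorem card_walks_comp_perm {n k m : ℕ} (hn : n ≠ 0) (hk : k ≤ n) (hmk : m = 0 ∨ k ≠ 0)
    (α : Fin m → ℕ) (hα : ∀ i, α i ≤ n - k) (τ : Equiv.Perm (Fin m)) (μ ν : BoxPartition n k) :
    Nat.card (walks (α ∘ τ) μ ν) = Nat.card (walks α μ ν) := by
  have h1 := schubert_mul_prod_hClass hn hk hmk α hα μ
  have h2 := schubert_mul_prod_hClass hn hk hmk (α ∘ τ) (fun i => hα _) μ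
  have hsum : ∑ i, (α ∘ τ) i = ∑ i, α i := Equiv.sum_comp τ α
  have hprod : ∏ i, hClass n k ((α ∘ τ) i : ℕ) = ∏ i, hClass n k (α i) :=
    Equiv.prod_comp τ fun i => hClass n k (α i)
  rw [hprod, h1, hsum] at h2
  have h3 := congrFun (eq_of_sum_smul_schubert_eq hn hk h2) ν
  have h4 := mul_right_cancel₀ (pow_ne_zero _ X_ne_zero) h3
  exact_mod_cast h4.symm

/-! ### Counting rearrangements -/

/-- The number of distinct rearrangements of a finite sequence. -/
theorem card_rearrangements {ι κ : Type*} [Fintype ι] [DecidableEq ι] [Fintype κ]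
    [DecidableEq κ] (f : ι → κ) :
    (Finset.univ.image fun τ : Equiv.Perm ι => f ∘ τ).card *
      ∏ c, (Fintype.card {i // f i = c}).factorial = (Fintype.card ι).factorial := by
  rw [← Fintype.card_perm, ← DomMulAct.stabilizer_card f, ← Finset.card_univ (α := Equiv.Perm ι),
    Finset.card_eq_sum_card_image (fun τ : Equiv.Perm ι => f ∘ τ), eq_comm]
  refine Finset.sum_const_nat fun g hg => ?_
  obtain ⟨τ, -, rfl⟩ := Finset.mem_image.1 hg
  rw [← Fintype.card_coe]
  refine Fintype.card_congr (((Equiv.mulRight τ).subtypeEquiv fun ρ => ?_).symm)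
  simp only [Finset.mem_filter, Finset.mem_univ, true_and, Equiv.coe_mulRight,
    Equiv.Perm.coe_mul, ← Function.comp_assoc]
  exact ⟨fun h => by rw [h], fun h => τ.surjective.injective_comp_right h⟩

/-- The parts of a partition in a box, as elements of `{0, …, n - k}`. -/
def BoxPartition.finParts {n k : ℕ} (p : BoxPartition n k) (i : Fin k) : Fin (n - k + 1) :=
  ⟨p.parts i, Nat.lt_succ_of_le (p.le i)⟩

theorem exists_sorted {n k : ℕ} (α : Fin k → Fin (n - k + 1)) :
    ∃ (lam : BoxPartition n k) (τ : Equiv.Perm (Fin k)), α = lam.finParts ∘ τ := by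
  set σ := Tuple.sort (OrderDual.toDual ∘ α) with hσ
  have hm := Tuple.monotone_sort (OrderDual.toDual ∘ α)
  refine ⟨⟨fun i => α (σ i), fun i j hij => hm hij, fun i => Nat.le_of_lt_succ (α _).2⟩, σ⁻¹, ?_⟩
  ext i
  simp [BoxPartition.finParts]

theorem sorted_unique {n k : ℕ} (lam lam' : BoxPartition n k) (τ τ' : Equiv.Perm (Fin k))
    (h : lam.finParts ∘ τ = lam'.finParts ∘ τ') : lam = lam' := by
  have h1 : Monotone ((OrderDual.toDual ∘ lam.finParts) ∘ (1 : Equiv.Perm (Fin k))) :=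
    fun i j hij => lam.anti hij
  have h2 : (OrderDual.toDual ∘ lam.finParts) ∘ (τ * τ'⁻¹ : Equiv.Perm (Fin k)) =
      OrderDual.toDual ∘ lam'.finParts := by
    ext1 i
    have := congrFun h (τ'⁻¹ i)
    simp only [Function.comp_apply, Equiv.Perm.mul_apply] at this ⊢
    rw [this]
    simp
  have h3 : Monotone ((OrderDual.toDual ∘ lam.finParts) ∘ (τ * τ'⁻¹ : Equiv.Perm (Fin k))) := by
    rw [h2]
    exact fun i j hij => lam'.anti hij
  have h4 := Tuple.unique_monotone h1 h3
  rw [h2] at h4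
  ext i
  exact congrArg (fun x => (OrderDual.ofDual x : Fin (n - k + 1)).val) (congrFun h4 i)

theorem card_finParts_rearrangements {n k : ℕ} (lam : BoxPartition n k) :
    ((Finset.univ.image fun τ : Equiv.Perm (Fin k) => lam.finParts ∘ τ).card : ℚ) =
      (lam.length.factorial : ℚ) / (∏ m ∈ Finset.Icc 1 (n - k), (lam.mult m).factorial : ℚ) *
        (k.choose lam.length : ℚ) := by
  have h := card_rearrangements lam.finParts
  rw [Fintype.card_fin, Fin.prod_univ_succ] at h
  have hm : ∀ c : Fin (n - k + 1), Fintype.card {i // lam.finParts i = c} = lam.mult c := by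
    intro c
    rw [Fintype.card_subtype, BoxPartition.mult]
    simp only [BoxPartition.finParts, Fin.ext_iff]
  simp only [hm] at h
  have hprod : ∏ i : Fin (n - k), (lam.mult i.succ).factorial =
      ∏ m ∈ Finset.Icc 1 (n - k), (lam.mult m).factorial := by
    rw [← Finset.Ico_add_one_right_eq_Icc, Finset.prod_Ico_eq_prod_range, Finset.prod_range]
    simp only [Fin.val_succ, add_comm]
    rfl
  have hadd : lam.mult 0 + lam.length = k := by
    have := Finset.card_filter_add_card_filter_not (s := Finset.univ) fun i => lam.parts i = 0
    simpa [BoxPartition.mult, BoxPartition.length] using this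
  rw [hprod, Fin.val_zero] at h
  have hle : lam.length ≤ k := by omega
  rw [Nat.cast_choose ℚ hle, show k - lam.length = lam.mult 0 by omega, ← h]
  have h1 : (lam.length.factorial : ℚ) ≠ 0 := by exact_mod_cast Nat.factorial_ne_zero _
  have h2 : ((lam.mult 0).factorial : ℚ) ≠ 0 := by exact_mod_cast Nat.factorial_ne_zero _
  have h3 : (∏ m ∈ Finset.Icc 1 (n - k), (lam.mult m).factorial : ℚ) ≠ 0 :=
    Finset.prod_ne_zero_iff.2 fun m _ => by exact_mod_cast Nat.factorial_ne_zero _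
  push_cast
  field_simp

theorem sum_card_walks {n k : ℕ} (hn : n ≠ 0) (hk : k ≤ n) (μ ν : BoxPartition n k) :
    ((∑ α : Fin k → Fin (n - k + 1), Nat.card (walks (fun i => (α i : ℕ)) μ ν) : ℕ) : ℚ) =
      ∑ lam : BoxPartition n k, (quantumKostka lam μ ν : ℚ) *
        ((lam.length.factorial : ℚ) / ∏ m ∈ Finset.Icc 1 (n - k), ((lam.mult m).factorial : ℚ)) *
        (k.choose lam.length : ℚ) := by
  classical
  choose s τ hs using exists_sorted (n := n) (k := k)
  have hmap : ∀ α ∈ (Finset.univ : Finset (Fin k → Fin (n - k + 1))), s α ∈ Finset.univ :=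
    fun _ _ => Finset.mem_univ _
  rw [← Finset.sum_fiberwise_of_maps_to hmap, Nat.cast_sum]
  refine Finset.sum_congr rfl fun lam _ => ?_
  have hfib : (Finset.univ.filter fun α => s α = lam) =
      Finset.univ.image fun τ : Equiv.Perm (Fin k) => lam.finParts ∘ τ := by
    ext α
    simp only [Finset.mem_filter, Finset.mem_univ, true_and, Finset.mem_image]
    constructor
    · rintro rfl; exact ⟨_, (hs α).symm⟩
    · rintro ⟨ρ, rfl⟩; exact (sorted_unique _ _ _ _ (hs _)).symm
  have hconst : ∀ α ∈ (Finset.univ.filter fun α => s α = lam),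
      Nat.card (walks (fun i => (α i : ℕ)) μ ν) = Nat.card (walks lam.parts μ ν) := by
    intro α hα
    rw [hfib] at hα
    obtain ⟨ρ, -, rfl⟩ := Finset.mem_image.1 hα
    exact card_walks_comp_perm hn hk (Nat.eq_zero_or_pos k |>.imp_right Nat.pos_iff_ne_zero.1)
      lam.parts lam.le ρ μ ν
  rw [Finset.sum_congr rfl hconst, Finset.sum_const, hfib, smul_eq_mul, Nat.cast_mul,
    card_finParts_rearrangements, quantumKostka_eq hn hk]
  push_cast
  ring

/-! ### Dimer configurations and walks -/

/-- The sequence of the one-letter positions of all tensor factors. -/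
def letters (n : ℕ) : (m : ℕ) → (α : Fin m → ℕ) → (columns n m α).V → Fin m → Finset (ZMod n)
  | 0, _, _ => Fin.elim0
  | m + 1, α, b => Fin.cons b.1.1 (letters n m (fun i => α i.succ) b.2)

/-- `S` describes successive hops leading from `Z` to `Z'`. -/
def IsHopSeq {n m : ℕ} (Z Z' : Finset (ZMod n)) (S : Fin m → Finset (ZMod n)) : Prop :=
  ∃ Y : Fin (m + 1) → Finset (ZMod n), Y 0 = Z ∧ Y (Fin.last m) = Z' ∧
    ∀ i, HopValid (Y i.castSucc) (S i) ∧ Y i.succ = hop (Y i.castSucc) (S i)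

theorem isWalk_iff {n m : ℕ} (α : Fin m → ℕ) (Z Z' : Finset (ZMod n)) (b : (columns n m α).V) :
    IsWalk n m α Z b Z' ↔ IsHopSeq Z Z' (letters n m α b) := by
  induction m generalizing Z with
  | zero =>
    constructor
    · intro h
      exact ⟨fun _ => Z, rfl, h, fun i => i.elim0⟩
    · rintro ⟨Y, h1, h2, -⟩
      exact h1.symm.trans h2
  | succ m ih =>
    constructor
    · rintro ⟨hv, hw⟩
      obtain ⟨Y, h1, h2, h3⟩ := (ih _ _ b.2).1 hw
      refine ⟨Fin.cons Z Y, rfl, h2, fun i => ?_⟩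
      induction i using Fin.cases with
      | zero => exact ⟨hv, h1⟩
      | succ i => exact h3 i
    · rintro ⟨Y, h1, h2, h3⟩
      have h0 := h3 0
      subst h1
      refine ⟨h0.1, (ih _ _ b.2).2 ⟨fun i => Y i.succ, ?_, h2, fun i => h3 i.succ⟩⟩
      exact h0.2

theorem letters_injective (n m : ℕ) (α : Fin m → ℕ) : Function.Injective (letters n m α) := by
  induction m with
  | zero => exact fun _ _ _ => Subsingleton.elim (α := Unit) _ _
  | succ m ih =>
    intro b b' h
    have h1 := congrFun h 0
    have h2 : letters n m (fun i => α i.succ) b.2 = letters n m (fun i => α i.succ) b'.2 :=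
      funext fun i => congrFun h i.succ
    exact Prod.ext (Subtype.ext h1) (ih _ h2)

theorem exists_letters_eq {n m : ℕ} (α : Fin m → ℕ) (S : Fin m → Finset (ZMod n))
    (hS : ∀ i, (S i).card = α i) : ∃ b, letters n m α b = S := by
  induction m with
  | zero => exact ⟨(), funext fun i => i.elim0⟩
  | succ m ih =>
    obtain ⟨b, hb⟩ := ih (fun i => α i.succ) (fun i => S i.succ) fun i => hS i.succ
    refine ⟨((⟨S 0, hS 0⟩ : (column n (α 0)).V), b), funext fun i => ?_⟩
    induction i using Fin.cases with
    | zero => rfl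
    | succ i => exact congrFun hb i

theorem card_letters {n m : ℕ} (α : Fin m → ℕ) (b : (columns n m α).V) (i : Fin m) :
    (letters n m α b i).card = α i := by
  induction m with
  | zero => exact i.elim0
  | succ m ih =>
    induction i using Fin.cases with
    | zero => exact b.1.2
    | succ i => exact ih (fun i => α i.succ) b.2 i

theorem card_walks_eq {n k m : ℕ} (α : Fin m → ℕ) (μ ν : BoxPartition n k) :
    Nat.card (walks α μ ν) = Nat.card {S : Fin m → Finset (ZMod n) //
      (∀ i, (S i).card = α i) ∧ IsHopSeq (zeroSet μ) (zeroSet ν) S} := by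
  refine Nat.card_congr (Equiv.ofBijective (fun b => ⟨letters n m α b.1, card_letters α b.1,
    (isWalk_iff α _ _ b.1).1 b.2⟩) ⟨?_, ?_⟩)
  · intro b b' h
    exact Subtype.ext (letters_injective n m α (congrArg Subtype.val h))
  · rintro ⟨S, h1, h2⟩
    obtain ⟨b, rfl⟩ := exists_letters_eq α S h1
    exact ⟨⟨b, (isWalk_iff α _ _ b).2 h2⟩, rfl⟩

/-- Exactly one of three propositions holds. -/
def OneOfThree (p q r : Prop) : Prop := (p ∧ ¬q ∧ ¬r) ∨ (¬p ∧ q ∧ ¬r) ∨ (¬p ∧ ¬q ∧ r)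

theorem existsUnique_mem_iff {E : Type*} {M : Set E} {P : E → Prop} {a b c : E} (hab : a ≠ b)
    (hac : a ≠ c) (hbc : b ≠ c) (hP : ∀ e, P e ↔ e = a ∨ e = b ∨ e = c) :
    (∃! e, e ∈ M ∧ P e) ↔ OneOfThree (a ∈ M) (b ∈ M) (c ∈ M) := by
  have ha := (hP a).2 (Or.inl rfl)
  have hb := (hP b).2 (Or.inr (Or.inl rfl))
  have hc := (hP c).2 (Or.inr (Or.inr rfl))
  constructor
  · rintro ⟨e, ⟨he1, he2⟩, huniq⟩
    have h1 : a ∈ M → a = e := fun h => huniq a ⟨h, ha⟩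
    have h2 : b ∈ M → b = e := fun h => huniq b ⟨h, hb⟩
    have h3 : c ∈ M → c = e := fun h => huniq c ⟨h, hc⟩
    rcases (hP e).1 he2 with rfl | rfl | rfl
    · exact Or.inl ⟨he1, fun h => hab (h2 h).symm, fun h => hac (h3 h).symm⟩
    · exact Or.inr (Or.inl ⟨fun h => hab (h1 h), he1, fun h => hbc (h3 h).symm⟩)
    · exact Or.inr (Or.inr ⟨fun h => hac (h1 h), fun h => hbc (h2 h), he1⟩)
  · rintro (⟨h1, h2, h3⟩ | ⟨h1, h2, h3⟩ | ⟨h1, h2, h3⟩)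
    · refine ⟨a, ⟨h1, ha⟩, fun e he => ?_⟩
      rcases (hP e).1 he.2 with rfl | rfl | rfl
      · rfl
      · exact absurd he.1 h2
      · exact absurd he.1 h3
    · refine ⟨b, ⟨h2, hb⟩, fun e he => ?_⟩
      rcases (hP e).1 he.2 with rfl | rfl | rfl
      · exact absurd he.1 h1
      · rfl
      · exact absurd he.1 h3
    · refine ⟨c, ⟨h3, hc⟩, fun e he => ?_⟩
      rcases (hP e).1 he.2 with rfl | rfl | rfl
      · exact absurd he.1 h1
      · exact absurd he.1 h2
      · rfl

theorem lower_mem_ends {n k : ℕ} (i : Fin k) (j : ZMod n) (e : Edge n k) :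
    Vertex.lower i j ∈ e.ends ↔
      e = .vertical i.castSucc j ∨ e = .horizontal i j ∨ e = .slanted i j := by
  cases e with
  | vertical l j' =>
    simp only [Edge.ends, Set.mem_ofPred_eq, Vertex.lower.injEq, reduceCtorEq, and_false, or_false,
      Edge.vertical.injEq]
    constructor
    · rintro ⟨i', rfl, rfl, rfl⟩; exact ⟨rfl, rfl⟩
    · rintro ⟨rfl, rfl⟩; exact ⟨i, rfl, rfl, rfl⟩
  | horizontal i' j' => simp [Edge.ends, eq_comm]
  | slanted i' j' => simp [Edge.ends, eq_comm]

theorem upper_mem_ends {n k : ℕ} (i : Fin k) (j : ZMod n) (e : Edge n k) :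
    Vertex.upper i j ∈ e.ends ↔
      e = .vertical i.succ j ∨ e = .slanted i j ∨ e = .horizontal i (j + 1) := by
  cases e with
  | vertical l j' =>
    simp only [Edge.ends, Set.mem_ofPred_eq, Vertex.upper.injEq, reduceCtorEq, and_false, false_or,
      or_false, Edge.vertical.injEq]
    constructor
    · rintro ⟨i', rfl, rfl, rfl⟩; exact ⟨rfl, rfl⟩
    · rintro ⟨rfl, rfl⟩; exact ⟨i, rfl, rfl, rfl⟩
  | horizontal i' j' =>
    simp only [Edge.ends, Set.mem_insert_iff, Set.mem_singleton_iff, reduceCtorEq, false_or,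
      Vertex.upper.injEq, Edge.horizontal.injEq, eq_sub_iff_add_eq, eq_comm (a := i),
      eq_comm (a := j + 1)]
  | slanted i' j' => simp [Edge.ends, eq_comm]

theorem isDimerConfig_iff {n k : ℕ} (M : Set (Edge n k)) :
    IsDimerConfig M ↔ ∀ (i : Fin k) (j : ZMod n),
      OneOfThree (.vertical i.castSucc j ∈ M) (.horizontal i j ∈ M) (.slanted i j ∈ M) ∧
      OneOfThree (.vertical i.succ j ∈ M) (.slanted i j ∈ M) (.horizontal i (j + 1) ∈ M) := by
  have h1 : ∀ (i : Fin k) (j : ZMod n), (∃! e : Edge n k, e ∈ M ∧ Vertex.lower i j ∈ e.ends) ↔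
      OneOfThree (.vertical i.castSucc j ∈ M) (.horizontal i j ∈ M) (.slanted i j ∈ M) :=
    fun i j => existsUnique_mem_iff (by simp) (by simp) (by simp) (lower_mem_ends i j)
  have h2 : ∀ (i : Fin k) (j : ZMod n), (∃! e : Edge n k, e ∈ M ∧ Vertex.upper i j ∈ e.ends) ↔
      OneOfThree (.vertical i.succ j ∈ M) (.slanted i j ∈ M) (.horizontal i (j + 1) ∈ M) :=
    fun i j => existsUnique_mem_iff (by simp) (by simp) (by simp) (upper_mem_ends i j)
  constructor
  · intro h i j
    exact ⟨(h1 i j).1 (h _), (h2 i j).1 (h _)⟩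
  · rintro h (⟨i, j⟩ | ⟨i, j⟩)
    · exact (h1 i j).2 (h i j).1
    · exact (h2 i j).2 (h i j).2

open scoped Classical in
/-- The reflected positions of the horizontal dimers in a row. -/
def horizontals {n k : ℕ} [NeZero n] (M : Set (Edge n k)) (i : Fin k) : Finset (ZMod n) :=
  Finset.univ.filter fun x => Edge.horizontal i (1 - x) ∈ M

open scoped Classical in
/-- The reflected positions of the empty vertical edges at a given height. -/
def empties {n k : ℕ} [NeZero n] (M : Set (Edge n k)) (l : Fin (k + 1)) : Finset (ZMod n) :=
  Finset.univ.filter fun x => Edge.vertical l (1 - x) ∉ M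

theorem mem_horizontals {n k : ℕ} [NeZero n] (M : Set (Edge n k)) (i : Fin k) (x : ZMod n) :
    x ∈ horizontals M i ↔ Edge.horizontal i (1 - x) ∈ M := by simp [horizontals]

theorem mem_empties {n k : ℕ} [NeZero n] (M : Set (Edge n k)) (l : Fin (k + 1)) (x : ZMod n) :
    x ∈ empties M l ↔ Edge.vertical l (1 - x) ∉ M := by simp [empties]

theorem ncard_horizontal {n k : ℕ} [NeZero n] (M : Set (Edge n k)) (i : Fin k) :
    {j : ZMod n | Edge.horizontal i j ∈ M}.ncard = (horizontals M i).card := by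
  rw [← Set.ncard_coe_finset]
  refine Set.ncard_congr (fun j _ => 1 - j) ?_ ?_ ?_
  · intro j hj
    rw [Finset.mem_coe, mem_horizontals, sub_sub_cancel]; exact hj
  · intro a b _ _ h; exact sub_right_injective h
  · intro x hx
    exact ⟨1 - x, (mem_horizontals M i x).1 hx, sub_sub_cancel 1 x⟩

/-- In a dimer configuration, the empty vertical edges below a row hop along the horizontal dimers
to become the empty vertical edges above it. -/
theorem isDimerConfig_iff_hop {n k : ℕ} [NeZero n] (M : Set (Edge n k)) :
    IsDimerConfig M ↔
      (∀ i x, Edge.slanted i (1 - x) ∈ M ↔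
        x ∈ empties M i.castSucc ∧ x ∉ horizontals M i) ∧
      ∀ i : Fin k, HopValid (empties M i.castSucc) (horizontals M i) ∧
        empties M i.succ = hop (empties M i.castSucc) (horizontals M i) := by
  have hmemhop : ∀ (i : Fin k) (x : ZMod n),
      x ∈ hop (empties M i.castSucc) (horizontals M i) ↔
      (x ∈ empties M i.castSucc ∧ x ∉ horizontals M i) ∨ Edge.horizontal i (1 - x + 1) ∈ M := by
    intro i x
    rw [hop, Finset.mem_union, Finset.mem_sdiff, Finset.mem_image]
    refine or_congr_right ?_
    rw [show 1 - x + 1 = 1 - (x - 1) by ring, ← mem_horizontals]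
    constructor
    · rintro ⟨y, hy, rfl⟩; simpa using hy
    · intro h; exact ⟨x - 1, h, by ring⟩
  rw [isDimerConfig_iff]
  constructor
  · intro h
    have hs : ∀ i x, Edge.slanted i (1 - x) ∈ M ↔
        x ∈ empties M i.castSucc ∧ x ∉ horizontals M i := by
      intro i x
      have h1 := (h i (1 - x)).1
      rw [mem_empties, mem_horizontals]
      unfold OneOfThree at h1
      tauto
    refine ⟨hs, fun i => ⟨⟨fun x hx => ?_, fun x hx hx1 => ?_⟩, Finset.ext fun x => ?_⟩⟩
    · have h1 := (h i (1 - x)).1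
      rw [mem_horizontals] at hx
      rw [mem_empties]
      unfold OneOfThree at h1
      tauto
    · by_contra hx2
      have h1 := (hs i (x + 1)).2 ⟨hx1, hx2⟩
      have h2 := (h i (1 - (x + 1))).2
      rw [mem_horizontals] at hx
      rw [show 1 - (x + 1) + 1 = 1 - x by ring] at h2
      unfold OneOfThree at h2
      tauto
    · rw [hmemhop, ← hs, mem_empties]
      have h2 := (h i (1 - x)).2
      unfold OneOfThree at h2
      tauto
  · rintro ⟨hs, h⟩ i j
    obtain ⟨x, rfl⟩ : ∃ x, j = 1 - x := ⟨1 - j, by ring⟩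
    obtain ⟨⟨h1, h2⟩, h3⟩ := h i
    have h1x := @h1 x
    have h2x := h2 (x - 1)
    have h3x : x ∈ empties M i.succ ↔ _ := (Finset.ext_iff.1 h3 x).trans (hmemhop i x)
    have hsx := hs i x
    rw [sub_add_cancel] at h2x
    have h4 : x - 1 ∈ horizontals M i ↔ Edge.horizontal i (1 - x + 1) ∈ M := by
      rw [mem_horizontals, show 1 - (x - 1) = 1 - x + 1 by ring]
    rw [mem_empties] at h3x
    rw [h4] at h2x
    have h5 := mem_empties M i.castSucc x
    have h6 := mem_horizontals M i x
    unfold OneOfThree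
    constructor
    · rw [h5, h6] at h1x hsx
      clear h1 h2 h3 h h2x h3x hs hmemhop h4 h5 h6
      tauto
    · rw [h5, h6] at h2x h3x hsx
      clear h1 h2 h3 h h1x hs hmemhop h4 h5 h6
      tauto

theorem mem_dimers_iff {n k : ℕ} [NeZero n] (hk : k ≤ n) (μ ν : BoxPartition n k)
    (M : Set (Edge n k)) : M ∈ dimers μ ν ↔ IsDimerConfig M ∧ empties M 0 = zeroSet μ ∧
      empties M (Fin.last k) = zeroSet ν := by
  have key : ∀ (l : Fin (k + 1)) (μ : BoxPartition n k),
      (∀ j, Edge.vertical l j ∈ M ↔ j ∈ bstring n μ.parts) ↔ empties M l = zeroSet μ := by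
    intro l μ
    rw [Finset.ext_iff]
    simp only [mem_empties, mem_zeroSet_iff_bstring (NeZero.ne n) hk, not_iff_not]
    constructor
    · intro h x; exact h _
    · intro h j
      have := h (1 - j)
      rwa [sub_sub_cancel] at this
  rw [dimers, Set.mem_ofPred_eq, key, key]

/-- Dimer configurations with given boundary are determined by their horizontal dimers, which
form an arbitrary sequence of hops. -/
theorem card_dimersWith {n k : ℕ} [NeZero n] (hk : k ≤ n) (α : Fin k → ℕ)
    (μ ν : BoxPartition n k) : (dimersWith α μ ν).ncard = Nat.card (walks α μ ν) := by
  rw [card_walks_eq, ← Nat.card_coe_set_eq]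
  refine Nat.card_congr (Equiv.ofBijective (fun M => ⟨horizontals M.1, ?_, ?_⟩) ⟨?_, ?_⟩)
  · intro i
    rw [← ncard_horizontal]; exact M.2.2 i
  · obtain ⟨h1, h2, h3⟩ := (mem_dimers_iff hk μ ν M.1).1 M.2.1
    exact ⟨empties M.1, h2, h3, ((isDimerConfig_iff_hop M.1).1 h1).2⟩
  · rintro ⟨M, hM, hMα⟩ ⟨M', hM', hMα'⟩ h
    have hH : horizontals M = horizontals M' := congrArg Subtype.val h
    obtain ⟨h1, h2, -⟩ := (mem_dimers_iff hk μ ν M).1 hM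
    obtain ⟨h1', h2', -⟩ := (mem_dimers_iff hk μ ν M').1 hM'
    obtain ⟨hs, hh⟩ := (isDimerConfig_iff_hop M).1 h1
    obtain ⟨hs', hh'⟩ := (isDimerConfig_iff_hop M').1 h1'
    have hE : ∀ l, empties M l = empties M' l := by
      intro l
      induction l using Fin.induction with
      | zero => rw [h2, h2']
      | succ i ih => rw [(hh i).2, (hh' i).2, ih, hH]
    refine Subtype.ext (Set.ext fun e => ?_)
    cases e with
    | vertical l j =>
      have h3 := mem_empties M l (1 - j)
      have h4 := mem_empties M' l (1 - j)
      rw [sub_sub_cancel] at h3 h4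
      rw [hE, h4] at h3
      exact (not_iff_not.1 h3).symm
    | horizontal i j =>
      have h3 := mem_horizontals M i (1 - j)
      have h4 := mem_horizontals M' i (1 - j)
      rw [sub_sub_cancel] at h3 h4
      rw [← h3, ← h4, hH]
    | slanted i j =>
      have h3 := hs i (1 - j)
      have h4 := hs' i (1 - j)
      rw [sub_sub_cancel] at h3 h4
      rw [h3, h4, hE, hH]
  · rintro ⟨S, hα, Y, h1, h2, h3⟩
    set M : Set (Edge n k) := {e | match e with
      | .vertical l j => 1 - j ∉ Y l
      | .horizontal i j => 1 - j ∈ S i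
      | .slanted i j => 1 - j ∈ Y i.castSucc ∧ 1 - j ∉ S i} with hM
    have hHM : horizontals M = S := by
      ext i x
      rw [mem_horizontals]
      change 1 - (1 - x) ∈ S i ↔ _
      rw [sub_sub_cancel]
    have hEM : empties M = Y := by
      ext l x
      rw [mem_empties]
      change ¬ (1 - (1 - x) ∉ Y l) ↔ _
      rw [sub_sub_cancel, not_not]
    have hdim : M ∈ dimers μ ν := by
      rw [mem_dimers_iff hk, isDimerConfig_iff_hop, hEM, hHM]
      refine ⟨⟨fun i x => ?_, h3⟩, h1, h2⟩
      change (1 - (1 - x) ∈ Y i.castSucc ∧ 1 - (1 - x) ∉ S i) ↔ _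
      rw [sub_sub_cancel]
    refine ⟨⟨M, hdim, fun i => ?_⟩, Subtype.ext hHM⟩
    rw [ncard_horizontal, hHM]; exact hα i

theorem card_hop {n : ℕ} {Z S : Finset (ZMod n)} (h : HopValid Z S) : (hop Z S).card = Z.card := by
  rw [hop, Finset.card_union_of_disjoint,
    Finset.card_image_of_injective _ (add_left_injective 1), Finset.card_sdiff_of_subset h.1,
    Nat.sub_add_cancel (Finset.card_le_card h.1)]
  rw [Finset.disjoint_left]
  intro x hx hx1
  obtain ⟨y, hy, rfl⟩ := Finset.mem_image.1 hx1
  rw [Finset.mem_sdiff] at hx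
  exact hx.2 (h.2 y hy hx.1)

theorem edge_finite (n k : ℕ) [NeZero n] : Finite (Edge n k) := by
  refine Finite.of_injective (β := (Fin (k + 1) × ZMod n) ⊕ (Fin k × ZMod n) ⊕ (Fin k × ZMod n))
    (fun e => match e with
      | .vertical l j => Sum.inl (l, j)
      | .horizontal i j => Sum.inr (Sum.inl (i, j))
      | .slanted i j => Sum.inr (Sum.inr (i, j))) ?_
  intro e e' h
  cases e <;> cases e' <;> simp_all

theorem card_dimers {n k : ℕ} [NeZero n] (hk : k ≤ n) (μ ν : BoxPartition n k) :
    (dimers μ ν).ncard =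
      ∑ α : Fin k → Fin (n - k + 1), (dimersWith (fun i => (α i : ℕ)) μ ν).ncard := by
  have := edge_finite n k
  simp only [← Nat.card_coe_set_eq]
  rw [← Nat.card_sigma]
  refine (Nat.card_congr (Equiv.ofBijective (fun p => ⟨p.2.1, p.2.2.1⟩) ⟨?_, ?_⟩)).symm
  · rintro ⟨α, M, hM, hα⟩ ⟨α', M', hM', hα'⟩ h
    obtain rfl : M = M' := congrArg Subtype.val h
    obtain rfl : α = α' := funext fun i => Fin.ext ((hα i).symm.trans (hα' i))
    rfl
  · rintro ⟨M, hM⟩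
    obtain ⟨h1, h2, -⟩ := (mem_dimers_iff hk μ ν M).1 hM
    obtain ⟨-, hh⟩ := (isDimerConfig_iff_hop M).1 h1
    have hE : ∀ l, (empties M l).card = n - k := by
      intro l
      induction l using Fin.induction with
      | zero => rw [h2, card_zeroSet hk]
      | succ i ih => rw [(hh i).2, card_hop (hh i).1, ih]
    have hle : ∀ i, {j : ZMod n | Edge.horizontal i j ∈ M}.ncard ≤ n - k := fun i => by
      rw [ncard_horizontal, ← hE i.castSucc]
      exact Finset.card_le_card (hh i).1.1
    exact ⟨⟨fun i => ⟨_, Nat.lt_succ_of_le (hle i)⟩, ⟨M, hM, fun i => rfl⟩⟩, rfl⟩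

/-! ### Regular crystals and their tensor products -/

/-- A function that counts how often a partial map can be applied is its depth. -/
theorem depth_eq_of_count {V : Type} {g : V → Option V} {t : V → ℕ}
    (h0 : ∀ b, g b = none → t b = 0) (h1 : ∀ b c, g b = some c → t b = t c + 1) (b : V) :
    depth g b = t b := by
  have hnone : ∀ p, (fun o : Option V => o.bind g)^[p] none = none := by
    intro p
    induction p with
    | zero => rfl
    | succ p ih => rw [Function.iterate_succ_apply]; exact ih
  have key : ∀ p b, (fun o : Option V => o.bind g)^[p] (some b) ≠ none ↔ p ≤ t b := by
    intro p
    induction p with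
    | zero => simp
    | succ p ih =>
      intro b
      rw [Function.iterate_succ_apply, Option.bind_some]
      cases hg : g b with
      | none => rw [hnone, h0 b hg]; simp
      | some c => rw [ih, h1 b c hg]; omega
  have : {p : ℕ | (fun o : Option V => o.bind g)^[p] (some b) ≠ none} = Set.Iic (t b) :=
    Set.ext fun p => key p b
  rw [depth, this, csSup_Iic]

/-- `e i` and `f i` are mutually inverse partial maps, and `ε`, `φ` are the distances to the ends
of the strings that they form. -/
structure IsRegular {n : ℕ} (A : Crystal n) (ε φ : ZMod n → A.V → ℕ) : Prop where
  inv : ∀ i b c, A.e i b = some c ↔ A.f i c = some b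
  eps_none : ∀ i b, A.e i b = none → ε i b = 0
  phi_none : ∀ i b, A.f i b = none → φ i b = 0
  eps_some : ∀ i b c, A.e i b = some c → ε i b = ε i c + 1
  phi_some : ∀ i b c, A.e i b = some c → φ i c = φ i b + 1

/-- A crystal is regular if this holds for its own functions `ε` and `φ`. -/
abbrev Crystal.Regular {n : ℕ} (A : Crystal n) : Prop := IsRegular A A.eps A.phi

theorem IsRegular.eps_eq {n : ℕ} {A : Crystal n} {ε φ : ZMod n → A.V → ℕ} (h : IsRegular A ε φ)
    (i : ZMod n) (b : A.V) : A.eps i b = ε i b :=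
  depth_eq_of_count (h.eps_none i) (h.eps_some i) b

theorem IsRegular.phi_eq {n : ℕ} {A : Crystal n} {ε φ : ZMod n → A.V → ℕ} (h : IsRegular A ε φ)
    (i : ZMod n) (b : A.V) : A.phi i b = φ i b :=
  depth_eq_of_count (h.phi_none i) (fun b c hc => h.phi_some i c b ((h.inv i c b).2 hc)) b

theorem IsRegular.regular {n : ℕ} {A : Crystal n} {ε φ : ZMod n → A.V → ℕ}
    (h : IsRegular A ε φ) : A.Regular := by
  have h1 : A.eps = ε := funext fun i => funext fun b => h.eps_eq i b
  have h2 : A.phi = φ := funext fun i => funext fun b => h.phi_eq i b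
  rw [Crystal.Regular, h1, h2]
  exact h

theorem IsRegular.exists_e {n : ℕ} {A : Crystal n} {ε φ : ZMod n → A.V → ℕ}
    (h : IsRegular A ε φ) {i : ZMod n} {b : A.V} (hb : 0 < ε i b) : ∃ c, A.e i b = some c := by
  cases hc : A.e i b with
  | none => rw [h.eps_none i b hc] at hb; exact absurd hb (lt_irrefl _)
  | some c => exact ⟨c, rfl⟩

/-- The signature rule for tensor products. -/
theorem IsRegular.tensor {n : ℕ} {A B : Crystal n} (hA : A.Regular) (hB : B.Regular) :
    IsRegular (A.tensor B) (fun i b => B.eps i b.2 + (A.eps i b.1 - B.phi i b.2))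
      (fun i b => A.phi i b.1 + (B.phi i b.2 - A.eps i b.1)) where
  inv := by
    rintro i ⟨b1, b2⟩ ⟨c1, c2⟩
    simp only [Crystal.tensor]
    constructor
    · intro h
      split_ifs at h with h1
      · obtain ⟨x, hx, he⟩ := Option.map_eq_some_iff.1 h
        obtain ⟨rfl, rfl⟩ := Prod.mk.inj he
        have := hA.eps_some i b1 x hx
        rw [if_pos (by omega), (hA.inv i b1 x).1 hx]; rfl
      · obtain ⟨y, hy, he⟩ := Option.map_eq_some_iff.1 h
        obtain ⟨rfl, rfl⟩ := Prod.mk.inj he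
        have := hB.phi_some i b2 y hy
        rw [if_neg (by omega), (hB.inv i b2 y).1 hy]; rfl
    · intro h
      split_ifs at h with h1
      · obtain ⟨x, hx, he⟩ := Option.map_eq_some_iff.1 h
        obtain ⟨rfl, rfl⟩ := Prod.mk.inj he
        have hx' := (hA.inv i x c1).2 hx
        have := hA.eps_some i x c1 hx'
        rw [if_pos (by omega), hx']; rfl
      · obtain ⟨y, hy, he⟩ := Option.map_eq_some_iff.1 h
        obtain ⟨rfl, rfl⟩ := Prod.mk.inj he
        have hy' := (hB.inv i y c2).2 hy
        have := hB.phi_some i y c2 hy'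
        rw [if_neg (by omega), hy']; rfl
  eps_none := by
    rintro i ⟨b1, b2⟩ h
    simp only [Crystal.tensor] at h ⊢
    split_ifs at h with h1
    · have := hA.eps_none i b1 (Option.map_eq_none_iff.1 h); omega
    · have := hB.eps_none i b2 (Option.map_eq_none_iff.1 h); omega
  phi_none := by
    rintro i ⟨b1, b2⟩ h
    simp only [Crystal.tensor] at h ⊢
    split_ifs at h with h1
    · have := hA.phi_none i b1 (Option.map_eq_none_iff.1 h); omega
    · have := hB.phi_none i b2 (Option.map_eq_none_iff.1 h); omega
  eps_some := by
    rintro i ⟨b1, b2⟩ ⟨c1, c2⟩ h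
    simp only [Crystal.tensor] at h ⊢
    split_ifs at h with h1
    · obtain ⟨x, hx, he⟩ := Option.map_eq_some_iff.1 h
      obtain ⟨rfl, rfl⟩ := Prod.mk.inj he
      have := hA.eps_some i b1 x hx
      omega
    · obtain ⟨y, hy, he⟩ := Option.map_eq_some_iff.1 h
      obtain ⟨rfl, rfl⟩ := Prod.mk.inj he
      have := hB.phi_some i b2 y hy
      have := hB.eps_some i b2 y hy
      omega
  phi_some := by
    rintro i ⟨b1, b2⟩ ⟨c1, c2⟩ h
    simp only [Crystal.tensor] at h ⊢
    split_ifs at h with h1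
    · obtain ⟨x, hx, he⟩ := Option.map_eq_some_iff.1 h
      obtain ⟨rfl, rfl⟩ := Prod.mk.inj he
      have := hA.eps_some i b1 x hx
      have := hA.phi_some i b1 x hx
      omega
    · obtain ⟨y, hy, he⟩ := Option.map_eq_some_iff.1 h
      obtain ⟨rfl, rfl⟩ := Prod.mk.inj he
      have := hB.phi_some i b2 y hy
      have := hB.eps_some i b2 y hy
      omega

theorem Crystal.Regular.tensor {n : ℕ} {A B : Crystal n} (hA : A.Regular) (hB : B.Regular) :
    (A.tensor B).Regular := (IsRegular.tensor hA hB).regular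

theorem tensor_eps {n : ℕ} {A B : Crystal n} (hA : A.Regular) (hB : B.Regular) (i : ZMod n)
    (b : (A.tensor B).V) :
    (A.tensor B).eps i b = B.eps i b.2 + (A.eps i b.1 - B.phi i b.2) :=
  (IsRegular.tensor hA hB).eps_eq i b

theorem tensor_phi {n : ℕ} {A B : Crystal n} (hA : A.Regular) (hB : B.Regular) (i : ZMod n)
    (b : (A.tensor B).V) :
    (A.tensor B).phi i b = A.phi i b.1 + (B.phi i b.2 - A.eps i b.1) :=
  (IsRegular.tensor hA hB).phi_eq i b

theorem isRegular_unit (n : ℕ) : IsRegular (Crystal.unit n) (fun _ _ => 0) (fun _ _ => 0) where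
  inv _ _ _ := by simp [Crystal.unit]
  eps_none _ _ _ := rfl
  phi_none _ _ _ := rfl
  eps_some _ _ _ h := by simp [Crystal.unit] at h
  phi_some _ _ _ h := by simp [Crystal.unit] at h

theorem column_e_eq_some {n r : ℕ} {i : ZMod n} {s t : (column n r).V} :
    (column n r).e i s = some t ↔ i + 1 ∈ s.1 ∧ i ∉ s.1 ∧ t.1 = insert i (s.1.erase (i + 1)) := by
  by_cases h : i + 1 ∈ s.1 ∧ i ∉ s.1
  · have h' : (column n r).e i s = some ⟨_, card_move s.2 h.1 h.2⟩ := dif_pos h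
    rw [h']
    exact ⟨fun e => ⟨h.1, h.2, (congrArg Subtype.val (Option.some.inj e)).symm⟩,
      fun e => congrArg some (Subtype.ext e.2.2.symm)⟩
  · have h' : (column n r).e i s = none := dif_neg h
    rw [h']
    exact ⟨fun e => (Option.some_ne_none t e.symm).elim, fun e => absurd ⟨e.1, e.2.1⟩ h⟩

theorem column_f_eq_some {n r : ℕ} {i : ZMod n} {s t : (column n r).V} :
    (column n r).f i s = some t ↔
      i ∈ s.1 ∧ i + 1 ∉ s.1 ∧ t.1 = insert (i + 1) (s.1.erase i) := by
  by_cases h : i ∈ s.1 ∧ i + 1 ∉ s.1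
  · have h' : (column n r).f i s = some ⟨_, card_move s.2 h.1 h.2⟩ := dif_pos h
    rw [h']
    exact ⟨fun e => ⟨h.1, h.2, (congrArg Subtype.val (Option.some.inj e)).symm⟩,
      fun e => congrArg some (Subtype.ext e.2.2.symm)⟩
  · have h' : (column n r).f i s = none := dif_neg h
    rw [h']
    exact ⟨fun e => (Option.some_ne_none t e.symm).elim, fun e => absurd ⟨e.1, e.2.1⟩ h⟩

theorem column_e_eq_none {n r : ℕ} {i : ZMod n} {s : (column n r).V} :
    (column n r).e i s = none ↔ ¬ (i + 1 ∈ s.1 ∧ i ∉ s.1) := by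
  simp only [column]
  split_ifs with h <;> simp [h]

theorem column_f_eq_none {n r : ℕ} {i : ZMod n} {s : (column n r).V} :
    (column n r).f i s = none ↔ ¬ (i ∈ s.1 ∧ i + 1 ∉ s.1) := by
  simp only [column]
  split_ifs with h <;> simp [h]

theorem self_ne_add_one {n : ℕ} (hn : 2 ≤ n) (i : ZMod n) : i ≠ i + 1 := by
  have : Fact (1 < n) := ⟨hn⟩
  intro h
  exact one_ne_zero (α := ZMod n) (by linear_combination -h)

theorem isRegular_column {n : ℕ} (hn : 2 ≤ n) (r : ℕ) : IsRegular (column n r)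
    (fun i s => if i + 1 ∈ s.1 ∧ i ∉ s.1 then 1 else 0)
    (fun i s => if i ∈ s.1 ∧ i + 1 ∉ s.1 then 1 else 0) where
  inv i s t := by
    have hne := self_ne_add_one hn i
    rw [column_e_eq_some, column_f_eq_some]
    constructor
    · rintro ⟨h1, h2, h3⟩
      rw [h3]
      refine ⟨by simp, by simp [hne.symm], ?_⟩
      rw [Finset.erase_insert (fun h => h2 (Finset.mem_of_mem_erase h)), Finset.insert_erase h1]
    · rintro ⟨h1, h2, h3⟩
      rw [h3]
      refine ⟨by simp, by simp [hne], ?_⟩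
      rw [Finset.erase_insert (fun h => h2 (Finset.mem_of_mem_erase h)), Finset.insert_erase h1]
  eps_none i s h := if_neg (column_e_eq_none.1 h)
  phi_none i s h := if_neg (column_f_eq_none.1 h)
  eps_some i s t h := by
    have hne := self_ne_add_one hn i
    obtain ⟨h1, h2, h3⟩ := column_e_eq_some.1 h
    have h4 : ¬ (i + 1 ∈ t.1 ∧ i ∉ t.1) := fun h => h.2 (by rw [h3]; simp)
    change (if i + 1 ∈ s.1 ∧ i ∉ s.1 then 1 else 0) = (if i + 1 ∈ t.1 ∧ i ∉ t.1 then 1 else 0) + 1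
    rw [if_pos ⟨h1, h2⟩, if_neg h4]
  phi_some i s t h := by
    have hne := self_ne_add_one hn i
    obtain ⟨h1, h2, h3⟩ := column_e_eq_some.1 h
    have h4 : i ∈ t.1 ∧ i + 1 ∉ t.1 := by rw [h3]; simp [hne.symm]
    have h5 : ¬ (i ∈ s.1 ∧ i + 1 ∉ s.1) := fun h => h2 h.1
    change (if i ∈ t.1 ∧ i + 1 ∉ t.1 then 1 else 0) = (if i ∈ s.1 ∧ i + 1 ∉ s.1 then 1 else 0) + 1
    rw [if_pos h4, if_neg h5]

theorem column_regular {n : ℕ} (hn : 2 ≤ n) (r : ℕ) : (column n r).Regular :=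
  (isRegular_column hn r).regular

theorem column_eps {n : ℕ} (hn : 2 ≤ n) {r : ℕ} (i : ZMod n) (s : (column n r).V) :
    (column n r).eps i s = if i + 1 ∈ s.1 ∧ i ∉ s.1 then 1 else 0 :=
  (isRegular_column hn r).eps_eq i s

theorem column_phi {n : ℕ} (hn : 2 ≤ n) {r : ℕ} (i : ZMod n) (s : (column n r).V) :
    (column n r).phi i s = if i ∈ s.1 ∧ i + 1 ∉ s.1 then 1 else 0 :=
  (isRegular_column hn r).phi_eq i s

theorem columns_regular {n : ℕ} (hn : 2 ≤ n) (m : ℕ) (α : Fin m → ℕ) :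
    (columns n m α).Regular := by
  induction m with
  | zero => exact (isRegular_unit n).regular
  | succ m ih => exact (column_regular hn (α 0)).tensor (ih fun i => α i.succ)

/-! ### Isomorphisms of crystals -/

/-- For regular crystals it suffices to check that a bijection commutes with all `f i`. -/
theorem isIso_of_f {n : ℕ} {A B : Crystal n} (hA : A.Regular) (hB : B.Regular) (R : A.V ≃ B.V)
    (h : ∀ i b, B.f i (R b) = (A.f i b).map R) : Crystal.IsIso R := by
  refine fun i b => ⟨?_, h i b⟩
  refine Option.ext fun c => ?_
  obtain ⟨a, rfl⟩ := R.surjective c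
  rw [hB.inv, h, Option.map_eq_some_iff, Option.map_eq_some_iff]
  constructor
  · rintro ⟨x, hx, hxb⟩
    obtain rfl := R.injective hxb
    exact ⟨a, (hA.inv i x a).2 hx, rfl⟩
  · rintro ⟨x, hx, hxa⟩
    obtain rfl := R.injective hxa
    exact ⟨b, (hA.inv i b x).1 hx, rfl⟩

theorem Crystal.IsIso.symm {n : ℕ} {A B : Crystal n} {R : A.V ≃ B.V} (h : Crystal.IsIso R) :
    Crystal.IsIso (A := B) (B := A) R.symm := by
  intro i b
  obtain ⟨a, rfl⟩ := R.surjective b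
  rw [R.symm_apply_apply, (h i a).1, (h i a).2, Option.map_map, Option.map_map]
  simp

theorem Crystal.IsIso.trans {n : ℕ} {A B C : Crystal n} {R : A.V ≃ B.V} {S : B.V ≃ C.V}
    (hR : Crystal.IsIso R) (hS : Crystal.IsIso S) :
    Crystal.IsIso (A := A) (B := C) (R.trans S) := by
  intro i b
  rw [Equiv.trans_apply, (hS i _).1, (hS i _).2, (hR i b).1, (hR i b).2, Option.map_map,
    Option.map_map]
  exact ⟨rfl, rfl⟩

theorem Crystal.IsIso.eps_eq {n : ℕ} {A B : Crystal n} {R : A.V ≃ B.V} (hB : B.Regular)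
    (hR : Crystal.IsIso R) (i : ZMod n) (b : A.V) : B.eps i (R b) = A.eps i b := by
  refine (depth_eq_of_count (t := fun b => B.eps i (R b)) (fun b hb => ?_) (fun b c hc => ?_)
    b).symm
  · exact hB.eps_none i _ (by rw [(hR i b).1, hb]; rfl)
  · exact hB.eps_some i _ _ (by rw [(hR i b).1, hc]; rfl)

theorem Crystal.IsIso.phi_eq {n : ℕ} {A B : Crystal n} {R : A.V ≃ B.V} (hB : B.Regular)
    (hR : Crystal.IsIso R) (i : ZMod n) (b : A.V) : B.phi i (R b) = A.phi i b := by
  refine (depth_eq_of_count (t := fun b => B.phi i (R b)) (fun b hb => ?_) (fun b c hc => ?_)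
    b).symm
  · exact hB.phi_none i _ (by rw [(hR i b).2, hb]; rfl)
  · exact hB.phi_some i _ _ ((hB.inv i _ _).2 (by rw [(hR i b).2, hc]; rfl))

theorem tensor_e_apply {n : ℕ} (A B : Crystal n) (i : ZMod n) (a : A.V) (b : B.V) :
    (A.tensor B).e i (a, b) = if B.phi i b < A.eps i a then (A.e i a).map (fun x => (x, b))
      else (B.e i b).map (fun y => (a, y)) := rfl

theorem tensor_f_apply {n : ℕ} (A B : Crystal n) (i : ZMod n) (a : A.V) (b : B.V) :
    (A.tensor B).f i (a, b) = if B.phi i b ≤ A.eps i a then (A.f i a).map (fun x => (x, b))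
      else (B.f i b).map (fun y => (a, y)) := rfl

theorem Crystal.IsIso.prodLeft {n : ℕ} {A B : Crystal n} (C : Crystal n) {R : A.V ≃ B.V}
    (hB : B.Regular) (hR : Crystal.IsIso R) :
    Crystal.IsIso (A := A.tensor C) (B := B.tensor C) (R.prodCongr (Equiv.refl C.V)) := by
  rintro i ⟨a, c⟩
  change (B.tensor C).e i (R a, c) = _ ∧ (B.tensor C).f i (R a, c) = _
  rw [tensor_e_apply, tensor_e_apply, tensor_f_apply, tensor_f_apply, hR.eps_eq hB i a,
    (hR i a).1, (hR i a).2]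
  constructor
  · split_ifs
    · cases A.e i a <;> rfl
    · cases C.e i c <;> rfl
  · split_ifs
    · cases A.f i a <;> rfl
    · cases C.f i c <;> rfl

theorem Crystal.IsIso.prodRight {n : ℕ} {A B : Crystal n} (C : Crystal n) {R : A.V ≃ B.V}
    (hB : B.Regular) (hR : Crystal.IsIso R) :
    Crystal.IsIso (A := C.tensor A) (B := C.tensor B) ((Equiv.refl C.V).prodCongr R) := by
  rintro i ⟨c, a⟩
  change (C.tensor B).e i (c, R a) = _ ∧ (C.tensor B).f i (c, R a) = _
  rw [tensor_e_apply, tensor_e_apply, tensor_f_apply, tensor_f_apply, hR.phi_eq hB i a,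
    (hR i a).1, (hR i a).2]
  constructor
  · split_ifs
    · cases C.e i c <;> rfl
    · cases A.e i a <;> rfl
  · split_ifs
    · cases C.f i c <;> rfl
    · cases A.f i a <;> rfl

/-- The tensor product of regular crystals is associative. -/
theorem isIso_prodAssoc {n : ℕ} {A B C : Crystal n} (hA : A.Regular) (hB : B.Regular)
    (hC : C.Regular) : Crystal.IsIso (A := (A.tensor B).tensor C) (B := A.tensor (B.tensor C))
      (Equiv.prodAssoc A.V B.V C.V) := by
  refine isIso_of_f ((hA.tensor hB).tensor hC) (hA.tensor (hB.tensor hC)) _ ?_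
  rintro i ⟨⟨a, b⟩, c⟩
  have h1 : (A.tensor B).eps i (a, b) = B.eps i b + (A.eps i a - B.phi i b) :=
    tensor_eps hA hB i (a, b)
  have h2 : (B.tensor C).phi i (b, c) = B.phi i b + (C.phi i c - B.eps i b) :=
    tensor_phi hB hC i (b, c)
  change (A.tensor (B.tensor C)).f i (a, (b, c)) =
    (((A.tensor B).tensor C).f i ((a, b), c)).map (Equiv.prodAssoc A.V B.V C.V)
  have e1 : ((A.tensor B).tensor C).f i ((a, b), c) =
      if C.phi i c ≤ B.eps i b + (A.eps i a - B.phi i b) then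
        ((A.tensor B).f i (a, b)).map (fun x => (x, c))
      else (C.f i c).map (fun y => ((a, b), y)) := by
    rw [← h1]; rfl
  have e2 : (A.tensor (B.tensor C)).f i (a, (b, c)) =
      if B.phi i b + (C.phi i c - B.eps i b) ≤ A.eps i a then
        (A.f i a).map (fun x => (x, (b, c)))
      else ((B.tensor C).f i (b, c)).map (fun y => (a, y)) := by
    rw [← h2]; rfl
  rw [e1, e2, tensor_f_apply A B, tensor_f_apply B C]
  split_ifs <;> first
    | omega
    | (cases A.f i a <;> rfl)
    | (cases B.f i b <;> rfl)
    | (cases C.f i c <;> rfl)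

/-! ### Weights and connectedness -/

/-- A weight function on a crystal of type `A_{n-1}^{(1)}`, with values in `ℤ^n`. -/
structure IsWeight {n : ℕ} (A : Crystal n) (w : A.V → ZMod n → ℤ) : Prop where
  phi_sub_eps : ∀ i b, (A.phi i b : ℤ) - A.eps i b = w b i - w b (i + 1)
  step : ∀ i b c, A.e i b = some c → ∀ j,
    w c j = w b j + (if j = i then 1 else 0) - (if j = i + 1 then 1 else 0)

theorem IsWeight.tensor {n : ℕ} {A B : Crystal n} (hA : A.Regular) (hB : B.Regular)
    {v : A.V → ZMod n → ℤ} {w : B.V → ZMod n → ℤ} (hv : IsWeight A v) (hw : IsWeight B w) :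
    IsWeight (A.tensor B) (fun b j => v b.1 j + w b.2 j) where
  phi_sub_eps := by
    rintro i ⟨a, b⟩
    have h1 : (A.tensor B).eps i (a, b) = B.eps i b + (A.eps i a - B.phi i b) :=
      tensor_eps hA hB i (a, b)
    have h2 : (A.tensor B).phi i (a, b) = A.phi i a + (B.phi i b - A.eps i a) :=
      tensor_phi hA hB i (a, b)
    have h3 := hv.phi_sub_eps i a
    have h4 := hw.phi_sub_eps i b
    rw [h1, h2]
    simp only
    omega
  step := by
    rintro i ⟨a, b⟩ ⟨a', b'⟩ h j
    rw [tensor_e_apply] at h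
    split_ifs at h with h1
    · obtain ⟨x, hx, he⟩ := Option.map_eq_some_iff.1 h
      obtain ⟨rfl, rfl⟩ := Prod.mk.inj he
      have := hv.step i a x hx j
      simp only [this]
      ring
    · obtain ⟨y, hy, he⟩ := Option.map_eq_some_iff.1 h
      obtain ⟨rfl, rfl⟩ := Prod.mk.inj he
      have := hw.step i b y hy j
      simp only [this]
      ring

theorem isWeight_unit (n : ℕ) : IsWeight (Crystal.unit n) (fun _ _ => 0) where
  phi_sub_eps i b := by
    rw [(isRegular_unit n).phi_eq, (isRegular_unit n).eps_eq]; rfl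
  step i b c h := nomatch h

theorem isWeight_column {n : ℕ} (hn : 2 ≤ n) (r : ℕ) :
    IsWeight (column n r) (fun s j => if j ∈ s.1 then 1 else 0) where
  phi_sub_eps i s := by
    rw [column_eps hn, column_phi hn]
    by_cases h1 : i ∈ s.1 <;> by_cases h2 : i + 1 ∈ s.1 <;> simp [h1, h2]
  step i s t h j := by
    obtain ⟨h1, h2, h3⟩ := column_e_eq_some.1 h
    have hne := self_ne_add_one hn i
    simp only [h3, Finset.mem_insert, Finset.mem_erase]
    by_cases e1 : j = i
    · subst e1; simp [h2, hne]
    · by_cases e2 : j = i + 1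
      · subst e2; simp [h1, hne.symm]
      · simp [e1, e2]

/-- The weight of a tensor product of columns counts the one-letters in each position. -/
def weight (n : ℕ) : (m : ℕ) → (α : Fin m → ℕ) → (columns n m α).V → ZMod n → ℤ
  | 0, _, _, _ => 0
  | m + 1, α, b, j => (if j ∈ b.1.1 then 1 else 0) + weight n m (fun i => α i.succ) b.2 j

theorem isWeight_weight {n : ℕ} (hn : 2 ≤ n) (m : ℕ) (α : Fin m → ℕ) :
    IsWeight (columns n m α) (weight n m α) := by
  induction m with
  | zero => exact isWeight_unit n
  | succ m ih =>
    exact (isWeight_column hn (α 0)).tensor (column_regular hn _) (columns_regular hn m _)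
      (ih fun i => α i.succ)

theorem sum_weight {n : ℕ} [NeZero n] (m : ℕ) (α : Fin m → ℕ) (b : (columns n m α).V) :
    ∑ j, weight n m α b j = ∑ i, (α i : ℤ) := by
  induction m with
  | zero => simp [weight]
  | succ m ih =>
    have h1 : ∑ j : ZMod n, (if j ∈ b.1.1 then (1 : ℤ) else 0) = α 0 := by
      rw [Finset.sum_boole, Finset.filter_mem_eq_inter, Finset.univ_inter, b.1.2]
    rw [Fin.sum_univ_succ, ← ih (fun i => α i.succ) b.2, ← h1, ← Finset.sum_add_distrib]
    rfl

/-- A set of vertices that is closed under the operators `e i`. -/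
def EClosed {n : ℕ} (A : Crystal n) (T : Set A.V) : Prop :=
  ∀ i b c, b ∈ T → A.e i b = some c → c ∈ T

/-- The crystal graph is strongly connected. -/
def Crystal.Connected {n : ℕ} (A : Crystal n) : Prop :=
  ∀ T : Set A.V, T.Nonempty → EClosed A T → ∀ b, b ∈ T

/-- In a finite crystal a set closed under the `e i` is closed under the `f i`: a top segment of an
`i`-string has `∑ (φ i - ε i) ≥ 0`, with equality only for full strings, while
`∑ i, (φ i - ε i)` vanishes at each vertex. -/
theorem EClosed.mem_of_e {n : ℕ} [NeZero n] {A : Crystal n} [Finite A.V] (hA : A.Regular)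
    {w : A.V → ZMod n → ℤ} (hw : IsWeight A w) {T : Set A.V} (hT : EClosed A T) {i : ZMod n}
    {b c : A.V} (hc : c ∈ T) (hb : A.e i b = some c) : b ∈ T := by
  classical
  have := Fintype.ofFinite A.V
  set T' : Finset A.V := Finset.univ.filter (· ∈ T) with hT'
  have memT : ∀ x, x ∈ T' ↔ x ∈ T := by simp [hT']
  set Q : ZMod n → Finset A.V := fun i => T'.filter fun c => ∃ b ∈ T, A.e i b = some c with hQ
  have hsum : ∀ i, ∑ b ∈ T', A.eps i b * (A.phi i b + 1) =
      ∑ c ∈ Q i, A.phi i c * (A.eps i c + 1) := by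
    intro i
    rw [← Finset.sum_filter_of_ne (p := fun b => 0 < A.eps i b)
      (fun x _ hx => Nat.pos_of_ne_zero fun h => hx (by rw [h, zero_mul]))]
    refine Finset.sum_nbij (fun b => (A.e i b).getD b) ?_ ?_ ?_ ?_
    · intro b hb
      obtain ⟨hb1, hb2⟩ := Finset.mem_filter.1 hb
      obtain ⟨c, hc⟩ := hA.exists_e hb2
      rw [hc, Option.getD_some]
      have hb3 := (memT b).1 hb1
      exact Finset.mem_filter.2 ⟨(memT c).2 (hT i b c hb3 hc), b, hb3, hc⟩
    · intro b hb b' hb' h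
      obtain ⟨c, hc⟩ := hA.exists_e (Finset.mem_filter.1 hb).2
      obtain ⟨c', hc'⟩ := hA.exists_e (Finset.mem_filter.1 hb').2
      simp only [hc, hc', Option.getD_some] at h
      subst h
      exact Option.some.inj (((hA.inv i b c).1 hc).symm.trans ((hA.inv i b' c).1 hc'))
    · intro c hc
      obtain ⟨_, b, hb, hbc⟩ := Finset.mem_filter.1 hc
      have h := hA.eps_some i b c hbc
      refine ⟨b, Finset.mem_coe.2 (Finset.mem_filter.2 ⟨(memT b).2 hb, by omega⟩), ?_⟩
      simp only [hbc, Option.getD_some]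
    · intro b hb
      obtain ⟨c, hc⟩ := hA.exists_e (Finset.mem_filter.1 hb).2
      simp only [hc, Option.getD_some]
      rw [hA.eps_some i b c hc, hA.phi_some i b c hc]
      ring
  have hle : ∀ i, ∑ b ∈ T', A.eps i b * (A.phi i b + 1) ≤
      ∑ c ∈ T', A.phi i c * (A.eps i c + 1) := fun i => by
    rw [hsum]
    exact Finset.sum_le_sum_of_subset (Finset.filter_subset _ _)
  have htot : ∑ i, ∑ b ∈ T', A.eps i b * (A.phi i b + 1) =
      ∑ i, ∑ b ∈ T', A.phi i b * (A.eps i b + 1) := by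
    have h : ∑ i, ∑ b ∈ T', ((A.phi i b * (A.eps i b + 1) : ℤ) -
        A.eps i b * (A.phi i b + 1)) = 0 := by
      rw [Finset.sum_comm]
      refine Finset.sum_eq_zero fun b _ => ?_
      have : ∀ i, ((A.phi i b * (A.eps i b + 1) : ℤ) - A.eps i b * (A.phi i b + 1)) =
          w b i - w b (i + 1) := fun i => by
        rw [← hw.phi_sub_eps i b]; ring
      rw [Finset.sum_congr rfl fun i _ => this i, Finset.sum_sub_distrib, sub_eq_zero]
      exact (Equiv.sum_comp (Equiv.addRight (1 : ZMod n)) (w b)).symm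
    simp only [Finset.sum_sub_distrib, sub_eq_zero] at h
    exact_mod_cast h.symm
  have heq := (Finset.sum_eq_sum_iff_of_le fun i _ => hle i).1 htot i (Finset.mem_univ i)
  have hcQ : c ∈ Q i := by
    by_contra hcQ
    have hsub : Q i ⊆ T' := Finset.filter_subset _ _
    have hsd := Finset.sum_sdiff (f := fun x => A.phi i x * (A.eps i x + 1)) hsub
    rw [hsum] at heq
    have h0 : ∑ x ∈ T' \ Q i, A.phi i x * (A.eps i x + 1) = 0 := by omega
    have := (Finset.sum_eq_zero_iff.1 h0) c (Finset.mem_sdiff.2 ⟨(memT c).2 hc, hcQ⟩)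
    have h1 := hA.phi_some i b c hb
    rw [h1] at this
    simp at this
  obtain ⟨_, b', hb', hbc'⟩ := Finset.mem_filter.1 hcQ
  obtain rfl : b' = b :=
    Option.some.inj (((hA.inv i b' c).1 hbc').symm.trans ((hA.inv i b c).1 hb))
  exact hb'

/-- A crystal is connected if some vertex lies in all nonempty sets closed under the `e i`. -/
theorem connected_of_forall_mem {n : ℕ} [NeZero n] {A : Crystal n} [Finite A.V] (hA : A.Regular)
    {w : A.V → ZMod n → ℤ} (hw : IsWeight A w) (p : A.V)
    (hp : ∀ T : Set A.V, T.Nonempty → EClosed A T → p ∈ T) : A.Connected := by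
  intro T hne hT b
  by_contra hb
  refine hp Tᶜ ⟨b, hb⟩ (fun i x y hx hxy hy => hx (hT.mem_of_e hA hw hy hxy)) (hp T hne hT)

/-- The height above the bottom of the finite type crystal, up to a constant: the operators `e i`
with `i ≠ -1` lower it by one. -/
def degree {n : ℕ} [NeZero n] (w : ZMod n → ℤ) : ℤ := ∑ j, (j.val : ℤ) * w j

theorem val_add_one_of_ne {n : ℕ} (hn : 2 ≤ n) {i : ZMod n} (hi : i ≠ -1) :
    (i + 1).val = i.val + 1 := by
  have : Fact (1 < n) := ⟨hn⟩
  have : NeZero n := ⟨by omega⟩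
  have hlt := ZMod.val_lt i
  have : i.val + 1 ≠ n := by
    intro h
    apply hi
    have h1 : ((i.val + 1 : ℕ) : ZMod n) = 0 := by rw [h]; exact ZMod.natCast_self n
    rw [Nat.cast_add, ZMod.natCast_zmod_val, Nat.cast_one] at h1
    linear_combination h1
  rw [ZMod.val_add, ZMod.val_one, Nat.mod_eq_of_lt (by omega)]

theorem IsWeight.degree_step {n : ℕ} [NeZero n] (hn : 2 ≤ n) {A : Crystal n}
    {w : A.V → ZMod n → ℤ} (hw : IsWeight A w) {i : ZMod n} (hi : i ≠ -1) {b c : A.V}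
    (h : A.e i b = some c) : degree (w b) = degree (w c) + 1 := by
  have hv := val_add_one_of_ne hn hi
  simp only [degree, hw.step i b c h, mul_sub, mul_add, Finset.sum_sub_distrib,
    Finset.sum_add_distrib, mul_ite, mul_one, mul_zero, Finset.sum_ite_eq', Finset.mem_univ,
    if_true, hv]
  push_cast
  ring

/-- A column in which no letter can be moved by an `e i` with `i ≠ -1` is an initial segment. -/
theorem eq_of_forall_e_eq_none {n r : ℕ} (hn : 2 ≤ n) {s t : (column n r).V}
    (hs : ∀ i, i ≠ -1 → (column n r).e i s = none)
    (ht : ∀ i, i ≠ -1 → (column n r).e i t = none) : s = t := by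
  have : NeZero n := ⟨by omega⟩
  have key : ∀ u : (column n r).V, (∀ i, i ≠ -1 → (column n r).e i u = none) →
      ∀ d : ℕ, ∀ x y : ZMod n, y.val + d = x.val → x ∈ u.1 → y ∈ u.1 := by
    intro u hu d
    induction d with
    | zero => intro x y h hx; rwa [ZMod.val_injective n h]
    | succ d ih =>
      intro x y h hx
      have hy : y ≠ -1 := by
        intro e
        have h1 := ZMod.val_lt x
        have h2 : (-1 : ZMod n).val = n - 1 := by
          obtain ⟨n, rfl⟩ : ∃ k, n = k + 1 := ⟨n - 1, by omega⟩
          rw [ZMod.val_neg_one]; rfl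
        rw [e, h2] at h
        omega
      have h2 := val_add_one_of_ne hn hy
      have h3 := ih x (y + 1) (by omega) hx
      have h4 := column_e_eq_none.1 (hu y hy)
      by_contra h5
      exact h4 ⟨h3, h5⟩
  apply Subtype.ext
  by_cases h : s.1 ⊆ t.1
  · exact Finset.eq_of_subset_of_card_le h (by rw [s.2, t.2])
  · refine (Finset.eq_of_subset_of_card_le (fun y hy => ?_) (by rw [s.2, t.2])).symm
    obtain ⟨x, hx, hxt⟩ := Finset.not_subset.1 h
    rcases le_total y.val x.val with hle | hle
    · exact key s hs (x.val - y.val) x y (by omega) hx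
    · exact absurd (key t ht (y.val - x.val) y x (by omega) hy) hxt

theorem nonempty_column {n r : ℕ} [NeZero n] (hr : r ≤ n) : Nonempty (column n r).V := by
  obtain ⟨s, -, hs⟩ := Finset.exists_subset_card_eq
    (s := (Finset.univ : Finset (ZMod n))) (n := r) (by rw [Finset.card_univ, ZMod.card]; exact hr)
  exact ⟨⟨s, hs⟩⟩

/-- Every column can be moved to a fixed one by operators `e i` with `i ≠ -1`, and this column has
the smallest degree. -/
theorem exists_initial_column {n r : ℕ} [NeZero n] (hn : 2 ≤ n) (hr : r ≤ n) :
    ∃ p : (column n r).V,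
      (∀ T : Set (column n r).V, T.Nonempty →
        (∀ i b c, i ≠ -1 → b ∈ T → (column n r).e i b = some c → c ∈ T) → p ∈ T) ∧
      ∀ s, degree (fun j => if j ∈ s.1 then 1 else 0) ≤
        degree (n := n) (fun j => if j ∈ p.1 then 1 else 0) → s = p := by
  have hw := isWeight_column hn r
  set D : (column n r).V → ℤ := fun s => degree fun j => if j ∈ s.1 then 1 else 0 with hD
  have hmin : ∀ T : Set (column n r).V, T.Nonempty →
      (∀ i b c, i ≠ -1 → b ∈ T → (column n r).e i b = some c → c ∈ T) →
      ∃ s ∈ T, (∀ t ∈ T, D s ≤ D t) ∧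
        ∀ t ∈ T, D t ≤ D s → ∀ i, i ≠ -1 → (column n r).e i t = none := by
    intro T hne hT
    obtain ⟨s, hs, hmin⟩ := Set.exists_min_image T D (Set.toFinite T) hne
    refine ⟨s, hs, hmin, fun t ht hts i hi => ?_⟩
    cases h : (column n r).e i t with
    | none => rfl
    | some c =>
      have h1 : D t = D c + 1 := hw.degree_step hn hi h
      have h2 := hmin c (hT i t c hi ht h)
      omega
  have := nonempty_column hr
  obtain ⟨p, -, hpmin, hp⟩ := hmin Set.univ Set.univ_nonempty fun _ _ _ _ _ _ => trivial
  have hp0 := hp p trivial le_rfl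
  refine ⟨p, fun T hne hT => ?_, fun s hs => ?_⟩
  · obtain ⟨s, hs, -, h⟩ := hmin T hne hT
    rw [← eq_of_forall_e_eq_none hn (h s hs le_rfl) hp0]
    exact hs
  · exact eq_of_forall_e_eq_none hn (hp s trivial hs) hp0

theorem column_connected {n r : ℕ} [NeZero n] (hn : 2 ≤ n) (hr : r ≤ n) :
    (column n r).Connected := by
  obtain ⟨p, hp, -⟩ := exists_initial_column hn hr
  exact connected_of_forall_mem (column_regular hn r) (isWeight_column hn r) p
    fun T hne hT => hp T hne fun i b c _ => hT i b c

/-- Tensoring with a column preserves connectedness: the operators `e i` with `i ≠ -1` act on the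
column alone if the other factor has maximal degree. -/
theorem Crystal.Connected.column_tensor {n r : ℕ} [NeZero n] (hn : 2 ≤ n) (hr : r ≤ n)
    {B : Crystal n} [Finite B.V] [Nonempty B.V] (hB : B.Regular) {w : B.V → ZMod n → ℤ}
    (hw : IsWeight B w) (h : B.Connected) : ((column n r).tensor B).Connected := by
  have hA := column_regular hn r
  obtain ⟨p, hp, -⟩ := exists_initial_column hn hr
  obtain ⟨q, hq⟩ := Finite.exists_max fun b => degree (w b)
  have hq0 : ∀ i, i ≠ -1 → B.phi i q = 0 := by
    intro i hi
    cases hf : B.f i q with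
    | none => exact hB.phi_none i q hf
    | some c =>
      have := hw.degree_step hn hi ((hB.inv i c q).2 hf)
      have := hq c
      omega
  have : Finite ((column n r).tensor B).V := inferInstanceAs (Finite ((column n r).V × B.V))
  refine connected_of_forall_mem (hA.tensor hB) ((isWeight_column hn r).tensor hA hB hw) (p, q) ?_
  intro T hne hT
  have hproj : EClosed B {b | ∃ a, (a, b) ∈ T} := by
    rintro i b c ⟨a, ha⟩ hbc
    suffices ∀ l a, (column n r).eps i a = l → (a, b) ∈ T → ∃ a, (a, c) ∈ T from
      this _ a rfl ha
    intro l
    induction l with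
    | zero =>
      intro a hl ha
      refine ⟨a, hT i (a, b) (a, c) ha ?_⟩
      rw [tensor_e_apply, if_neg (by omega), hbc]; rfl
    | succ l ih =>
      intro a hl ha
      by_cases hlt : B.phi i b < (column n r).eps i a
      · obtain ⟨a', ha'⟩ := hA.exists_e (i := i) (b := a) (by omega)
        have := hA.eps_some i a a' ha'
        refine ih a' (by omega) (hT i (a, b) (a', b) ha ?_)
        rw [tensor_e_apply, if_pos hlt, ha']; rfl
      · refine ⟨a, hT i (a, b) (a, c) ha ?_⟩
        rw [tensor_e_apply, if_neg hlt, hbc]; rfl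
  obtain ⟨⟨a₀, b₀⟩, h₀⟩ := hne
  have hproj_ne : Set.Nonempty {b : B.V | ∃ a, (a, b) ∈ T} := ⟨b₀, a₀, h₀⟩
  obtain ⟨a, ha⟩ := h _ hproj_ne hproj q
  refine hp {a | (a, q) ∈ T} ⟨a, ha⟩ fun i a c hi ha hac => hT i (a, q) (c, q) ha ?_
  have := hA.eps_some i a c hac
  rw [tensor_e_apply, if_pos (by rw [hq0 i hi]; omega), hac]; rfl

theorem nonempty_columns {n : ℕ} [NeZero n] (m : ℕ) (α : Fin m → ℕ) (hα : ∀ i, α i ≤ n) :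
    Nonempty (columns n m α).V := by
  induction m with
  | zero => exact inferInstanceAs (Nonempty Unit)
  | succ m ih =>
    obtain ⟨a⟩ := nonempty_column (hα 0)
    obtain ⟨b⟩ := ih (fun i => α i.succ) fun i => hα i.succ
    exact Nonempty.intro (α := (column n (α 0)).V × (columns n m fun i => α i.succ).V) (a, b)

theorem columns_connected {n : ℕ} [NeZero n] (hn : 2 ≤ n) (m : ℕ) (α : Fin m → ℕ)
    (hα : ∀ i, α i ≤ n) : (columns n m α).Connected := by
  induction m with
  | zero => rintro T ⟨b, hb⟩ - c; exact hb
  | succ m ih =>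
    have := nonempty_columns m (fun i => α i.succ) fun i => hα i.succ
    exact (ih (fun i => α i.succ) fun i => hα i.succ).column_tensor hn (hα 0)
      (columns_regular hn m _) (isWeight_weight hn m _)

/-- The degree has a unique minimum. -/
theorem exists_unique_min_degree {n : ℕ} [NeZero n] (hn : 2 ≤ n) (m : ℕ) (α : Fin m → ℕ)
    (hα : ∀ i, α i ≤ n) : ∃ p : (columns n m α).V, ∀ b : (columns n m α).V,
      degree (weight n m α b) ≤ degree (weight n m α p) → b = p := by
  induction m with
  | zero => exact Exists.intro (α := Unit) () fun _ _ => rfl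
  | succ m ih =>
    obtain ⟨q, hq⟩ := ih (fun i => α i.succ) fun i => hα i.succ
    obtain ⟨p, -, hp⟩ := exists_initial_column hn (hα 0)
    refine ⟨(p, q), fun b hb => ?_⟩
    have hadd : ∀ c : (columns n (m + 1) α).V, degree (weight n (m + 1) α c) =
        degree (fun j => if j ∈ c.1.1 then 1 else 0) +
          degree (weight n m (fun i => α i.succ) c.2) := by
      intro c
      simp only [degree, weight, mul_add, Finset.sum_add_distrib]
    replace hb := (hadd b).symm.trans_le (hb.trans (hadd (p, q)).le)
    change degree _ + degree _ ≤ degree (fun j => if j ∈ p.1 then 1 else 0) +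
      degree (weight n m (fun i => α i.succ) q) at hb
    have h1 : degree (fun j => if j ∈ p.1 then 1 else 0) ≤
        degree (n := n) (fun j => if j ∈ b.1.1 then 1 else 0) := by
      by_contra h
      have := hp b.1 (by omega)
      rw [this] at h
      exact h le_rfl
    have h2 := hq b.2 (by omega)
    have h3 := hp b.1 (by rw [h2] at hb; omega)
    exact Prod.ext h3 h2

/-- A tensor product of columns has no nontrivial automorphisms. -/
theorem IsIso.eq_of_columns {n : ℕ} [NeZero n] (hn : 2 ≤ n) {m : ℕ} {α : Fin m → ℕ}
    (hα : ∀ i, α i ≤ n) {B : Crystal n} {R R' : (columns n m α).V ≃ B.V} (hR : Crystal.IsIso R)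
    (hR' : Crystal.IsIso R') : R = R' := by
  have hA := columns_regular hn m α
  have hσ := hR.trans hR'.symm
  set σ := R.trans R'.symm with hσ'
  have hw := isWeight_weight hn m α
  -- `φ i - ε i` determines the weight up to a constant, and the constant vanishes as the total
  -- weight is the same everywhere
  have hwt : ∀ b, weight n m α (σ b) = weight n m α b := by
    intro b
    have hd : ∀ i, weight n m α (σ b) (i + 1) - weight n m α b (i + 1) =
        weight n m α (σ b) i - weight n m α b i := by
      intro i
      have h1 := hw.phi_sub_eps i b
      have h2 := hw.phi_sub_eps i (σ b)
      rw [hσ.phi_eq hA, hσ.eps_eq hA] at h2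
      omega
    have hc : ∀ l : ℕ, weight n m α (σ b) (l : ZMod n) - weight n m α b (l : ZMod n) =
        weight n m α (σ b) 0 - weight n m α b 0 := by
      intro l
      induction l with
      | zero => simp
      | succ l ih => rw [Nat.cast_succ, hd, ih]
    have hc' : ∀ j : ZMod n, weight n m α (σ b) j - weight n m α b j =
        weight n m α (σ b) 0 - weight n m α b 0 := by
      intro j
      rw [← hc j.val, ZMod.natCast_zmod_val]
    have hs : ∑ j, (weight n m α (σ b) j - weight n m α b j) = 0 := by
      rw [Finset.sum_sub_distrib, sum_weight, sum_weight, sub_self]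
    rw [Finset.sum_congr rfl fun j _ => hc' j, Finset.sum_const, Finset.card_univ, ZMod.card,
      smul_eq_zero] at hs
    have h0 := hs.resolve_left (NeZero.ne n)
    funext j
    have := hc' j
    omega
  obtain ⟨p, hp⟩ := exists_unique_min_degree hn m α hα
  have hfix := columns_connected hn m α hα {b | σ b = b} ⟨p, hp _ (by rw [hwt])⟩
    fun i b c hb hbc => by
      have h := (hσ i b).1
      rw [show σ b = b from hb, hbc] at h
      exact (Option.some.inj h).symm
  ext b
  have h := hfix b
  rw [Set.mem_ofPred_eq, hσ', Equiv.trans_apply, Equiv.symm_apply_eq] at h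
  exact h

/-! ### The combinatorial R-matrix for two columns -/

/-- The bracketing rule that describes the combinatorial R-matrix `B_M ⊗ B_r → B_r ⊗ B_M`, `r ≤ M`,
on a pair `x ⊗ y` of columns. Going round the circle in decreasing direction, every one-letter of
`y` is matched with the first available one-letter of `x` in the same or a subsequent position;
`c p` is the number of those letters of `y` that are unmatched when the position `p` has been
treated, and `F` is the set of unmatched letters of `x`. -/
structure IsCarry {n : ℕ} (x y F : Finset (ZMod n)) (c : ZMod n → ℕ) : Prop where
  mem_iff : ∀ p, p ∈ F ↔ p ∈ x ∧ p ∉ y ∧ c (p + 1) = 0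
  carry : ∀ p, c p = c (p + 1) + (if p ∈ y then 1 else 0) - (if p ∈ x then 1 else 0)

theorem sum_add_one {n : ℕ} [NeZero n] {M : Type*} [AddCommMonoid M] (g : ZMod n → M) :
    ∑ p, g (p + 1) = ∑ p, g p :=
  Equiv.sum_comp (Equiv.addRight (1 : ZMod n)) g

/-- The unmatched letters do not depend on the choice of `c`. -/
theorem IsCarry.unique {n : ℕ} [NeZero n] {x y F F' : Finset (ZMod n)} {c c' : ZMod n → ℕ}
    (h : IsCarry x y F c) (h' : IsCarry x y F' c') : F = F' := by
  -- the distance of two solutions does not increase in the direction of matching, so it is constant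
  have hle : ∀ p, ((c p : ℤ) - c' p).natAbs ≤ ((c (p + 1) : ℤ) - c' (p + 1)).natAbs := by
    intro p
    have h1 := h.carry p
    have h2 := h'.carry p
    split_ifs at h1 h2 <;> omega
  have heq : ∀ p, ((c p : ℤ) - c' p).natAbs = ((c (p + 1) : ℤ) - c' (p + 1)).natAbs := fun p =>
    (Finset.sum_eq_sum_iff_of_le fun p _ => hle p).1
      (sum_add_one fun p => ((c p : ℤ) - c' p).natAbs).symm p (Finset.mem_univ p)
  ext p
  have h1 := h.carry p
  have h2 := h'.carry p
  have h3 := heq p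
  rw [h.mem_iff, h'.mem_iff]
  refine and_congr_right fun hx => and_congr_right fun hy => ?_
  rw [if_pos hx, if_neg hy] at h1 h2
  omega

theorem IsCarry.subset {n : ℕ} {x y F : Finset (ZMod n)} {c : ZMod n → ℕ}
    (h : IsCarry x y F c) : F ⊆ x := fun p hp => ((h.mem_iff p).1 hp).1

theorem IsCarry.disjoint {n : ℕ} {x y F : Finset (ZMod n)} {c : ZMod n → ℕ}
    (h : IsCarry x y F c) : Disjoint y F :=
  Finset.disjoint_right.2 fun p hp => ((h.mem_iff p).1 hp).2.1

theorem IsCarry.card_add {n : ℕ} [NeZero n] {x y F : Finset (ZMod n)} {c : ZMod n → ℕ}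
    (h : IsCarry x y F c) : F.card + y.card = x.card := by
  have h1 : ∀ p, (if p ∈ F then 1 else 0) + (if p ∈ y then 1 else 0) + c (p + 1) =
      (if p ∈ x then 1 else 0) + c p := by
    intro p
    have h2 := h.carry p
    have h3 := h.mem_iff p
    by_cases hx : p ∈ x <;> by_cases hy : p ∈ y <;> by_cases hc : c (p + 1) = 0 <;>
      simp [hx, hy, hc] at h2 h3 ⊢ <;> simp [h3] <;> omega
  have h2 := Finset.sum_congr (rfl : (Finset.univ : Finset (ZMod n)) = _) fun p _ => h1 p
  simp only [Finset.sum_add_distrib, sum_add_one c, Finset.sum_boole, Finset.filter_mem_eq_inter,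
    Finset.univ_inter, Nat.cast_id] at h2
  omega

/-- The excess of letters of `x` over letters of `y` in the positions `p, …, p + t - 1`. -/
def excess {n : ℕ} (x y : Finset (ZMod n)) (p : ZMod n) (t : ℕ) : ℤ :=
  ∑ s ∈ Finset.range t,
    ((if p + (s : ZMod n) ∈ x then 1 else 0) - (if p + (s : ZMod n) ∈ y then 1 else 0))

theorem excess_succ {n : ℕ} (x y : Finset (ZMod n)) (p : ZMod n) (t : ℕ) :
    excess x y p (t + 1) =
      ((if p ∈ x then 1 else 0) - (if p ∈ y then 1 else 0)) + excess x y (p + 1) t := by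
  simp only [excess]
  rw [Finset.sum_range_succ', add_comm]
  simp only [Nat.cast_zero, add_zero, Nat.cast_succ]
  congr 1
  refine Finset.sum_congr rfl fun s _ => ?_
  rw [show p + ((s : ZMod n) + 1) = p + 1 + s by ring]

theorem sum_range_zmod {n : ℕ} [NeZero n] {M : Type*} [AddCommMonoid M] (p : ZMod n)
    (g : ZMod n → M) : ∑ s ∈ Finset.range n, g (p + (s : ZMod n)) = ∑ q, g q := by
  refine Finset.sum_nbij (fun s : ℕ => p + (s : ZMod n)) (fun _ _ => Finset.mem_univ _) ?_ ?_
    (fun _ _ => rfl)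
  · intro s hs t ht h
    have h1 := congrArg ZMod.val (add_left_cancel h)
    rwa [ZMod.val_cast_of_lt (Finset.mem_range.1 hs),
      ZMod.val_cast_of_lt (Finset.mem_range.1 ht)] at h1
  · intro q _
    exact ⟨(q - p).val, Finset.mem_coe.2 (Finset.mem_range.2 (ZMod.val_lt _)), by
      simp only [ZMod.natCast_zmod_val]; ring⟩

theorem excess_add_self {n : ℕ} [NeZero n] (x y : Finset (ZMod n)) (p : ZMod n) (t : ℕ) :
    excess x y p (n + t) = (x.card - y.card) + excess x y p t := by
  have h : ∑ q : ZMod n, ((if q ∈ x then (1 : ℤ) else 0) - (if q ∈ y then 1 else 0)) =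
      x.card - y.card := by
    rw [Finset.sum_sub_distrib, Finset.sum_boole, Finset.sum_boole, Finset.filter_mem_eq_inter,
      Finset.filter_mem_eq_inter, Finset.univ_inter, Finset.univ_inter]
  rw [excess, Finset.sum_range_add, ← h,
    sum_range_zmod p fun q => ((if q ∈ x then (1 : ℤ) else 0) - (if q ∈ y then 1 else 0)), excess]
  simp only [Nat.cast_add, ZMod.natCast_self, zero_add]

theorem neg_le_excess {n : ℕ} [NeZero n] {x y : Finset (ZMod n)} (h : y.card ≤ x.card)
    (p : ZMod n) (t : ℕ) : -(n : ℤ) ≤ excess x y p t := by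
  induction t using Nat.strong_induction_on with
  | _ t ih =>
    rcases lt_or_ge t n with ht | ht
    · have : -(t : ℤ) ≤ excess x y p t := by
        have h1 : ∑ _s ∈ Finset.range t, (-1 : ℤ) ≤ excess x y p t :=
          Finset.sum_le_sum fun s _ => by split_ifs <;> norm_num
        simpa using h1
      omega
    · obtain ⟨u, rfl⟩ := Nat.exists_eq_add_of_le ht
      have := ih u (by have := NeZero.pos n; omega)
      rw [excess_add_self]
      omega

/-- The smallest amount by which all excesses starting at `p` have to be raised to become
nonnegative. -/
def minCarry {n : ℕ} (x y : Finset (ZMod n)) (p : ZMod n) : ℕ :=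
  sInf {c : ℕ | ∀ t, 0 ≤ (c : ℤ) + excess x y p t}

theorem minCarry_le_iff {n : ℕ} [NeZero n] {x y : Finset (ZMod n)} (h : y.card ≤ x.card)
    (p : ZMod n) (z : ℤ) : (minCarry x y p : ℤ) ≤ z ↔ ∀ t, 0 ≤ z + excess x y p t := by
  have hne : {c : ℕ | ∀ t, 0 ≤ (c : ℤ) + excess x y p t}.Nonempty :=
    ⟨n, fun t => by have := neg_le_excess h p t; omega⟩
  constructor
  · intro hz t
    have h1 := Nat.sInf_mem hne t
    rw [minCarry] at hz
    omega
  · intro hz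
    have h0 : 0 ≤ z := by simpa [excess] using hz 0
    obtain ⟨c, rfl⟩ := Int.eq_ofNat_of_zero_le h0
    exact_mod_cast Nat.sInf_le (show c ∈ {c : ℕ | ∀ t, 0 ≤ (c : ℤ) + excess x y p t} from hz)

/-- The letters of `x` that remain unmatched. -/
def freeSet {n : ℕ} [NeZero n] (x y : Finset (ZMod n)) : Finset (ZMod n) :=
  Finset.univ.filter fun p => p ∈ x ∧ p ∉ y ∧ minCarry x y (p + 1) = 0

theorem isCarry_freeSet {n : ℕ} [NeZero n] {x y : Finset (ZMod n)} (h : y.card ≤ x.card) :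
    IsCarry x y (freeSet x y) (minCarry x y) where
  mem_iff p := by simp [freeSet]
  carry p := by
    have key : ∀ z : ℤ, (minCarry x y p : ℤ) ≤ z ↔ 0 ≤ z ∧ (minCarry x y (p + 1) : ℤ) ≤
        z + ((if p ∈ x then 1 else 0) - (if p ∈ y then 1 else 0)) := by
      intro z
      rw [minCarry_le_iff h, minCarry_le_iff h]
      constructor
      · intro hz
        refine ⟨by simpa [excess] using hz 0, fun t => ?_⟩
        have := hz (t + 1)
        rw [excess_succ] at this
        linarith
      · rintro ⟨h0, hz⟩ t
        cases t with
        | zero => simpa [excess] using h0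
        | succ t =>
          have := hz t
          rw [excess_succ]
          linarith
    have k1 := (key (minCarry x y p)).1 le_rfl
    have k2 := key ((minCarry x y (p + 1) +
      (if p ∈ y then 1 else 0) - (if p ∈ x then 1 else 0) : ℕ) : ℤ)
    split_ifs at k1 k2 ⊢ <;> omega

/-- Moving a letter from `i` to `i + 1` changes `c` at most at `i + 1`, provided that the signature
rule does not forbid the move. -/
theorem IsCarry.update {n : ℕ} (hn : 2 ≤ n) {x y x' y' F : Finset (ZMod n)}
    {c : ZMod n → ℕ} {i : ZMod n} (h : IsCarry x y F c)
    (hout : ∀ j, j ≠ i → j ≠ i + 1 → (j ∈ x' ↔ j ∈ x) ∧ (j ∈ y' ↔ j ∈ y))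
    (hin : (i ∈ x ∧ i + 1 ∉ x ∧ ¬ (i ∈ y ∧ i + 1 ∉ y) ∧
        i ∉ x' ∧ i + 1 ∈ x' ∧ (i ∈ y' ↔ i ∈ y) ∧ (i + 1 ∈ y' ↔ i + 1 ∈ y)) ∨
      (i ∈ y ∧ i + 1 ∉ y ∧ ¬ (i ∉ x ∧ i + 1 ∈ x) ∧
        i ∉ y' ∧ i + 1 ∈ y' ∧ (i ∈ x' ↔ i ∈ x) ∧ (i + 1 ∈ x' ↔ i + 1 ∈ x)))
    [NeZero n] :
    ∃ F' c', IsCarry x' y' F' c' ∧ ∀ j, j ≠ i + 1 → c' j = c j := by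
  classical
  have hne := self_ne_add_one hn
  set c' := Function.update c (i + 1) (c (i + 1 + 1) + (if i + 1 ∈ y' then 1 else 0) -
    (if i + 1 ∈ x' then 1 else 0)) with hc'
  have hc1 : ∀ j, j ≠ i + 1 → c' j = c j := fun j hj => Function.update_of_ne hj _ _
  refine ⟨Finset.univ.filter fun p => p ∈ x' ∧ p ∉ y' ∧ c' (p + 1) = 0, c',
    ⟨fun p => by simp, fun p => ?_⟩, hc1⟩
  by_cases h1 : p = i + 1
  · rw [h1, hc1 (i + 1 + 1) (hne (i + 1)).symm, hc', Function.update_self]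
  · by_cases h2 : p = i
    · subst h2
      rw [hc1 p (hne p), hc', Function.update_self]
      have e1 := h.carry p
      have e2 := h.carry (p + 1)
      rcases hin with ⟨a1, a2, a3, a4, a5, a6, a7⟩ | ⟨a1, a2, a3, a4, a5, a6, a7⟩
      · by_cases b1 : p ∈ y <;> by_cases b2 : p + 1 ∈ y <;>
          simp [a1, a2, a4, a5, a6, a7, b1, b2] at a3 e1 e2 ⊢ <;> omega
      · by_cases b1 : p ∈ x <;> by_cases b2 : p + 1 ∈ x <;>
          simp [a1, a2, a4, a5, a6, a7, b1, b2] at a3 e1 e2 ⊢ <;> omega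
    · obtain ⟨h3, h4⟩ := hout p h2 h1
      rw [hc1 p h1, hc1 (p + 1) (fun e => h2 (add_right_cancel e)), h.carry p]
      simp only [h3, h4]

theorem ite_le_ite_iff {p q : Prop} [Decidable p] [Decidable q] :
    (if p then 1 else 0) ≤ (if q then 1 else 0) ↔ ¬ p ∨ q := by
  by_cases h1 : p <;> by_cases h2 : q <;> simp [h1, h2]

theorem column_tensor_f_eq_some {n M r : ℕ} (hn : 2 ≤ n) {i : ZMod n}
    {a b : ((column n M).tensor (column n r)).V} :
    ((column n M).tensor (column n r)).f i a = some b ↔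
      (∀ j, j ≠ i → j ≠ i + 1 → (j ∈ b.1.1 ↔ j ∈ a.1.1) ∧ (j ∈ b.2.1 ↔ j ∈ a.2.1)) ∧
      ((i ∈ a.1.1 ∧ i + 1 ∉ a.1.1 ∧ ¬ (i ∈ a.2.1 ∧ i + 1 ∉ a.2.1) ∧
        i ∉ b.1.1 ∧ i + 1 ∈ b.1.1 ∧ (i ∈ b.2.1 ↔ i ∈ a.2.1) ∧
          (i + 1 ∈ b.2.1 ↔ i + 1 ∈ a.2.1)) ∨
      (i ∈ a.2.1 ∧ i + 1 ∉ a.2.1 ∧ ¬ (i ∉ a.1.1 ∧ i + 1 ∈ a.1.1) ∧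
        i ∉ b.2.1 ∧ i + 1 ∈ b.2.1 ∧ (i ∈ b.1.1 ↔ i ∈ a.1.1) ∧
          (i + 1 ∈ b.1.1 ↔ i + 1 ∈ a.1.1))) := by
  obtain ⟨x, y⟩ := a
  obtain ⟨x', y'⟩ := b
  have hne := self_ne_add_one hn i
  have hext : ∀ {l : ℕ} (s t : (column n l).V), s = t ↔
      (∀ j, j ≠ i → j ≠ i + 1 → (j ∈ t.1 ↔ j ∈ s.1)) ∧ (i ∈ t.1 ↔ i ∈ s.1) ∧
        (i + 1 ∈ t.1 ↔ i + 1 ∈ s.1) := by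
    refine fun s t => ⟨fun h => by rw [h]; simp, fun ⟨h1, h2, h3⟩ =>
      Subtype.ext (Finset.ext fun j => Iff.symm ?_)⟩
    by_cases e1 : j = i
    · rwa [e1]
    · by_cases e2 : j = i + 1
      · rwa [e2]
      · exact h1 j e1 e2
  have hmove : ∀ s t : Finset (ZMod n), t = insert (i + 1) (s.erase i) ↔
      (∀ j, j ≠ i → j ≠ i + 1 → (j ∈ t ↔ j ∈ s)) ∧ i ∉ t ∧ i + 1 ∈ t := by
    intro s t
    constructor
    · rintro rfl
      refine ⟨fun j h1 h2 => by simp [h1, h2], by simp [hne], by simp⟩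
    · rintro ⟨h3, h1, h2⟩
      ext j
      by_cases e1 : j = i
      · subst e1; simp [h1, hne]
      · by_cases e2 : j = i + 1
        · subst e2; simp [h2]
        · simp [e1, e2, h3 j e1 e2]
  have hx : ((column n M).f i x).map (fun x => (x, y)) = some (x', y') ↔
      (i ∈ x.1 ∧ i + 1 ∉ x.1 ∧ x'.1 = insert (i + 1) (x.1.erase i)) ∧ y = y' := by
    rw [← column_f_eq_some, Option.map_eq_some_iff]
    constructor
    · rintro ⟨z, hz, he⟩
      obtain ⟨rfl, rfl⟩ := Prod.mk.inj he
      exact ⟨hz, rfl⟩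
    · rintro ⟨hz, rfl⟩
      exact ⟨x', hz, rfl⟩
  have hy : ((column n r).f i y).map (fun y => (x, y)) = some (x', y') ↔
      (i ∈ y.1 ∧ i + 1 ∉ y.1 ∧ y'.1 = insert (i + 1) (y.1.erase i)) ∧ x = x' := by
    rw [← column_f_eq_some, Option.map_eq_some_iff]
    constructor
    · rintro ⟨z, hz, he⟩
      obtain ⟨rfl, rfl⟩ := Prod.mk.inj he
      exact ⟨hz, rfl⟩
    · rintro ⟨hz, rfl⟩
      exact ⟨y', hz, rfl⟩
  rw [hmove, hext] at hx hy
  rw [tensor_f_apply, column_eps hn, column_phi hn]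
  change (if _ then ((column n M).f i x).map (fun x => (x, y)) else
    ((column n r).f i y).map (fun y => (x, y))) = some (x', y') ↔
      (∀ j, j ≠ i → j ≠ i + 1 → (j ∈ x'.1 ↔ j ∈ x.1) ∧ (j ∈ y'.1 ↔ j ∈ y.1)) ∧
      ((i ∈ x.1 ∧ i + 1 ∉ x.1 ∧ ¬ (i ∈ y.1 ∧ i + 1 ∉ y.1) ∧
        i ∉ x'.1 ∧ i + 1 ∈ x'.1 ∧ (i ∈ y'.1 ↔ i ∈ y.1) ∧
          (i + 1 ∈ y'.1 ↔ i + 1 ∈ y.1)) ∨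
      (i ∈ y.1 ∧ i + 1 ∉ y.1 ∧ ¬ (i ∉ x.1 ∧ i + 1 ∈ x.1) ∧
        i ∉ y'.1 ∧ i + 1 ∈ y'.1 ∧ (i ∈ x'.1 ↔ i ∈ x.1) ∧
          (i + 1 ∈ x'.1 ↔ i + 1 ∈ x.1)))
  simp only [imp_and, forall_and]
  generalize (∀ j, j ≠ i → j ≠ i + 1 → (j ∈ x'.1 ↔ j ∈ x.1)) = p at hx hy ⊢
  generalize (∀ j, j ≠ i → j ≠ i + 1 → (j ∈ y'.1 ↔ j ∈ y.1)) = q at hx hy ⊢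
  by_cases hc : ¬ (i ∈ y.1 ∧ i + 1 ∉ y.1) ∨ (i + 1 ∈ x.1 ∧ i ∉ x.1)
  · rw [if_pos (ite_le_ite_iff.2 hc), hx]
    clear hx hy hext hmove
    generalize (i ∈ x.1) = x0 at hc ⊢
    generalize (i + 1 ∈ x.1) = x1 at hc ⊢
    generalize (i ∈ y.1) = y0 at hc ⊢
    generalize (i + 1 ∈ y.1) = y1 at hc ⊢
    generalize (i ∈ x'.1) = x0'
    generalize (i + 1 ∈ x'.1) = x1'
    generalize (i ∈ y'.1) = y0'
    generalize (i + 1 ∈ y'.1) = y1'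
    grind
  · rw [if_neg (mt ite_le_ite_iff.1 hc), hy]
    clear hx hy hext hmove
    generalize (i ∈ x.1) = x0 at hc ⊢
    generalize (i + 1 ∈ x.1) = x1 at hc ⊢
    generalize (i ∈ y.1) = y0 at hc ⊢
    generalize (i + 1 ∈ y.1) = y1 at hc ⊢
    generalize (i ∈ x'.1) = x0'
    generalize (i + 1 ∈ x'.1) = x1'
    generalize (i ∈ y'.1) = y0'
    generalize (i + 1 ∈ y'.1) = y1'
    grind

theorem column_tensor_f_eq_none {n M r : ℕ} (hn : 2 ≤ n) {i : ZMod n}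
    {a : ((column n M).tensor (column n r)).V} :
    ((column n M).tensor (column n r)).f i a = none ↔
      ¬ (i ∈ a.1.1 ∧ i + 1 ∉ a.1.1 ∧ ¬ (i ∈ a.2.1 ∧ i + 1 ∉ a.2.1)) ∧
      ¬ (i ∈ a.2.1 ∧ i + 1 ∉ a.2.1 ∧ ¬ (i ∉ a.1.1 ∧ i + 1 ∈ a.1.1)) := by
  obtain ⟨x, y⟩ := a
  have hx : ((column n M).f i x).map (fun x => (x, y)) = none ↔ ¬ (i ∈ x.1 ∧ i + 1 ∉ x.1) := by
    rw [Option.map_eq_none_iff, column_f_eq_none]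
  have hy : ((column n r).f i y).map (fun y => (x, y)) = none ↔ ¬ (i ∈ y.1 ∧ i + 1 ∉ y.1) := by
    rw [Option.map_eq_none_iff, column_f_eq_none]
  rw [tensor_f_apply, column_eps hn, column_phi hn]
  change (if _ then ((column n M).f i x).map (fun x => (x, y)) else
    ((column n r).f i y).map (fun y => (x, y))) = none ↔
      ¬ (i ∈ x.1 ∧ i + 1 ∉ x.1 ∧ ¬ (i ∈ y.1 ∧ i + 1 ∉ y.1)) ∧
      ¬ (i ∈ y.1 ∧ i + 1 ∉ y.1 ∧ ¬ (i ∉ x.1 ∧ i + 1 ∈ x.1))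
  by_cases hc : ¬ (i ∈ y.1 ∧ i + 1 ∉ y.1) ∨ (i + 1 ∈ x.1 ∧ i ∉ x.1)
  · rw [if_pos (ite_le_ite_iff.2 hc), hx]
    clear hx hy
    generalize (i ∈ x.1) = x0 at hc ⊢
    generalize (i + 1 ∈ x.1) = x1 at hc ⊢
    generalize (i ∈ y.1) = y0 at hc ⊢
    generalize (i + 1 ∈ y.1) = y1 at hc ⊢
    grind
  · rw [if_neg (mt ite_le_ite_iff.1 hc), hy]
    clear hx hy
    generalize (i ∈ x.1) = x0 at hc ⊢
    generalize (i + 1 ∈ x.1) = x1 at hc ⊢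
    generalize (i ∈ y.1) = y0 at hc ⊢
    generalize (i + 1 ∈ y.1) = y1 at hc ⊢
    grind

/-- The combinatorial R-matrix `B_M ⊗ B_r → B_r ⊗ B_M`, `r ≤ M`: the unmatched letters of the first
factor are moved to the second one. -/
def rMap {n : ℕ} [NeZero n] {M r : ℕ} (h : r ≤ M) (a : ((column n M).tensor (column n r)).V) :
    ((column n r).tensor (column n M)).V :=
  have hc := isCarry_freeSet (x := a.1.1) (y := a.2.1) (by rw [a.1.2, a.2.2]; exact h)
  have hcard := hc.card_add
  (⟨a.1.1 \ freeSet a.1.1 a.2.1, by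
      rw [Finset.card_sdiff_of_subset hc.subset]; have := a.2.2; omega⟩,
    ⟨a.2.1 ∪ freeSet a.1.1 a.2.1, by
      rw [Finset.card_union_of_disjoint hc.disjoint]; have := a.1.2; omega⟩)

theorem IsCarry.mem_rMap {n : ℕ} [NeZero n] {M r : ℕ} (h : r ≤ M)
    {a : ((column n M).tensor (column n r)).V} {F : Finset (ZMod n)} {c : ZMod n → ℕ}
    (hF : IsCarry a.1.1 a.2.1 F c) (j : ZMod n) :
    (j ∈ (rMap h a).1.1 ↔ j ∈ a.1.1 ∧ (j ∈ a.2.1 ∨ c (j + 1) ≠ 0)) ∧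
    (j ∈ (rMap h a).2.1 ↔ j ∈ a.2.1 ∨ (j ∈ a.1.1 ∧ c (j + 1) = 0)) := by
  have hc := isCarry_freeSet (x := a.1.1) (y := a.2.1) (by rw [a.1.2, a.2.2]; exact h)
  change (j ∈ a.1.1 \ freeSet a.1.1 a.2.1 ↔ _) ∧ (j ∈ a.2.1 ∪ freeSet a.1.1 a.2.1 ↔ _)
  rw [hc.unique hF, Finset.mem_sdiff, Finset.mem_union, hF.mem_iff]
  tauto

theorem rMap_f {n : ℕ} [NeZero n] (hn : 2 ≤ n) {M r : ℕ} (h : r ≤ M) (i : ZMod n)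
    (a : ((column n M).tensor (column n r)).V) :
    ((column n r).tensor (column n M)).f i (rMap h a) =
      (((column n M).tensor (column n r)).f i a).map (rMap h) := by
  have hF := isCarry_freeSet (x := a.1.1) (y := a.2.1) (by rw [a.1.2, a.2.2]; exact h)
  have e1 := hF.carry (i + 1)
  have a0 := hF.mem_rMap h i
  have a1 := hF.mem_rMap h (i + 1)
  cases hf : ((column n M).tensor (column n r)).f i a with
  | none =>
    rw [column_tensor_f_eq_none hn] at hf
    rw [Option.map_none, column_tensor_f_eq_none hn, a0.1, a0.2, a1.1, a1.2]
    generalize minCarry a.1.1 a.2.1 (i + 1 + 1) = z at e1 ⊢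
    generalize minCarry a.1.1 a.2.1 (i + 1) = z1 at e1 ⊢
    clear a0 a1 hF
    by_cases h1 : i ∈ a.1.1 <;> by_cases h2 : i + 1 ∈ a.1.1 <;> by_cases h3 : i ∈ a.2.1 <;>
      by_cases h4 : i + 1 ∈ a.2.1 <;> simp [h1, h2, h3, h4] at hf e1 ⊢ <;> omega
  | some b =>
    rw [column_tensor_f_eq_some hn] at hf
    obtain ⟨F', c', hF', hc'⟩ := hF.update hn hf.1 hf.2
    have b0 := hF'.mem_rMap h i
    have b1 := hF'.mem_rMap h (i + 1)
    have e1' := hF'.carry (i + 1)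
    have hz := hc' (i + 1 + 1) (self_ne_add_one hn _).symm
    rw [Option.map_some, column_tensor_f_eq_some hn]
    refine ⟨fun j hj0 hj1 => ?_, ?_⟩
    · have h1 := hF.mem_rMap h j
      have h2 := hF'.mem_rMap h j
      rw [h1.1, h1.2, h2.1, h2.2, hc' (j + 1) (fun e => hj0 (add_right_cancel e)),
        (hf.1 j hj0 hj1).1, (hf.1 j hj0 hj1).2]
      exact ⟨Iff.rfl, Iff.rfl⟩
    · rw [a0.1, a0.2, a1.1, a1.2, b0.1, b0.2, b1.1, b1.2, hz]
      rw [hz] at e1'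
      replace hf := hf.2
      generalize minCarry a.1.1 a.2.1 (i + 1 + 1) = z at e1 e1' ⊢
      generalize minCarry a.1.1 a.2.1 (i + 1) = z1 at e1 ⊢
      generalize c' (i + 1) = z1' at e1' ⊢
      clear a0 a1 b0 b1 hF hF' hc' hz
      rcases hf with ⟨h1, h2, h3, h1', h2', h3', h4'⟩ | ⟨h1, h2, h3, h1', h2', h3', h4'⟩
      · by_cases h5 : i ∈ a.2.1 <;> by_cases h6 : i + 1 ∈ a.2.1 <;>
          simp [h1, h2, h1', h2', h3', h4', h5, h6] at h3 e1 e1' ⊢ <;> omega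
      · by_cases h5 : i ∈ a.1.1 <;> by_cases h6 : i + 1 ∈ a.1.1 <;>
          simp [h1, h2, h1', h2', h3', h4', h5, h6] at h3 e1 e1' ⊢ <;> omega

/-! ### The combinatorial R-matrix of a tensor product of columns -/

/-- A map between finite crystals that commutes with all `f i` and preserves weights is an
isomorphism, if its target is connected and both crystals have the same size: as it preserves `φ i`
and weights, it preserves `ε i`, and so its range is closed under the `e i`. -/
theorem exists_isIso_of_f {n : ℕ} {A B : Crystal n} [Finite A.V] [Nonempty A.V] (hA : A.Regular)
    (hB : B.Regular) {v : A.V → ZMod n → ℤ} {w : B.V → ZMod n → ℤ} (hv : IsWeight A v)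
    (hw : IsWeight B w) (hconn : B.Connected) (hcard : Nat.card A.V ≤ Nat.card B.V)
    (g : A.V → B.V) (hg : ∀ i b, B.f i (g b) = (A.f i b).map g) (hgw : ∀ b, w (g b) = v b) :
    ∃ R : A.V ≃ B.V, (∀ b, R b = g b) ∧ Crystal.IsIso R := by
  have hphi : ∀ i b, B.phi i (g b) = A.phi i b := by
    intro i b
    refine (depth_eq_of_count (t := fun b => B.phi i (g b)) (fun b hb => ?_) (fun b c hc => ?_)
      b).symm
    · exact hB.phi_none i _ (by rw [hg i b, hb]; rfl)
    · exact hB.phi_some i _ _ ((hB.inv i _ _).2 (by rw [hg i b, hc]; rfl))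
  have heps : ∀ i b, B.eps i (g b) = A.eps i b := by
    intro i b
    have h1 := hv.phi_sub_eps i b
    have h2 := hw.phi_sub_eps i (g b)
    rw [hgw, hphi] at h2
    omega
  have hsurj : Function.Surjective g := by
    refine hconn (Set.range g) (Set.range_nonempty g) ?_
    rintro i _ d ⟨b, rfl⟩ hd
    have h1 := hB.eps_some i _ d hd
    rw [heps] at h1
    obtain ⟨b', hb'⟩ := hA.exists_e (i := i) (b := b) (by omega)
    have h2 := hg i b'
    rw [(hA.inv i b b').1 hb', Option.map_some] at h2
    rw [(hB.inv i _ _).2 h2] at hd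
    exact ⟨b', Option.some.inj hd⟩
  have hbij := hsurj.bijective_of_nat_card_le hcard
  exact ⟨Equiv.ofBijective g hbij, fun _ => rfl, isIso_of_f hA hB _ hg⟩

/-- The walks of letters describe the fibres of the R-matrix for two columns. -/
theorem exists_isIso_column {n : ℕ} [NeZero n] (hn : 2 ≤ n) {M r : ℕ} (hr : r ≤ M) (hM : M ≤ n) :
    ∃ R : ((column n M).tensor (column n r)).V ≃ ((column n r).tensor (column n M)).V,
      Crystal.IsIso R ∧ ∀ (u : (column n M).V) (s : (column n r).V) (v : (column n M).V),
        R (u, shift s) = (s, v) ↔ HopValid u.1 s.1 ∧ v.1 = hop u.1 s.1 := by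
  have hA := column_regular hn M
  have hB := column_regular hn r
  have : Nonempty (column n M).V := nonempty_column hM
  have : Nonempty (column n r).V := nonempty_column (hr.trans hM)
  have : Finite ((column n M).tensor (column n r)).V :=
    inferInstanceAs (Finite ((column n M).V × (column n r).V))
  have : Nonempty ((column n M).tensor (column n r)).V :=
    inferInstanceAs (Nonempty ((column n M).V × (column n r).V))
  obtain ⟨R, hR, hiso⟩ := exists_isIso_of_f (hA.tensor hB) (hB.tensor hA)
    ((isWeight_column hn M).tensor hA hB (isWeight_column hn r))
    ((isWeight_column hn r).tensor hB hA (isWeight_column hn M))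
    ((column_connected hn hM).column_tensor hn (hr.trans hM) hA (isWeight_column hn M))
    (Nat.card_congr (Equiv.prodComm (column n M).V (column n r).V)).le (rMap hr) (rMap_f hn hr)
    (fun a => by
      have hF := isCarry_freeSet (x := a.1.1) (y := a.2.1) (by rw [a.1.2, a.2.2]; exact hr)
      funext j
      have h1 := hF.mem_rMap hr j
      simp only [h1.1, h1.2]
      by_cases h2 : j ∈ a.1.1 <;> by_cases h3 : j ∈ a.2.1 <;>
        by_cases h4 : minCarry a.1.1 a.2.1 (j + 1) = 0 <;> simp [h2, h3, h4])
  refine ⟨R, hiso, fun u s v => ?_⟩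
  have hmem : ∀ p, p ∈ (shift s).1 ↔ p - 1 ∈ s.1 := by
    intro p
    change p ∈ s.1.image (fun i => i + 1) ↔ _
    rw [Finset.mem_image]
    exact ⟨by rintro ⟨q, hq, rfl⟩; rwa [add_sub_cancel_right], fun h => ⟨_, h, sub_add_cancel _ _⟩⟩
  have hF := isCarry_freeSet (x := u.1) (y := (shift s).1) (by rw [u.2, (shift s).2]; exact hr)
  refine Iff.trans (Eq.congr_left (hR (u, shift s))) ?_
  constructor
  · intro h
    have h1 : u.1 \ freeSet u.1 (shift s).1 = s.1 := congrArg (fun a => a.1.1) h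
    have h2 : (shift s).1 ∪ freeSet u.1 (shift s).1 = v.1 := congrArg (fun a => a.2.1) h
    have h3 : freeSet u.1 (shift s).1 = u.1 \ s.1 := by
      rw [← h1, Finset.sdiff_sdiff_eq_self hF.subset]
    refine ⟨⟨h1 ▸ Finset.sdiff_subset, fun x hx hx1 => ?_⟩, ?_⟩
    · rw [← h1, Finset.mem_sdiff]
      refine ⟨hx1, fun hf => Finset.disjoint_right.1 hF.disjoint hf ?_⟩
      rw [hmem, add_sub_cancel_right]
      exact hx
    · rw [← h2, h3, Finset.union_comm]
      rfl
  · rintro ⟨⟨hsub, hval⟩, hv⟩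
    -- a letter of `u` that hops is matched with its own image, so that exactly one letter is
    -- carried over from `p` if `p - 1` hops, and none otherwise
    have hc : IsCarry u.1 (shift s).1 (u.1 \ s.1) (fun p => if p - 1 ∈ s.1 then 1 else 0) := by
      constructor
      · intro p
        have h1 := hval (p - 1)
        rw [sub_add_cancel] at h1
        rw [hmem, Finset.mem_sdiff, add_sub_cancel_right]
        by_cases h2 : p ∈ s.1 <;> by_cases h3 : p - 1 ∈ s.1 <;> simp [h2, h3] at h1 ⊢
        exact h1
      · intro p
        have h1 := hval (p - 1)
        have h4 := @hsub p
        rw [sub_add_cancel] at h1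
        simp only [hmem, add_sub_cancel_right]
        by_cases h2 : p ∈ s.1 <;> by_cases h3 : p - 1 ∈ s.1 <;> simp [h2, h3] at h1 h4 ⊢ <;>
          simp [h1, h4]
    have h3 := hF.unique hc
    refine Prod.ext (Subtype.ext ?_) (Subtype.ext ?_)
    · change u.1 \ freeSet u.1 (shift s).1 = s.1
      rw [h3, Finset.sdiff_sdiff_eq_self hsub]
    · change (shift s).1 ∪ freeSet u.1 (shift s).1 = v.1
      rw [h3, hv, Finset.union_comm]
      rfl

theorem isIso_unit {n : ℕ} {A : Crystal n} (hA : A.Regular) :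
    Crystal.IsIso (A := A.tensor (Crystal.unit n)) (B := (Crystal.unit n).tensor A)
      (Equiv.prodComm A.V Unit) := by
  have hU := (isRegular_unit n).regular
  refine isIso_of_f (hA.tensor hU) (hU.tensor hA) _ ?_
  rintro i ⟨a, u⟩
  change ((Crystal.unit n).tensor A).f i (u, a) =
    ((A.tensor (Crystal.unit n)).f i (a, u)).map (Equiv.prodComm A.V Unit)
  rw [tensor_f_apply, tensor_f_apply, (isRegular_unit n).phi_eq, (isRegular_unit n).eps_eq,
    if_pos (Nat.zero_le _)]
  split_ifs with h
  · have : A.f i a = none := by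
      cases hf : A.f i a with
      | none => rfl
      | some c =>
        have := hA.phi_some i c a ((hA.inv i c a).2 hf)
        omega
    rw [this]; rfl
  · cases A.f i a <;> rfl

/-- The R-matrix moves a column through a tensor product one factor at a time. -/
theorem exists_isIso_columns {n : ℕ} [NeZero n] (hn : 2 ≤ n) {M : ℕ} (hM : M ≤ n) (m : ℕ)
    (α : Fin m → ℕ) (hα : ∀ i, α i ≤ M) :
    ∃ R : ((column n M).tensor (columns n m α)).V ≃ ((columns n m α).tensor (column n M)).V,
      Crystal.IsIso R ∧ ∀ (u : (column n M).V) (b : (columns n m α).V) (v : (column n M).V),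
        R (u, Omega n m α b) = (b, v) ↔ IsWalk n m α u.1 b v.1 := by
  have hU := column_regular hn M
  induction m with
  | zero =>
    refine ⟨Equiv.prodComm _ _, isIso_unit hU, fun u b v => ?_⟩
    change (b, u) = (b, v) ↔ u.1 = v.1
    exact ⟨fun h => congrArg (fun a => a.2.1) h, fun h => by rw [Subtype.ext h]⟩
  | succ m ih =>
    obtain ⟨S, hS, hSw⟩ := ih (fun i => α i.succ) fun i => hα i.succ
    obtain ⟨R, hR, hRw⟩ := exists_isIso_column hn (hα 0) hM
    have hA := column_regular hn (α 0)
    have hC := columns_regular hn m fun i => α i.succ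
    have i1 := (isIso_prodAssoc hU hA hC).symm
    have i2 := hR.prodLeft (columns n m fun i => α i.succ) (hA.tensor hU)
    have i3 := isIso_prodAssoc hA hU hC
    have i4 := hS.prodRight (column n (α 0)) (hC.tensor hU)
    have i5 := (isIso_prodAssoc hA hC hU).symm
    refine ⟨_, (((i1.trans i2).trans i3).trans i4).trans i5, ?_⟩
    rintro u ⟨s, b⟩ v
    obtain ⟨⟨s', w⟩, hw⟩ : ∃ p, p = R (u, shift s) := ⟨_, rfl⟩
    obtain ⟨⟨b', v'⟩, hv'⟩ : ∃ p, p = S (w, Omega n m (fun i => α i.succ) b) := ⟨_, rfl⟩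
    have hval : ((Equiv.prodAssoc _ _ _).symm ((Equiv.refl _).prodCongr S
        (Equiv.prodAssoc _ _ _ ((R.prodCongr (Equiv.refl _))
          ((Equiv.prodAssoc _ _ _).symm (u, (shift s, Omega n m (fun i => α i.succ) b))))))) =
        ((s', b'), v') := by
      change (((R (u, shift s)).1, (S ((R (u, shift s)).2, Omega n m (fun i => α i.succ) b)).1),
        (S ((R (u, shift s)).2, Omega n m (fun i => α i.succ) b)).2) = ((s', b'), v')
      rw [← hw]
      change ((s', (S (w, Omega n m (fun i => α i.succ) b)).1),
        (S (w, Omega n m (fun i => α i.succ) b)).2) = ((s', b'), v')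
      rw [← hv']
    change _ = ((s, b), v) ↔ HopValid u.1 s.1 ∧ IsWalk n m (fun i => α i.succ) (hop u.1 s.1) b v.1
    refine Iff.trans (Eq.congr_left hval) ?_
    constructor
    · intro h
      obtain ⟨h1, rfl⟩ := Prod.mk.inj h
      obtain ⟨rfl, rfl⟩ := Prod.mk.inj h1
      obtain ⟨h2, h3⟩ := (hRw u s' w).1 hw.symm
      exact ⟨h2, h3 ▸ (hSw w b' v').1 hv'.symm⟩
    · rintro ⟨h1, h2⟩
      have hw0 : ∃ w0 : (column n M).V, w0.1 = hop u.1 s.1 :=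
        ⟨⟨hop u.1 s.1, by rw [card_hop h1, u.2]⟩, rfl⟩
      obtain ⟨w0, hw0⟩ := hw0
      have e1 := hw.trans ((hRw u s w0).2 ⟨h1, hw0⟩)
      obtain ⟨rfl, rfl⟩ := Prod.mk.inj e1
      have e2 := hv'.trans ((hSw w b v).2 (hw0 ▸ h2))
      obtain ⟨rfl, rfl⟩ := Prod.mk.inj e2
      rfl

/-- The R-matrix condition says that the string `b` describes a walk. -/
theorem rMatrixCond_iff {n k : ℕ} [NeZero n] (hn : 2 ≤ n) (hk : k ≤ n) (α : Fin k → ℕ)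
    (hα : ∀ i, α i ≤ n - k) (μ ν : BoxPartition n k) (b : (columns n k α).V) :
    RMatrixCond α μ ν b ↔ b ∈ walks α μ ν := by
  obtain ⟨R, hR, hRw⟩ := exists_isIso_columns hn (Nat.sub_le n k) k α hα
  constructor
  · rintro ⟨R', hR', u, v, hu, hv, h⟩
    have hle : ∀ i, (Fin.cons (n - k) α : Fin (k + 1) → ℕ) i ≤ n := by
      refine Fin.cases (Nat.sub_le n k) fun i => (hα i).trans (Nat.sub_le n k)
    have : R' = R := IsIso.eq_of_columns (α := Fin.cons (n - k) α) hn hle hR' hR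
    rw [this, hRw, hu, hv] at h
    exact h
  · intro h
    refine ⟨R, hR, ⟨zeroSet μ, card_zeroSet hk μ⟩, ⟨zeroSet ν, card_zeroSet hk ν⟩, rfl, rfl, ?_⟩
    exact (hRw _ b _).2 h

/-! ### The signature condition -/

theorem weight_nonneg {n : ℕ} (m : ℕ) (α : Fin m → ℕ) (b : (columns n m α).V) (x : ZMod n) :
    0 ≤ weight n m α b x := by
  induction m with
  | zero => exact le_rfl
  | succ m ih =>
    have := ih (fun i => α i.succ) b.2
    change 0 ≤ (if x ∈ b.1.1 then 1 else 0) + weight n m (fun i => α i.succ) b.2 x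
    split_ifs <;> omega

theorem mem_hop_add_one_iff {n : ℕ} {Z S : Finset (ZMod n)} (x : ZMod n) :
    x + 1 ∈ hop Z S ↔ (x + 1 ∈ Z ∧ x + 1 ∉ S) ∨ x ∈ S := by
  simp [hop]

/-- Conservation of particles: the weight of a walk counts the hops out of each position. -/
theorem IsWalk.flux {n m : ℕ} {α : Fin m → ℕ} {Z Z' : Finset (ZMod n)}
    {b : (columns n m α).V} (h : IsWalk n m α Z b Z') (x : ZMod n) :
    (if x + 1 ∈ Z' then (1 : ℤ) else 0) =
      (if x + 1 ∈ Z then 1 else 0) - weight n m α b (x + 1) + weight n m α b x := by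
  induction m generalizing Z with
  | zero =>
    obtain rfl : Z = Z' := h
    simp [weight]
  | succ m ih =>
    obtain ⟨⟨h1, h2⟩, h3⟩ := h
    have h4 := @h1 (x + 1)
    have h5 := h2 x
    have h6 := @h1 x
    rw [ih h3]
    simp only [weight, mem_hop_add_one_iff]
    generalize weight n m (fun i => α i.succ) b.2 (x + 1) = w1
    generalize weight n m (fun i => α i.succ) b.2 x = w0
    by_cases e1 : x ∈ b.1.1 <;> by_cases e2 : x + 1 ∈ b.1.1 <;> by_cases e3 : x + 1 ∈ Z <;>
      simp [e1, e2, e3] at h4 h5 ⊢ <;> omega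

/-- The hops onto and out of a position alternate along a walk, so that the signature rule leaves at
most one letter: whether the position is occupied at the start decides about `φ`, whether it is
occupied at the end decides about `ε`. -/
theorem IsWalk.phi_eps {n m : ℕ} (hn : 2 ≤ n) {α : Fin m → ℕ} {Z Z' : Finset (ZMod n)}
    {b : (columns n m α).V} (h : IsWalk n m α Z b Z') (i : ZMod n) :
    (columns n m α).phi i b = (if i + 1 ∉ Z ∧ 0 < weight n m α b i then 1 else 0) ∧
    (columns n m α).eps i b = (if i + 1 ∉ Z' ∧ 0 < weight n m α b (i + 1) then 1 else 0) := by
  induction m generalizing Z with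
  | zero =>
    have h1 : (columns n 0 α).phi i b = 0 := (isRegular_unit n).phi_eq i b
    have h2 : (columns n 0 α).eps i b = 0 := (isRegular_unit n).eps_eq i b
    rw [h1, h2]
    simp [weight]
  | succ m ih =>
    obtain ⟨s, b⟩ := b
    obtain ⟨⟨h1, h2⟩, h3⟩ := h
    have hA := column_regular hn (α 0)
    have hB := columns_regular hn m fun i => α i.succ
    have hphi : (columns n (m + 1) α).phi i (s, b) = (column n (α 0)).phi i s +
        ((columns n m fun i => α i.succ).phi i b - (column n (α 0)).eps i s) :=
      tensor_phi hA hB i (s, b)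
    have heps : (columns n (m + 1) α).eps i (s, b) = (columns n m fun i => α i.succ).eps i b +
        ((column n (α 0)).eps i s - (columns n m fun i => α i.succ).phi i b) :=
      tensor_eps hA hB i (s, b)
    have h4 : i + 1 ∈ s.1 → i + 1 ∈ Z := @h1 (i + 1)
    have h5 : i ∈ s.1 → i + 1 ∈ Z → i + 1 ∈ s.1 := h2 i
    have hfl := IsWalk.flux h3 i
    have hn0 := weight_nonneg m (fun i => α i.succ) b i
    have hn1 := weight_nonneg m (fun i => α i.succ) b (i + 1)
    have hm : i + 1 ∈ hop Z s.1 ↔ (i + 1 ∈ Z ∧ i + 1 ∉ s.1) ∨ i ∈ s.1 :=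
      mem_hop_add_one_iff i
    obtain ⟨ih1, ih2⟩ := ih h3
    rw [hphi, heps, column_phi hn, column_eps hn]
    change _ = (if i + 1 ∉ Z ∧ 0 < (if i ∈ s.1 then 1 else 0) +
        weight n m (fun i => α i.succ) b i then 1 else 0) ∧
      _ = (if i + 1 ∉ Z' ∧ 0 < (if i + 1 ∈ s.1 then 1 else 0) +
        weight n m (fun i => α i.succ) b (i + 1) then 1 else 0)
    change (columns n m fun i => α i.succ).phi i b =
      (if i + 1 ∉ hop Z s.1 ∧ 0 < weight n m (fun i => α i.succ) b i then 1 else 0) at ih1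
    change (columns n m fun i => α i.succ).eps i b =
      (if i + 1 ∉ Z' ∧ 0 < weight n m (fun i => α i.succ) b (i + 1) then 1 else 0) at ih2
    change (if i + 1 ∈ Z' then (1 : ℤ) else 0) = (if i + 1 ∈ hop Z s.1 then 1 else 0) -
      weight n m (fun i => α i.succ) b (i + 1) + weight n m (fun i => α i.succ) b i at hfl
    simp only [hm] at ih1 hfl
    generalize weight n m (fun i => α i.succ) b (i + 1) = w1 at *
    generalize weight n m (fun i => α i.succ) b i = w0 at *
    generalize (columns n m fun i => α i.succ).phi i b = p at *
    generalize (columns n m fun i => α i.succ).eps i b = e at *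
    clear ih hA hB hphi heps h1 h2 hm h3
    by_cases e1 : i ∈ s.1 <;> by_cases e2 : i + 1 ∈ s.1 <;> by_cases e3 : i + 1 ∈ Z <;>
      by_cases e4 : i + 1 ∈ Z' <;> simp [e1, e2, e3, e4] at h4 h5 hfl ih1 ih2 ⊢ <;>
      (try split_ifs at *) <;> omega

theorem val_sub_val_sub_one {n : ℕ} (hn : 2 ≤ n) (x : ZMod n) :
    (x.val : ℤ) - (x - 1).val = 1 - n * (if x = 0 then 1 else 0) := by
  by_cases h : x = 0
  · obtain ⟨n, rfl⟩ : ∃ k, n = k + 1 := ⟨n - 1, by omega⟩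
    rw [h, zero_sub, ZMod.val_neg_one]
    simp
  · have := val_add_one_of_ne hn (i := x - 1) fun e => h (by linear_combination e)
    rw [sub_add_cancel] at this
    rw [if_neg h]
    omega

theorem sum_val_bstring {n k : ℕ} (hk : k ≤ n) (μ : BoxPartition n k) :
    ∑ y ∈ bstring n μ.parts, ((y - 1).val : ℤ) = μ.size + ∑ i : Fin k, ((k : ℤ) - i - 1) := by
  have hinj := Finset.card_image_iff.1
    ((card_bstring hk μ.anti μ.le).trans (Finset.card_fin k).symm)
  rw [bstring, Finset.sum_image hinj, BoxPartition.size, Nat.cast_sum, ← Finset.sum_add_distrib]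
  refine Finset.sum_congr rfl fun i _ => ?_
  have h1 := i.2
  have h2 := μ.le i
  have h3 : ((μ.parts i + (k - (i : ℕ)) : ℕ) : ZMod n) - 1 =
      ((μ.parts i + (k - (i : ℕ)) - 1 : ℕ) : ZMod n) := by
    rw [Nat.cast_sub (by omega), Nat.cast_one]
  rw [h3, ZMod.val_cast_of_lt (by omega)]
  omega

theorem indicator_bstring {n k : ℕ} (hn : n ≠ 0) (hk : k ≤ n) (μ : BoxPartition n k)
    (y : ZMod n) : (if y ∈ bstring n μ.parts then (1 : ℤ) else 0) =
      1 - if -y + 1 ∈ zeroSet μ then 1 else 0 := by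
  have h := mem_zeroSet_iff_bstring hn hk μ (-y + 1)
  rw [show 1 - (-y + 1) = y by ring] at h
  by_cases h1 : y ∈ bstring n μ.parts <;> simp [h, h1]

/-- The degree of a walk is the number of hops out of the position `0`. -/
theorem mul_weight_zero_of_mem_walks {n k m : ℕ} [NeZero n] (hn : 2 ≤ n) (hk : k ≤ n)
    {α : Fin m → ℕ} {μ ν : BoxPartition n k} {b : (columns n m α).V} (hb : b ∈ walks α μ ν) :
    n * weight n m α b 0 = (∑ i, (α i : ℤ)) + μ.size - ν.size := by
  have hdiff : (ν.size : ℤ) - μ.size =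
      ∑ y : ZMod n, ((y - 1).val : ℤ) * (weight n m α b (-y + 1) - weight n m α b (-y)) := by
    have h1 := sum_val_bstring hk μ
    have h2 := sum_val_bstring hk ν
    rw [show (ν.size : ℤ) - μ.size = ∑ y ∈ bstring n ν.parts, ((y - 1).val : ℤ) -
      ∑ y ∈ bstring n μ.parts, ((y - 1).val : ℤ) by rw [h1, h2]; ring]
    rw [← Finset.univ_inter (bstring n ν.parts), ← Finset.univ_inter (bstring n μ.parts),
      ← Finset.sum_ite_mem, ← Finset.sum_ite_mem, ← Finset.sum_sub_distrib]
    refine Finset.sum_congr rfl fun y _ => ?_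
    have h3 := indicator_bstring (NeZero.ne n) hk μ y
    have h4 := indicator_bstring (NeZero.ne n) hk ν y
    have h5 := IsWalk.flux hb (-y)
    have h6 : (if y ∈ bstring n ν.parts then (1 : ℤ) else 0) -
        (if y ∈ bstring n μ.parts then 1 else 0) =
        weight n m α b (-y + 1) - weight n m α b (-y) := by
      rw [h3, h4, h5]; ring
    rw [← h6, mul_sub, mul_ite, mul_ite, mul_one, mul_zero]
  have hs1 : ∑ y : ZMod n, ((y - 1).val : ℤ) * weight n m α b (-y + 1) =
      ∑ z : ZMod n, ((-z).val : ℤ) * weight n m α b z := by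
    rw [← Equiv.sum_comp (Equiv.subLeft (1 : ZMod n))]
    refine Finset.sum_congr rfl fun z _ => ?_
    rw [Equiv.subLeft_apply, show (1 : ZMod n) - z - 1 = -z by ring,
      show -(1 - z) + 1 = z by ring]
  have hs2 : ∑ y : ZMod n, ((y - 1).val : ℤ) * weight n m α b (-y) =
      ∑ z : ZMod n, ((-z - 1).val : ℤ) * weight n m α b z := by
    rw [← Equiv.sum_comp (Equiv.neg (ZMod n))]
    refine Finset.sum_congr rfl fun z _ => ?_
    rw [Equiv.neg_apply, neg_neg]
  have hs3 : ∀ z : ZMod n, ((-z).val : ℤ) * weight n m α b z -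
      ((-z - 1).val : ℤ) * weight n m α b z =
      weight n m α b z - if z = 0 then n * weight n m α b z else 0 := by
    intro z
    rw [← sub_mul, val_sub_val_sub_one hn]
    by_cases h : z = 0
    · simp [h]; ring
    · simp [h]
  simp only [mul_sub, Finset.sum_sub_distrib] at hdiff
  rw [hs1, hs2, ← Finset.sum_sub_distrib, Finset.sum_congr rfl fun z _ => hs3 z,
    Finset.sum_sub_distrib, sum_weight, Finset.sum_ite_eq', if_pos (Finset.mem_univ _)] at hdiff
  linarith

theorem partialSum_succ {n k : ℕ} (μ : BoxPartition n k) {i : ℕ} (hi : i ≤ n) :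
    (partialSum μ (i + 1) : ℤ) =
      partialSum μ i + if ((n - i : ℕ) : ZMod n) ∈ bstring n μ.parts then 1 else 0 := by
  have h1 : Finset.Icc (n + 1 - (i + 1)) n = insert (n - i) (Finset.Icc (n + 1 - i) n) := by
    ext j
    simp only [Finset.mem_Icc, Finset.mem_insert]
    omega
  rw [partialSum, partialSum, h1, Finset.filter_insert]
  split_ifs with h
  · rw [Finset.card_insert_of_notMem (fun hm => by
      have := Finset.mem_Icc.1 (Finset.mem_filter.1 hm).1; omega)]
    push_cast; rfl
  · simp

/-- `θ_i` counts the hops out of the position `i`. -/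
theorem theta_eq_weight {n k m : ℕ} [NeZero n] (hk : k ≤ n) {α : Fin m → ℕ}
    {μ ν : BoxPartition n k} {b : (columns n m α).V} (hb : b ∈ walks α μ ν) {i : ℕ}
    (hi : i ≤ n + 1) : theta μ ν (weight n m α b 0) i = weight n m α b (i : ZMod n) := by
  induction i with
  | zero =>
    have h : ∀ κ : BoxPartition n k, partialSum κ 0 = 0 := fun κ => by simp [partialSum]
    simp [theta, h]
  | succ i ih =>
    have h1 := ih (by omega)
    have h2 := partialSum_succ μ (i := i) (by omega)
    have h3 := partialSum_succ ν (i := i) (by omega)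
    have h4 := IsWalk.flux hb (i : ZMod n)
    rw [indicator_bstring (NeZero.ne n) hk, Nat.cast_sub (by omega), ZMod.natCast_self,
      zero_sub, neg_neg] at h2 h3
    rw [theta] at h1 ⊢
    rw [Nat.cast_succ]
    linarith

theorem signatureCond_of_mem_walks {n k : ℕ} [NeZero n] (hn : 2 ≤ n) (hk : k ≤ n)
    {α : Fin k → ℕ} {μ ν : BoxPartition n k} {b : (columns n k α).V} (hb : b ∈ walks α μ ν) :
    SignatureCond α μ ν b := by
  refine ⟨weight n k α b 0, mul_weight_zero_of_mem_walks hn hk hb, fun i hi => ?_⟩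
  have hi' := Finset.mem_Icc.1 hi
  obtain ⟨h1, h2⟩ := IsWalk.phi_eps hn hb (i : ZMod n)
  have h3 : ∀ κ : BoxPartition n k,
      ((n - i : ℕ) : ZMod n) ∈ bstring n κ.parts ↔ (i : ZMod n) + 1 ∉ zeroSet κ := by
    intro κ
    rw [mem_zeroSet_iff_bstring (NeZero.ne n) hk, not_not, Nat.cast_sub hi'.2,
      ZMod.natCast_self, zero_sub, show (1 : ZMod n) - ((i : ZMod n) + 1) = -i by ring]
  rw [theta_eq_weight hk hb (by omega), theta_eq_weight hk hb (by omega), Nat.cast_succ]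
  simp only [h3]
  exact ⟨h1, h2⟩

/-- The vertices that satisfy the signature condition and the R-matrix condition are the walks. -/
theorem crystalSet_eq_walks {n k : ℕ} [NeZero n] (hn : 2 ≤ n) (hk : k ≤ n) (α : Fin k → ℕ)
    (hα : ∀ i, α i ≤ n - k) (μ ν : BoxPartition n k) : crystalSet α μ ν = walks α μ ν := by
  ext b
  constructor
  · exact fun h => (rMatrixCond_iff hn hk α hα μ ν b).1 h.2
  · exact fun h => ⟨signatureCond_of_mem_walks hn hk h, (rMatrixCond_iff hn hk α hα μ ν b).2 h⟩

end QKostka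

end

theorem mainTheorem2 (n k : ℕ) (hn : 3 ≤ n) (hk : k ≤ n) :
    -- the expansion in Schubert classes that defines the quantum Kostka numbers exists, is unique,
    -- and contains `q ^ d • σ_ν` only for the degree `d` given by `n d = |lam| + |μ| - |ν|`
    (∀ lam μ : QKostka.BoxPartition n k,
      (∃! c : QKostka.BoxPartition n k → Polynomial ℤ, QKostka.IsExpansion lam μ c) ∧
      ∀ (ν : QKostka.BoxPartition n k) (d : ℕ), n * d + ν.size ≠ lam.size + μ.size →
        (QKostka.expansion lam μ ν).coeff d = 0) ∧
    -- (i)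
    (∀ lam μ ν : QKostka.BoxPartition n k,
      QKostka.quantumKostka lam μ ν = ((QKostka.dimersWith lam.parts μ ν).ncard : ℤ) ∧
      QKostka.quantumKostka lam μ ν = ((QKostka.crystalSet lam.parts μ ν).ncard : ℤ)) ∧
    -- (ii)
    (∀ μ ν : QKostka.BoxPartition n k,
      (QKostka.dimers μ ν).ncard =
        ∑ α : Fin k → Fin (n - k + 1), (QKostka.dimersWith (fun i => (α i : ℕ)) μ ν).ncard ∧
      ((QKostka.dimers μ ν).ncard : ℚ) =
        ∑ lam : QKostka.BoxPartition n k, (QKostka.quantumKostka lam μ ν : ℚ) *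
          ((Nat.factorial lam.length : ℚ) /
            ∏ m ∈ Finset.Icc 1 (n - k), (Nat.factorial (lam.mult m) : ℚ)) *
          (Nat.choose k lam.length : ℚ)) := by
  have hn0 : n ≠ 0 := by omega
  have : NeZero n := ⟨hn0⟩
  refine ⟨fun lam μ => ⟨QKostka.existsUnique_isExpansion hn0 hk lam μ, fun ν d hd => ?_⟩,
    fun lam μ ν => ⟨?_, ?_⟩, fun μ ν => ⟨QKostka.card_dimers hk μ ν, ?_⟩⟩
  · rw [QKostka.coeff_expansion hn0 hk, if_neg hd]
  · rw [QKostka.quantumKostka_eq hn0 hk, QKostka.card_dimersWith hk]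
  · rw [QKostka.quantumKostka_eq hn0 hk, QKostka.crystalSet_eq_walks (by omega) hk _ lam.le,
      Nat.card_coe_set_eq]
  · rw [QKostka.card_dimers hk μ ν, ← QKostka.sum_card_walks hn0 hk μ ν]
    simp only [QKostka.card_dimersWith hk]
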